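/- Let $\gamma\in(0,1)$, let $b:(0,\infty)\times\mathbb R\to\mathbb R$ be (Borel) measurable and bounded, $\sup_{t,x}|b(t,x)|<\infty$, and consider $$u_t=\tfrac12u_{xx}+\frac{b(t,x)}{|x|^{\gamma}}\,u_x\qquad(1)$$ (at $x=0$ the coefficient $b(t,x)|x|^{-\gamma}$ is given the value $0$). For $0\le s<t$ and $x,y\in\mathbb R$ put $$Z(t,x,s,y)=(2\pi(t-s))^{-1/2}\exp\Big\{-\frac{(x-y)^2}{2(t-s)}\Big\},\qquad \Phi_1(t,x,s,y)=\frac{b(t,x)}{|x|^\gamma}\,\partial_xZ(t,x,s,y),$$ $$(f*g)(t,x,s,y)=\int_s^t dr\int_{\mathbb R}f(t,x,r,z)\,g(r,z,s,y)\,dz,\qquad \Phi_{m+1}=\Phi_1*\Phi_m\quad(m\ge1).$$ Then the following hold for all $0\le s<t$ and $x,y\in\mathbb R$. 1. The double integrals defining all $\Phi_m$ converge absolutely, and the Neumann series $\Phi=\sum_{m\ge1}\Phi_m$ converges absolutely. 2. The double integral defining $\Phi_1*\Phi$ converges absolutely, and $\Phi$ solves the Volterra equation $\Phi=\Phi_1+\Phi_1*\Phi$.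 3. The double integrals defining $Z*\Phi$ and all $Z*\Phi_m$ and the series $\sum_{m\ge1}Z*\Phi_m$ converge absolutely, and $$p:=Z+Z*\Phi=Z+\sum_{m\ge1}Z*\Phi_m$$ is a fundamental solution of the Cauchy problem for (1). Here $p(t,x,s,y)$, $0\le s<t$, is called a fundamental solution if * it is measurable; * for all fixed $s\ge0$, $y\in\mathbb R$ the function $u(t,x)=p(t,x,s,y)$ is a strong solution of (1) on $(s,\infty)\times\mathbb R$: $u$ is continuous, the classical derivative $u_x$ exists everywhere and is continuous, $u_t$ and $u_{xx}=(u_x)_x$ exist as weak derivatives in $L^1_{\rm loc}((s,\infty)\times\mathbb R)$, and (1) holds almost everywhere; * $p(t,x,s,\cdot)$ is integrable on $\mathbb R$ for all $0\le s<t$, $x\in\mathbb R$, and $\lim_{t\to s+}\int_{\mathbb R}p(t,x,s,y)f(y)\,dy=f(x)$ for every bounded continuous $f$ and all $s\ge0$, $x\in\mathbb R$. -/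

import Mathlib

open Set Filter Topology MeasureTheory
open scoped ContDiff

noncomputable section

/-- Functions of the four real variables `(t, x, s, y)`. -/
abbrev ParabolicKernel : Type := ℝ → ℝ → ℝ → ℝ → ℝ

/-- The Gaussian heat kernel
`Z(t,x,s,y) = (2π(t-s))^{-1/2} exp(-(x-y)²/(2(t-s)))`, used for `s < t` only. -/
def heatZ : ParabolicKernel := fun t x s y =>
  (2 * Real.pi * (t - s)) ^ (-(1 / 2) : ℝ) * Real.exp (-(1 / 2) * ((x - y) ^ 2 / (t - s)))

/-- The first order coefficient `b(t,x) / |x|^γ` of the equation. On the null set `x = 0` it takes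
the conventional value `0`. -/
def drift (γ : ℝ) (b : ℝ → ℝ → ℝ) (t x : ℝ) : ℝ := b t x / |x| ^ γ

/-- The space-time convolution
`(f * g)(t,x,s,y) = ∫_s^t dr ∫_ℝ f(t,x,r,z) g(r,z,s,y) dz`. -/
def stConv (f g : ParabolicKernel) : ParabolicKernel := fun t x s y =>
  ∫ r in s..t, ∫ z : ℝ, f t x r z * g r z s y

/-- Absolute convergence of the double integral that defines `stConv f g t x s y`. -/
def StConvIntegrable (f g : ParabolicKernel) (t x s y : ℝ) : Prop :=
  IntegrableOn (fun q : ℝ × ℝ => f t x q.1 q.2 * g q.1 q.2 s y) (Ioo s t ×ˢ univ)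

/-- The kernel `Φ₁(t,x,s,y) = b(t,x) |x|^{-γ} ∂Z/∂x (t,x,s,y)` of the Volterra equation. -/
def leviKernel (γ : ℝ) (b : ℝ → ℝ → ℝ) : ParabolicKernel := fun t x s y =>
  drift γ b t x * deriv (fun ξ => heatZ t ξ s y) x

/-- The iterated kernels, numbered from zero: `leviTerm γ b m` is `Φ_{m+1}`, where
`Φ_{m+1} = Φ₁ * Φ_m`. -/
def leviTerm (γ : ℝ) (b : ℝ → ℝ → ℝ) : ℕ → ParabolicKernel
  | 0 => leviKernel γ b
  | m + 1 => stConv (leviKernel γ b) (leviTerm γ b m)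

/-- The Neumann series `Φ = ∑_{m ≥ 1} Φ_m`. -/
def leviSeries (γ : ℝ) (b : ℝ → ℝ → ℝ) : ParabolicKernel := fun t x s y =>
  ∑' m : ℕ, leviTerm γ b m t x s y

/-- `v` is the weak derivative of `u` in the direction `e` on the open set `Q` of the
`(t,x)`-plane: both are locally integrable on `Q` and `∫ u ∂_e φ = - ∫ v φ` for every smooth
function `φ` with compact support in `Q`. -/
structure HasWeakDerivOn (e : ℝ × ℝ) (u v : ℝ × ℝ → ℝ) (Q : Set (ℝ × ℝ)) : Prop where
  locallyIntegrableOn : LocallyIntegrableOn u Q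
  locallyIntegrableOn_deriv : LocallyIntegrableOn v Q
  integral_eq : ∀ φ : ℝ × ℝ → ℝ, ContDiff ℝ ∞ φ → HasCompactSupport φ → tsupport φ ⊆ Q →
    ∫ q in Q, u q * fderiv ℝ φ q e = - ∫ q in Q, v q * φ q

/-- `u` is a strong solution of `u_t = (1/2) u_xx + a(t,x) u_x` on `(s,∞) × ℝ`, where `a` is
merely measurable: `u` is continuous, the classical derivative `u_x` exists everywhere and is
continuous, `u_t` and `u_xx = (u_x)_x` exist as locally integrable weak derivatives, and the
equation holds at almost every point. -/
def IsStrongSolution (a : ℝ → ℝ → ℝ) (s : ℝ) (u : ℝ → ℝ → ℝ) : Prop :=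
  ∃ ut ux uxx : ℝ × ℝ → ℝ,
    ContinuousOn (Function.uncurry u) (Ioi s ×ˢ univ) ∧
    ContinuousOn ux (Ioi s ×ˢ univ) ∧
    (∀ t x : ℝ, s < t → HasDerivAt (fun ξ => u t ξ) (ux (t, x)) x) ∧
    HasWeakDerivOn (1, 0) (Function.uncurry u) ut (Ioi s ×ˢ univ) ∧
    HasWeakDerivOn (0, 1) ux uxx (Ioi s ×ˢ univ) ∧
    ∀ᵐ q : ℝ × ℝ, s < q.1 → ut q = 1 / 2 * uxx q + a q.1 q.2 * ux q

/-- `p(t,x,s,y)`, `0 ≤ s < t`, is a fundamental solution of the Cauchy problem for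
`u_t = (1/2) u_xx + a(t,x) u_x`: it is measurable, it solves the equation in `(t,x)` for all fixed
`(s,y)`, and `∫ p(t,x,s,y) f(y) dy → f(x)` as `t → s+` for every bounded continuous `f`
and every `x`. Only the values of `p` at `0 ≤ s < t` matter. -/
structure IsFundamentalSolution (a : ℝ → ℝ → ℝ) (p : ParabolicKernel) : Prop where
  measurable : Measurable
    (({q : ℝ × ℝ × ℝ × ℝ | 0 ≤ q.2.2.1 ∧ q.2.2.1 < q.1} : Set (ℝ × ℝ × ℝ × ℝ)).domRestrict
      (fun q => p q.1 q.2.1 q.2.2.1 q.2.2.2))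
  solves : ∀ s y : ℝ, 0 ≤ s → IsStrongSolution a s (fun t x => p t x s y)
  integrable : ∀ t x s : ℝ, 0 ≤ s → s < t → Integrable (fun y => p t x s y)
  initial : ∀ f : ℝ → ℝ, Continuous f → (∃ C : ℝ, ∀ x, |f x| ≤ C) → ∀ s x : ℝ, 0 ≤ s →
    Tendsto (fun t => ∫ y : ℝ, p t x s y * f y) (𝓝[>] s) (𝓝 (f x))

end

/-- The centred Gaussian density of variance `v`; it vanishes for `v ≤ 0`. -/
noncomputable def gauss (v x : ℝ) : ℝ :=
  (2 * Real.pi * v) ^ (-(1 / 2) : ℝ) * Real.exp (-(1 / 2) * (x ^ 2 / v))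

/-- The first derivative of `gauss v`. -/
noncomputable def gauss1 (v x : ℝ) : ℝ := -(x / v) * gauss v x

/-- The second derivative of `gauss v`. -/
noncomputable def gauss2 (v x : ℝ) : ℝ := (x ^ 2 / v ^ 2 - 1 / v) * gauss v x

theorem heatZ_eq_gauss (t x s y : ℝ) : heatZ t x s y = gauss (t - s) (x - y) := rfl

theorem gauss_of_nonpos {v : ℝ} (hv : v ≤ 0) (x : ℝ) : gauss v x = 0 := by
  have h : (2 * Real.pi * v) ^ (-(1 / 2) : ℝ) = 0 := by
    rcases hv.eq_or_lt with rfl | hv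
    · rw [mul_zero, Real.zero_rpow (by norm_num)]
    · rw [Real.rpow_def_of_neg (mul_neg_of_pos_of_neg Real.two_pi_pos hv)]
      have : -(1 / 2) * Real.pi = -(Real.pi / 2) := by ring
      rw [this, Real.cos_neg, Real.cos_pi_div_two, mul_zero]
  rw [gauss, h, zero_mul]

theorem gauss1_of_nonpos {v : ℝ} (hv : v ≤ 0) (x : ℝ) : gauss1 v x = 0 := by
  rw [gauss1, gauss_of_nonpos hv, mul_zero]

theorem gauss2_of_nonpos {v : ℝ} (hv : v ≤ 0) (x : ℝ) : gauss2 v x = 0 := by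
  rw [gauss2, gauss_of_nonpos hv, mul_zero]

theorem gauss_pos {v : ℝ} (hv : 0 < v) (x : ℝ) : 0 < gauss v x :=
  mul_pos (Real.rpow_pos_of_pos (mul_pos Real.two_pi_pos hv) _) (Real.exp_pos _)

theorem gauss_nonneg (v x : ℝ) : 0 ≤ gauss v x := by
  rcases le_or_gt v 0 with hv | hv
  · rw [gauss_of_nonpos hv]
  · exact (gauss_pos hv x).le

theorem gauss_neg (v x : ℝ) : gauss v (-x) = gauss v x := by simp [gauss]

theorem gauss_sub_comm (v x y : ℝ) : gauss v (x - y) = gauss v (y - x) := by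
  rw [← gauss_neg, neg_sub]

theorem gauss2_sub_comm (v x y : ℝ) : gauss2 v (x - y) = gauss2 v (y - x) := by
  rw [gauss2, gauss2, gauss_sub_comm v x y, ← neg_sub y x, neg_sq]

theorem measurable_gauss : Measurable (Function.uncurry gauss) := by
  unfold gauss Function.uncurry
  fun_prop

theorem Measurable.gauss {α : Type*} [MeasurableSpace α] {f g : α → ℝ} (hf : Measurable f)
    (hg : Measurable g) : Measurable (fun a => gauss (f a) (g a)) :=
  measurable_gauss.comp (hf.prodMk hg)

theorem Measurable.gauss1 {α : Type*} [MeasurableSpace α] {f g : α → ℝ} (hf : Measurable f)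
    (hg : Measurable g) : Measurable (fun a => gauss1 (f a) (g a)) :=
  ((hg.div hf).neg).mul (hf.gauss hg)

theorem Measurable.gauss2 {α : Type*} [MeasurableSpace α] {f g : α → ℝ} (hf : Measurable f)
    (hg : Measurable g) : Measurable (fun a => gauss2 (f a) (g a)) :=
  (((hg.pow_const 2).div (hf.pow_const 2)).sub (measurable_const.div hf)).mul (hf.gauss hg)

theorem gauss_eq_gaussianPDFReal {v : ℝ} (hv : 0 < v) (m x : ℝ) :
    gauss v (x - m) = ProbabilityTheory.gaussianPDFReal m v.toNNReal x := by
  rw [gauss, ProbabilityTheory.gaussianPDFReal_def, Real.rpow_neg (by positivity),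
    Real.sqrt_eq_rpow, Real.coe_toNNReal v hv.le]
  congr 2
  field_simp

theorem integrable_gauss (v m : ℝ) : Integrable (fun x => gauss v (x - m)) := by
  rcases le_or_gt v 0 with hv | hv
  · simp [gauss_of_nonpos hv]
  · simp_rw [gauss_eq_gaussianPDFReal hv]
    exact ProbabilityTheory.integrable_gaussianPDFReal _ _

theorem integrable_gauss' (v m : ℝ) : Integrable (fun x => gauss v (m - x)) := by
  simp_rw [gauss_sub_comm v m]
  exact integrable_gauss v m

theorem integral_gauss {v : ℝ} (hv : 0 < v) (m : ℝ) : ∫ x, gauss v (x - m) = 1 := by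
  simp_rw [gauss_eq_gaussianPDFReal hv]
  exact ProbabilityTheory.integral_gaussianPDFReal_eq_one _ (Real.toNNReal_pos.2 hv).ne'

theorem integral_gauss' {v : ℝ} (hv : 0 < v) (m : ℝ) : ∫ x, gauss v (m - x) = 1 := by
  simp_rw [gauss_sub_comm v m]
  exact integral_gauss hv m

theorem lintegral_gauss {v : ℝ} (hv : 0 < v) (m : ℝ) :
    ∫⁻ x, ENNReal.ofReal (gauss v (x - m)) = 1 := by
  rw [← ofReal_integral_eq_lintegral_ofReal (integrable_gauss v m)
    (Eventually.of_forall fun _ => gauss_nonneg _ _), integral_gauss hv, ENNReal.ofReal_one]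

theorem gauss_le_rpow {v : ℝ} (hv : 0 < v) (x : ℝ) : gauss v x ≤ v ^ (-(1 / 2) : ℝ) := by
  rw [gauss, Real.mul_rpow Real.two_pi_pos.le hv.le, mul_right_comm]
  refine mul_le_of_le_one_left (by positivity) (mul_le_one₀ ?_ (Real.exp_pos _).le ?_)
  · refine Real.rpow_le_one_of_one_le_of_nonpos ?_ (by norm_num)
    nlinarith [Real.pi_gt_three]
  · refine Real.exp_le_one_iff.2 ?_
    have : 0 ≤ x ^ 2 / v := by positivity
    linarith

theorem hasDerivAt_gauss (v x : ℝ) : HasDerivAt (gauss v) (gauss1 v x) x := by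
  rcases le_or_gt v 0 with hv | hv
  · have : gauss v = fun _ => 0 := funext fun x => gauss_of_nonpos hv x
    rw [gauss1_of_nonpos hv, this]
    exact hasDerivAt_const _ _
  · have h := ((((hasDerivAt_id x).pow 2).div_const v).const_mul (-(1 / 2) : ℝ)).exp.const_mul
      ((2 * Real.pi * v) ^ (-(1 / 2) : ℝ))
    refine h.congr_deriv ?_
    simp only [gauss1, gauss, id, Pi.pow_apply]
    field_simp
    ring_nf

theorem hasDerivAt_gauss1 (v x : ℝ) : HasDerivAt (gauss1 v) (gauss2 v x) x := by
  have h := (((hasDerivAt_id x).div_const v).neg).mul (hasDerivAt_gauss v x)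
  refine h.congr_deriv ?_
  simp only [gauss1, gauss2, id, Pi.neg_apply]
  ring

theorem hasDerivAt_gauss_sub (v x y : ℝ) :
    HasDerivAt (fun x => gauss v (x - y)) (gauss1 v (x - y)) x :=
  HasDerivAt.comp_sub_const x y (hasDerivAt_gauss v (x - y))

theorem hasDerivAt_gauss1_sub (v x y : ℝ) :
    HasDerivAt (fun x => gauss1 v (x - y)) (gauss2 v (x - y)) x :=
  HasDerivAt.comp_sub_const x y (hasDerivAt_gauss1 v (x - y))

theorem hasDerivAt_gauss_var {v : ℝ} (hv : 0 < v) (x : ℝ) :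
    HasDerivAt (fun v => gauss v x) (1 / 2 * gauss2 v x) v := by
  have h1 : HasDerivAt (fun v : ℝ => (2 * Real.pi * v) ^ (-(1 / 2) : ℝ))
      (-(1 / 2) * (2 * Real.pi * v) ^ (-(1 / 2) : ℝ) / v) v := by
    have h := ((hasDerivAt_id v).const_mul (2 * Real.pi)).rpow_const (p := -(1 / 2))
      (Or.inl (mul_pos Real.two_pi_pos hv).ne')
    refine h.congr_deriv ?_
    rw [id, Real.rpow_sub_one (mul_pos Real.two_pi_pos hv).ne']
    have := Real.pi_pos
    field_simp
  have h2 := (((hasDerivAt_inv hv.ne').const_mul (x ^ 2)).const_mul (-(1 / 2) : ℝ)).exp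
  refine (h1.mul h2).congr_deriv ?_
  simp only [gauss2, gauss, div_eq_mul_inv]
  ring

theorem continuousOn_gauss : ContinuousOn (Function.uncurry gauss) (Ioi 0 ×ˢ univ) := by
  unfold gauss Function.uncurry
  refine ContinuousOn.mul (ContinuousOn.rpow_const (by fun_prop) ?_) (Real.continuous_exp.comp_continuousOn ?_)
  · rintro ⟨v, x⟩ ⟨hv, -⟩
    exact Or.inl (mul_pos Real.two_pi_pos hv).ne'
  · refine continuousOn_const.mul (ContinuousOn.div (by fun_prop) (by fun_prop) ?_)
    rintro ⟨v, x⟩ ⟨hv, -⟩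
    exact (ne_of_gt hv)

theorem continuousOn_gauss1 : ContinuousOn (Function.uncurry gauss1) (Ioi 0 ×ˢ univ) := by
  have : Function.uncurry gauss1 = fun p => -(p.2 / p.1) * Function.uncurry gauss p := rfl
  rw [this]
  refine ContinuousOn.mul (ContinuousOn.neg (ContinuousOn.div (by fun_prop) (by fun_prop) ?_))
    continuousOn_gauss
  rintro ⟨v, x⟩ ⟨hv, -⟩
  exact (ne_of_gt hv)

theorem continuousOn_gauss2 : ContinuousOn (Function.uncurry gauss2) (Ioi 0 ×ˢ univ) := by
  have : Function.uncurry gauss2 =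
    fun p => (p.2 ^ 2 / p.1 ^ 2 - 1 / p.1) * Function.uncurry gauss p := rfl
  rw [this]
  have h : ∀ p ∈ (Ioi 0 ×ˢ univ : Set (ℝ × ℝ)), p.1 ≠ 0 := fun p hp => (ne_of_gt hp.1)
  exact ContinuousOn.mul ((ContinuousOn.div (by fun_prop) (by fun_prop)
    fun p hp => pow_ne_zero 2 (h p hp)).sub (ContinuousOn.div (by fun_prop) (by fun_prop) h))
    continuousOn_gauss

theorem exists_rpow_mul_exp_neg_le {q : ℝ} (hq : 0 ≤ q) :
    ∃ C : ℝ, 0 < C ∧ ∀ y : ℝ, 0 ≤ y → y ^ q * Real.exp (-y) ≤ C := by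
  refine ⟨Nat.factorial ⌈q⌉₊ + 1, by positivity, fun y hy => ?_⟩
  rw [Real.exp_neg, ← div_eq_mul_inv, div_le_iff₀ (Real.exp_pos y)]
  rcases le_total y 1 with h | h
  · have h1 : y ^ q ≤ 1 := Real.rpow_le_one hy h hq
    have h2 : 1 ≤ Real.exp y := Real.one_le_exp hy
    have h3 : (0 : ℝ) < Nat.factorial ⌈q⌉₊ := by positivity
    nlinarith
  · have h1 : y ^ q ≤ y ^ ⌈q⌉₊ := by
      rw [← Real.rpow_natCast]
      exact Real.rpow_le_rpow_of_exponent_le h (Nat.le_ceil q)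
    have h2 := Real.pow_div_factorial_le_exp y hy ⌈q⌉₊
    rw [div_le_iff₀ (by positivity)] at h2
    nlinarith [Real.exp_pos y]

/-- Powers of `|x|` are absorbed by a Gaussian at the cost of doubling the variance. -/
theorem exists_abs_rpow_mul_gauss_le {p : ℝ} (hp : 0 ≤ p) :
    ∃ C : ℝ, 0 < C ∧ ∀ v x : ℝ, 0 < v → |x| ^ p * gauss v x ≤ C * v ^ (p / 2) * gauss (2 * v) x := by
  obtain ⟨C, hC, h⟩ := exists_rpow_mul_exp_neg_le (q := p / 2) (by positivity)
  refine ⟨2 ^ (1 / 2 : ℝ) * 4 ^ (p / 2) * C, by positivity, fun v x hv => ?_⟩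
  set y := x ^ 2 / (4 * v) with hy
  have hy0 : 0 ≤ y := by positivity
  have h1 : |x| ^ p = 4 ^ (p / 2) * v ^ (p / 2) * y ^ (p / 2) := by
    rw [← Real.mul_rpow (by norm_num) hv.le, ← Real.mul_rpow (by positivity) hy0]
    have : 4 * v * y = |x| ^ (2 : ℝ) := by
      rw [hy, Real.rpow_two, sq_abs]; field_simp
    rw [this, ← Real.rpow_mul (abs_nonneg x)]
    congr 1; ring
  have h2 : gauss v x = 2 ^ (1 / 2 : ℝ) * gauss (2 * v) x * Real.exp (-y) := by
    rw [gauss, gauss, show 2 * Real.pi * (2 * v) = 2 * (2 * Real.pi * v) by ring,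
      Real.mul_rpow (x := 2) (y := 2 * Real.pi * v) (by norm_num) (by positivity)]
    have e : Real.exp (-(1 / 2) * (x ^ 2 / v)) =
        Real.exp (-(1 / 2) * (x ^ 2 / (2 * v))) * Real.exp (-y) := by
      rw [← Real.exp_add, hy]; congr 1; field_simp; ring
    have e2 : (2 : ℝ) ^ (1 / 2 : ℝ) * 2 ^ (-(1 / 2) : ℝ) = 1 := by
      rw [← Real.rpow_add (by norm_num)]; norm_num
    rw [e]
    linear_combination (-(2 * Real.pi * v) ^ (-(1 / 2) : ℝ) *
        (Real.exp (-(1 / 2) * (x ^ 2 / (2 * v))) * Real.exp (-y))) * e2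
  have h3 := h y hy0
  have hg := gauss_nonneg (2 * v) x
  calc |x| ^ p * gauss v x
      = 2 ^ (1 / 2 : ℝ) * 4 ^ (p / 2) * (y ^ (p / 2) * Real.exp (-y)) * v ^ (p / 2) *
        gauss (2 * v) x := by rw [h1, h2]; ring
    _ ≤ _ := by gcongr

theorem exists_gauss_le : ∃ C : ℝ, 0 < C ∧ ∀ v x : ℝ, 0 < v → gauss v x ≤ C * gauss (2 * v) x := by
  obtain ⟨C, hC, h⟩ := exists_abs_rpow_mul_gauss_le (p := 0) le_rfl
  refine ⟨C, hC, fun v x hv => ?_⟩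
  simpa using h v x hv

theorem exists_abs_rpow_mul_abs_gauss1_le {p : ℝ} (hp : 0 ≤ p) :
    ∃ C : ℝ, 0 < C ∧ ∀ v x : ℝ, 0 < v →
      |x| ^ p * |gauss1 v x| ≤ C * v ^ (p / 2 - 1 / 2) * gauss (2 * v) x := by
  obtain ⟨C, hC, h⟩ := exists_abs_rpow_mul_gauss_le (p := p + 1) (by positivity)
  refine ⟨C, hC, fun v x hv => ?_⟩
  have h1 : |x| ^ p * |gauss1 v x| = v⁻¹ * (|x| ^ (p + 1) * gauss v x) := by
    rw [gauss1, abs_mul, abs_of_nonneg (gauss_nonneg v x), abs_neg, abs_div, abs_of_pos hv,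
      Real.rpow_add_one' (abs_nonneg x) (by positivity)]
    ring
  have h2 : v ^ (p / 2 - 1 / 2) = v⁻¹ * v ^ ((p + 1) / 2) := by
    rw [← Real.rpow_neg_one, ← Real.rpow_add hv]; congr 1; ring
  rw [h1, h2]
  calc _ ≤ v⁻¹ * (C * v ^ ((p + 1) / 2) * gauss (2 * v) x) := mul_le_mul_of_nonneg_left (h v x hv) (by positivity)
    _ = _ := by ring

theorem exists_abs_gauss1_le :
    ∃ C : ℝ, 0 < C ∧ ∀ v x : ℝ, 0 < v →
      |gauss1 v x| ≤ C * v ^ (-(1 / 2) : ℝ) * gauss (2 * v) x := by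
  obtain ⟨C, hC, h⟩ := exists_abs_rpow_mul_abs_gauss1_le (p := 0) le_rfl
  refine ⟨C, hC, fun v x hv => ?_⟩
  simpa using h v x hv

theorem exists_abs_rpow_mul_abs_gauss2_le {p : ℝ} (hp : 0 ≤ p) :
    ∃ C : ℝ, 0 < C ∧ ∀ v x : ℝ, 0 < v →
      |x| ^ p * |gauss2 v x| ≤ C * v ^ (p / 2 - 1) * gauss (2 * v) x := by
  obtain ⟨C, hC, h⟩ := exists_abs_rpow_mul_gauss_le (p := p + 2) (by positivity)
  obtain ⟨D, hD, h'⟩ := exists_abs_rpow_mul_gauss_le hp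
  refine ⟨C + D, by positivity, fun v x hv => ?_⟩
  have h1 : |x| ^ p * |gauss2 v x| ≤
      v⁻¹ ^ 2 * (|x| ^ (p + 2) * gauss v x) + v⁻¹ * (|x| ^ p * gauss v x) := by
    have : |x ^ 2 / v ^ 2 - 1 / v| ≤ x ^ 2 / v ^ 2 + 1 / v := by
      rw [abs_le]
      constructor <;> nlinarith [show 0 ≤ x ^ 2 / v ^ 2 by positivity, show 0 ≤ 1 / v by positivity]
    rw [gauss2, abs_mul, abs_of_nonneg (gauss_nonneg v x),
      Real.rpow_add' (abs_nonneg x) (by positivity), Real.rpow_two, sq_abs]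
    have hg := gauss_nonneg v x
    calc _ ≤ |x| ^ p * ((x ^ 2 / v ^ 2 + 1 / v) * gauss v x) := by gcongr
      _ = _ := by ring
  have h2 : v ^ (p / 2 - 1) = v⁻¹ ^ 2 * v ^ ((p + 2) / 2) := by
    rw [← Real.rpow_neg_one, ← Real.rpow_natCast, ← Real.rpow_mul hv.le, ← Real.rpow_add hv]
    congr 1; push_cast; ring
  have h3 : v ^ (p / 2 - 1) = v⁻¹ * v ^ (p / 2) := by
    rw [← Real.rpow_neg_one, ← Real.rpow_add hv]; congr 1; ring
  calc _ ≤ _ := h1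
    _ ≤ v⁻¹ ^ 2 * (C * v ^ ((p + 2) / 2) * gauss (2 * v) x) +
        v⁻¹ * (D * v ^ (p / 2) * gauss (2 * v) x) :=
      add_le_add (mul_le_mul_of_nonneg_left (h v x hv) (by positivity))
        (mul_le_mul_of_nonneg_left (h' v x hv) (by positivity))
    _ = C * (v⁻¹ ^ 2 * v ^ ((p + 2) / 2)) * gauss (2 * v) x +
        D * (v⁻¹ * v ^ (p / 2)) * gauss (2 * v) x := by ring
    _ = _ := by rw [← h2, ← h3]; ring

theorem exists_abs_gauss2_le :
    ∃ C : ℝ, 0 < C ∧ ∀ v x : ℝ, 0 < v → |gauss2 v x| ≤ C * v⁻¹ * gauss (2 * v) x := by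
  obtain ⟨C, hC, h⟩ := exists_abs_rpow_mul_abs_gauss2_le (p := 0) le_rfl
  refine ⟨C, hC, fun v x hv => ?_⟩
  simpa [Real.rpow_neg_one] using h v x hv

/-- The product of two Gaussians is a Gaussian. -/
theorem gauss_mul_gauss {v w : ℝ} (hv : 0 < v) (hw : 0 < w) (x y z : ℝ) :
    gauss v (x - z) * gauss w (z - y) =
      gauss (v + w) (x - y) * gauss (v * w / (v + w)) (z - (w * x + v * y) / (v + w)) := by
  have hvw : 0 < v + w := by positivity
  have hp := Real.two_pi_pos
  simp only [gauss]
  rw [mul_mul_mul_comm, mul_mul_mul_comm ((2 * Real.pi * (v + w)) ^ (-(1 / 2) : ℝ)),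
    ← Real.mul_rpow (by positivity) (by positivity), ← Real.mul_rpow (by positivity) (by positivity),
    ← Real.exp_add, ← Real.exp_add]
  congr 2
  · field_simp
  · field_simp
    ring

theorem integral_gauss_mul_gauss {v w : ℝ} (hv : 0 < v) (hw : 0 < w) (x y : ℝ) :
    ∫ z, gauss v (x - z) * gauss w (z - y) = gauss (v + w) (x - y) := by
  simp_rw [gauss_mul_gauss hv hw]
  rw [integral_const_mul, integral_gauss (by positivity), mul_one]

theorem integrable_sq_mul_gauss {v : ℝ} (hv : 0 < v) :
    Integrable (fun x => x ^ 2 * gauss v x) := by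
  obtain ⟨C, hC, h⟩ := exists_abs_rpow_mul_gauss_le (p := 2) (by norm_num)
  have hm : Measurable fun x : ℝ => x ^ 2 * gauss v x :=
    (measurable_id.pow_const 2).mul (measurable_const.gauss measurable_id)
  have hi := integrable_gauss (2 * v) 0
  simp only [sub_zero] at hi
  refine (hi.const_mul (C * v ^ (2 / 2 : ℝ))).mono' hm.aestronglyMeasurable
    (Eventually.of_forall fun x => ?_)
  have := h v x hv
  rw [Real.rpow_two, sq_abs] at this
  rwa [Real.norm_eq_abs, abs_of_nonneg (mul_nonneg (sq_nonneg x) (gauss_nonneg v x))]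

theorem integrable_mul_gauss {v : ℝ} (hv : 0 < v) : Integrable (fun x => x * gauss v x) := by
  obtain ⟨C, hC, h⟩ := exists_abs_rpow_mul_gauss_le (p := 1) (by norm_num)
  have hm : Measurable fun x : ℝ => x * gauss v x :=
    measurable_id.mul (measurable_const.gauss measurable_id)
  have hi := integrable_gauss (2 * v) 0
  simp only [sub_zero] at hi
  refine (hi.const_mul (C * v ^ (1 / 2 : ℝ))).mono' hm.aestronglyMeasurable
    (Eventually.of_forall fun x => ?_)
  have := h v x hv
  rw [Real.rpow_one] at this
  rwa [Real.norm_eq_abs, abs_mul, abs_of_nonneg (gauss_nonneg v x)]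

theorem integral_sq_mul_gauss {v : ℝ} (hv : 0 < v) : ∫ x, x ^ 2 * gauss v x = v := by
  have h := ProbabilityTheory.variance_id_gaussianReal (μ := 0) (v := v.toNNReal)
  rw [ProbabilityTheory.variance_eq_integral measurable_id.aemeasurable] at h
  simp only [id, ProbabilityTheory.integral_id_gaussianReal, sub_zero] at h
  rw [ProbabilityTheory.integral_gaussianReal_eq_integral_smul (Real.toNNReal_pos.2 hv).ne',
    Real.coe_toNNReal v hv.le] at h
  refine Eq.trans ?_ h
  refine integral_congr_ae (Eventually.of_forall fun x => ?_)
  have := gauss_eq_gaussianPDFReal hv 0 x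
  rw [sub_zero] at this
  simp only [smul_eq_mul]
  rw [← this, mul_comm]

theorem integral_gauss1_mul_gauss1 {v : ℝ} (hv : 0 < v) (x z : ℝ) :
    ∫ y, gauss1 v (y - x) * gauss1 v (y - z) = -gauss2 (2 * v) (x - z) := by
  have e : ∀ y, gauss1 v (y - x) * gauss1 v (y - z) = (gauss (2 * v) (x - z) * v⁻¹ ^ 2) *
      ((fun w => w ^ 2 * gauss (v / 2) w - ((x - z) / 2) ^ 2 * gauss (v / 2) w)
        (y - (x + z) / 2)) := by
    intro y
    have h := gauss_mul_gauss hv hv x z y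
    rw [gauss_sub_comm v x y, ← two_mul, show v * v / (2 * v) = v / 2 by field_simp,
      show (v * x + v * z) / (2 * v) = (x + z) / 2 by field_simp] at h
    simp only [gauss1]
    calc _ = (y - x) * (y - z) * v⁻¹ ^ 2 * (gauss v (y - x) * gauss v (y - z)) := by ring
      _ = _ := by rw [h]; ring
  have hi := integrable_gauss (v / 2) 0
  have h1 := integral_gauss (half_pos hv) 0
  simp only [sub_zero] at hi h1
  simp_rw [e]
  rw [integral_const_mul, integral_sub_right_eq_self
    (fun w => w ^ 2 * gauss (v / 2) w - ((x - z) / 2) ^ 2 * gauss (v / 2) w),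
    integral_sub (integrable_sq_mul_gauss (half_pos hv)) (hi.const_mul _),
    integral_sq_mul_gauss (half_pos hv), integral_const_mul, h1, gauss2]
  field_simp
  ring

theorem lintegral_Ioo_sub_left_rpow {s t b : ℝ} (hst : s < t) (hb : 0 < b) :
    ∫⁻ r in Ioo s t, ENNReal.ofReal ((r - s) ^ (b - 1)) = ENNReal.ofReal ((t - s) ^ b / b) := by
  have h1 : IntervalIntegrable (fun r : ℝ => (r - s) ^ (b - 1)) volume s t := by
    have := (intervalIntegral.intervalIntegrable_rpow' (a := 0) (b := t - s)
      (r := b - 1) (by linarith)).comp_sub_right s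
    simpa using this
  rw [← ofReal_integral_eq_lintegral_ofReal]
  · rw [← integral_Ioc_eq_integral_Ioo, ← intervalIntegral.integral_of_le hst.le,
      intervalIntegral.integral_comp_sub_right (fun r => r ^ (b - 1)),
      integral_rpow (Or.inl (by linarith))]
    simp [hb.ne']
  · exact (intervalIntegrable_iff_integrableOn_Ioo_of_le hst.le).1 h1
  · exact (ae_restrict_iff' measurableSet_Ioo).2
      (Eventually.of_forall fun r hr => Real.rpow_nonneg (sub_nonneg.2 hr.1.le) _)

theorem lintegral_Ioo_sub_right_rpow {s t b : ℝ} (hst : s < t) (hb : 0 < b) :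
    ∫⁻ r in Ioo s t, ENNReal.ofReal ((t - r) ^ (b - 1)) = ENNReal.ofReal ((t - s) ^ b / b) := by
  have h1 : IntervalIntegrable (fun r : ℝ => (t - r) ^ (b - 1)) volume s t := by
    have := (intervalIntegral.intervalIntegrable_rpow' (a := t - s) (b := 0)
      (r := b - 1) (by linarith)).comp_sub_left t
    simpa using this
  rw [← ofReal_integral_eq_lintegral_ofReal]
  · rw [← integral_Ioc_eq_integral_Ioo, ← intervalIntegral.integral_of_le hst.le,
      intervalIntegral.integral_comp_sub_left (fun r => r ^ (b - 1)),
      integral_rpow (Or.inl (by linarith))]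
    simp [hb.ne']
  · exact (intervalIntegrable_iff_integrableOn_Ioo_of_le hst.le).1 h1
  · exact (ae_restrict_iff' measurableSet_Ioo).2
      (Eventually.of_forall fun r hr => Real.rpow_nonneg (sub_nonneg.2 hr.2.le) _)

theorem lintegral_Ioo_rpow_mul_exp_le {s t a l : ℝ} (ha : 0 < a) (hl : 0 < l) :
    ∫⁻ r in Ioo s t, ENNReal.ofReal ((t - r) ^ (a - 1) * Real.exp (-(l * (t - r)))) ≤
      ENNReal.ofReal (Real.Gamma a * l ^ (-a)) := by
  have h0 := Real.integral_rpow_mul_exp_neg_mul_Ioi ha hl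
  have hne : ∫ r in Ioi (0 : ℝ), r ^ (a - 1) * Real.exp (-(l * r)) ≠ 0 := by
    rw [h0]
    exact (mul_pos (by positivity) (Real.Gamma_pos_of_pos ha)).ne'
  have hi : IntegrableOn (fun r : ℝ => r ^ (a - 1) * Real.exp (-(l * r))) (Ioi 0) :=
    not_imp_comm.1 integral_undef hne
  have h1 : ENNReal.ofReal (Real.Gamma a * l ^ (-a)) =
      ∫⁻ r in Ioi (0 : ℝ), ENNReal.ofReal (r ^ (a - 1) * Real.exp (-(l * r))) := by
    rw [← ofReal_integral_eq_lintegral_ofReal hi, h0, Real.rpow_neg hl.le, one_div,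
      Real.inv_rpow hl.le, mul_comm]
    exact (ae_restrict_iff' measurableSet_Ioi).2
      (Eventually.of_forall fun r hr => mul_nonneg (Real.rpow_nonneg (le_of_lt hr) _)
        (Real.exp_pos _).le)
  rw [h1, ← lintegral_indicator measurableSet_Ioo, ← lintegral_indicator measurableSet_Ioi,
    ← lintegral_sub_left_eq_self
      ((Ioi (0 : ℝ)).indicator fun r => ENNReal.ofReal (r ^ (a - 1) * Real.exp (-(l * r)))) t]
  refine lintegral_mono fun r => ?_
  by_cases hr : r ∈ Ioo s t
  · rw [indicator_of_mem hr, indicator_of_mem (show t - r ∈ Ioi 0 from sub_pos.2 hr.2)]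
  · rw [indicator_of_notMem hr]
    exact zero_le

/-- A Beta integral with an exponential weight. -/
theorem exists_lintegral_beta_le {a b : ℝ} (ha : 0 < a) (hb : 0 < b) (hb1 : b ≤ 1) :
    ∃ C : ℝ, 0 < C ∧ ∀ l s t : ℝ, 0 < l → s < t →
      ∫⁻ r in Ioo s t, ENNReal.ofReal
        ((t - r) ^ (a - 1) * (r - s) ^ (b - 1) * Real.exp (-(l * (t - r)))) ≤
      ENNReal.ofReal (C * l ^ (-a) * (t - s) ^ (b - 1)) := by
  obtain ⟨C, hC, h⟩ := exists_rpow_mul_exp_neg_le ha.le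
  have hG := Real.Gamma_pos_of_pos ha
  refine ⟨2 ^ (1 - b) * Real.Gamma a + 2 * C / b, by positivity, fun l s t hl hst => ?_⟩
  have hts : 0 < t - s := sub_pos.2 hst
  have key : ∀ r ∈ Ioo s t, ENNReal.ofReal
      ((t - r) ^ (a - 1) * (r - s) ^ (b - 1) * Real.exp (-(l * (t - r)))) ≤
      ENNReal.ofReal (((t - s) / 2) ^ (b - 1)) *
        ENNReal.ofReal ((t - r) ^ (a - 1) * Real.exp (-(l * (t - r)))) +
      ENNReal.ofReal (2 * C * l ^ (-a) * (t - s)⁻¹) * ENNReal.ofReal ((r - s) ^ (b - 1)) := by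
    intro r hr
    have h1 : 0 < t - r := sub_pos.2 hr.2
    have h2 : 0 < r - s := sub_pos.2 hr.1
    rw [← ENNReal.ofReal_mul (by positivity), ← ENNReal.ofReal_mul (by positivity),
      ← ENNReal.ofReal_add (by positivity) (by positivity)]
    refine ENNReal.ofReal_le_ofReal ?_
    rcases le_total ((t - s) / 2) (r - s) with hc | hc
    · have : (r - s) ^ (b - 1) ≤ ((t - s) / 2) ^ (b - 1) :=
        Real.rpow_le_rpow_of_nonpos (by positivity) hc (by linarith)
      calc _ = (r - s) ^ (b - 1) * ((t - r) ^ (a - 1) * Real.exp (-(l * (t - r)))) := by ring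
        _ ≤ ((t - s) / 2) ^ (b - 1) * ((t - r) ^ (a - 1) * Real.exp (-(l * (t - r)))) := by gcongr
        _ ≤ _ := le_add_of_nonneg_right (by positivity)
    · have e : (t - r) ^ (a - 1) * Real.exp (-(l * (t - r))) =
          l ^ (-a) * (t - r)⁻¹ * ((l * (t - r)) ^ a * Real.exp (-(l * (t - r)))) := by
        rw [Real.rpow_sub_one h1.ne', Real.mul_rpow hl.le h1.le, Real.rpow_neg hl.le]
        have := Real.rpow_pos_of_pos hl a
        field_simp
      have h3 : (t - r)⁻¹ ≤ 2 * (t - s)⁻¹ := by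
        rw [← div_eq_mul_inv, inv_eq_one_div, div_le_div_iff₀ h1 hts]
        linarith
      calc _ = ((t - r) ^ (a - 1) * Real.exp (-(l * (t - r)))) * (r - s) ^ (b - 1) := by ring
        _ ≤ (l ^ (-a) * (2 * (t - s)⁻¹) * C) * (r - s) ^ (b - 1) := by
          rw [e]
          gcongr
          exact h _ (by positivity)
        _ = 2 * C * l ^ (-a) * (t - s)⁻¹ * (r - s) ^ (b - 1) := by ring
        _ ≤ _ := le_add_of_nonneg_left (by positivity)
  calc _ ≤ _ := setLIntegral_mono (by fun_prop) key
    _ ≤ ENNReal.ofReal (((t - s) / 2) ^ (b - 1)) * ENNReal.ofReal (Real.Gamma a * l ^ (-a)) +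
        ENNReal.ofReal (2 * C * l ^ (-a) * (t - s)⁻¹) * ENNReal.ofReal ((t - s) ^ b / b) := by
      rw [lintegral_add_left (by fun_prop), lintegral_const_mul _ (by fun_prop),
        lintegral_const_mul _ (by fun_prop), lintegral_Ioo_sub_left_rpow hst hb]
      gcongr
      exact lintegral_Ioo_rpow_mul_exp_le ha hl
    _ = _ := by
      rw [← ENNReal.ofReal_mul (by positivity), ← ENNReal.ofReal_mul (by positivity),
        ← ENNReal.ofReal_add (by positivity) (by positivity)]
      congr 1
      rw [Real.div_rpow hts.le (by norm_num), Real.rpow_sub_one hts.ne',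
        show (2 : ℝ) ^ (1 - b) = (2 ^ (b - 1))⁻¹ by rw [← Real.rpow_neg (by norm_num), neg_sub]]
      field_simp

theorem lintegral_Ioo_abs_rpow {R b : ℝ} (hR : 0 < R) (hb : 0 < b) :
    ∫⁻ z in Ioo (-R) R, ENNReal.ofReal (|z| ^ (b - 1)) ≤ ENNReal.ofReal (2 * (R ^ b / b)) := by
  have h1 : ∫⁻ z in Ioo (-R) 0, ENNReal.ofReal (|z| ^ (b - 1)) = ENNReal.ofReal (R ^ b / b) := by
    have := lintegral_Ioo_sub_right_rpow (s := -R) (t := 0) (by linarith) hb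
    rw [zero_sub, neg_neg] at this
    rw [← this]
    refine setLIntegral_congr_fun measurableSet_Ioo fun z hz => ?_
    simp only [abs_of_neg hz.2, zero_sub]
  have h2 : ∫⁻ z in Ioo 0 R, ENNReal.ofReal (|z| ^ (b - 1)) = ENNReal.ofReal (R ^ b / b) := by
    have := lintegral_Ioo_sub_left_rpow (s := 0) (t := R) hR hb
    rw [sub_zero] at this
    rw [← this]
    refine setLIntegral_congr_fun measurableSet_Ioo fun z hz => ?_
    simp only [abs_of_pos hz.1, sub_zero]
  have h3 : Ioo (-R) R ⊆ (Ioo (-R) 0 ∪ Ioo 0 R) ∪ {0} := by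
    intro z hz
    rcases lt_trichotomy z 0 with h | h | h
    · exact Or.inl (Or.inl ⟨hz.1, h⟩)
    · exact Or.inr h
    · exact Or.inl (Or.inr ⟨h, hz.2⟩)
  calc _ ≤ _ := lintegral_mono_set h3
    _ ≤ _ := lintegral_union_le _ _ _
    _ ≤ (ENNReal.ofReal (R ^ b / b) + ENNReal.ofReal (R ^ b / b)) + 0 := by
      refine add_le_add ((lintegral_union_le _ _ _).trans (by rw [h1, h2])) ?_
      simp
    _ = _ := by rw [add_zero, ← ENNReal.ofReal_add (by positivity) (by positivity), two_mul]

/-- Negative moments of a Gaussian, uniformly in its mean. -/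
theorem exists_lintegral_abs_rpow_mul_gauss_le {β : ℝ} (h0 : 0 ≤ β) (h1 : β < 1) :
    ∃ C : ℝ, 0 < C ∧ ∀ v m : ℝ, 0 < v →
      ∫⁻ z, ENNReal.ofReal (|z| ^ (-β) * gauss v (z - m)) ≤ ENNReal.ofReal (C * v ^ (-(β / 2))) := by
  have hb : 0 < 1 - β := by linarith
  refine ⟨2 / (1 - β) + 1, by positivity, fun v m hv => ?_⟩
  have hR : 0 < v ^ (1 / 2 : ℝ) := by positivity
  set R := v ^ (1 / 2 : ℝ) with hRdef
  have key : ∀ z, ENNReal.ofReal (|z| ^ (-β) * gauss v (z - m)) ≤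
      (Ioo (-R) R).indicator (fun z => ENNReal.ofReal (v ^ (-(1 / 2) : ℝ)) *
        ENNReal.ofReal (|z| ^ ((1 - β) - 1))) z +
      ENNReal.ofReal (v ^ (-(β / 2))) * ENNReal.ofReal (gauss v (z - m)) := by
    intro z
    by_cases hz : z ∈ Ioo (-R) R
    · rw [indicator_of_mem hz, ← ENNReal.ofReal_mul (by positivity)]
      refine le_add_of_le_of_nonneg (ENNReal.ofReal_le_ofReal ?_) zero_le
      rw [mul_comm, show (1 - β) - 1 = -β by ring]
      exact mul_le_mul_of_nonneg_right (gauss_le_rpow hv _) (by positivity)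
    · rw [indicator_of_notMem hz, zero_add, ← ENNReal.ofReal_mul (by positivity)]
      refine ENNReal.ofReal_le_ofReal (mul_le_mul_of_nonneg_right ?_ (gauss_nonneg _ _))
      have : R ≤ |z| := by
        by_contra hc
        exact hz (abs_lt.1 (not_le.1 hc))
      calc |z| ^ (-β) ≤ R ^ (-β) := Real.rpow_le_rpow_of_nonpos hR this (by linarith)
        _ = v ^ (-(β / 2)) := by rw [hRdef, ← Real.rpow_mul hv.le]; congr 1; ring
  calc _ ≤ _ := lintegral_mono key
    _ ≤ ENNReal.ofReal (v ^ (-(1 / 2) : ℝ)) * ENNReal.ofReal (2 * (R ^ (1 - β) / (1 - β))) +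
        ENNReal.ofReal (v ^ (-(β / 2))) * 1 := by
      rw [lintegral_add_left (Measurable.indicator (by fun_prop) measurableSet_Ioo),
        lintegral_indicator measurableSet_Ioo, lintegral_const_mul _ (by fun_prop),
        lintegral_const_mul' _ _ ENNReal.ofReal_ne_top, lintegral_gauss hv]
      gcongr
      exact lintegral_Ioo_abs_rpow hR hb
    _ = _ := by
      rw [mul_one, ← ENNReal.ofReal_mul (by positivity),
        ← ENNReal.ofReal_add (by positivity) (by positivity)]
      congr 1
      have : v ^ (-(1 / 2) : ℝ) * R ^ (1 - β) = v ^ (-(β / 2)) := by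
        rw [hRdef, ← Real.rpow_mul hv.le, ← Real.rpow_add hv]; congr 1; ring
      rw [← this]
      field_simp

/-- The space-time convolution of two Gaussian majorants, one of which carries a weight that is
singular at the origin. -/
theorem exists_lintegral_conv_le {β p q : ℝ} (h0 : 0 ≤ β) (h1 : β < 1) (hp : p + β / 2 < 1)
    (hq : q + β / 2 < 1) (hq0 : 0 ≤ q + β / 2) :
    ∃ C : ℝ, 0 < C ∧ ∀ l s t x y : ℝ, 0 < l → s < t →
      ∫⁻ r in Ioo s t, ∫⁻ z, ENNReal.ofReal
        ((t - r) ^ (-p) * Real.exp (-(l * (t - r))) * gauss (2 * (t - r)) (x - z) *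
          (|z| ^ (-β) * (r - s) ^ (-q) * gauss (2 * (r - s)) (z - y))) ≤
      ENNReal.ofReal
        (C * l ^ (-(1 - p - β / 2)) * (t - s) ^ (-q) * gauss (2 * (t - s)) (x - y)) := by
  obtain ⟨C, hC, hmom⟩ := exists_lintegral_abs_rpow_mul_gauss_le h0 h1
  obtain ⟨D, hD, hbeta⟩ := exists_lintegral_beta_le (a := 1 - p - β / 2) (b := 1 - q - β / 2)
    (by linarith) (by linarith) (by linarith)
  refine ⟨D * (C * 2 ^ (-(β / 2))), by positivity, fun l s t x y hl hst => ?_⟩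
  have hts : 0 < t - s := sub_pos.2 hst
  have hg := gauss_nonneg (2 * (t - s)) (x - y)
  have key : ∀ r ∈ Ioo s t, ∫⁻ z, ENNReal.ofReal
      ((t - r) ^ (-p) * Real.exp (-(l * (t - r))) * gauss (2 * (t - r)) (x - z) *
        (|z| ^ (-β) * (r - s) ^ (-q) * gauss (2 * (r - s)) (z - y))) ≤
      ENNReal.ofReal (C * 2 ^ (-(β / 2)) * (t - s) ^ (β / 2) * gauss (2 * (t - s)) (x - y)) *
      ENNReal.ofReal ((t - r) ^ (1 - p - β / 2 - 1) * (r - s) ^ (1 - q - β / 2 - 1) *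
        Real.exp (-(l * (t - r)))) := by
    intro r hr
    have h1 : 0 < t - r := sub_pos.2 hr.2
    have h2 : 0 < r - s := sub_pos.2 hr.1
    set V := 2 * (t - r) * (2 * (r - s)) / (2 * (t - r) + 2 * (r - s)) with hV
    set m := (2 * (r - s) * x + 2 * (t - r) * y) / (2 * (t - r) + 2 * (r - s))
    have hV0 : 0 < V := by positivity
    have e : ∀ z, ENNReal.ofReal
        ((t - r) ^ (-p) * Real.exp (-(l * (t - r))) * gauss (2 * (t - r)) (x - z) *
        (|z| ^ (-β) * (r - s) ^ (-q) * gauss (2 * (r - s)) (z - y))) =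
        ENNReal.ofReal ((t - r) ^ (-p) * Real.exp (-(l * (t - r))) * (r - s) ^ (-q) *
          gauss (2 * (t - s)) (x - y)) * ENNReal.ofReal (|z| ^ (-β) * gauss V (z - m)) := by
      intro z
      rw [← ENNReal.ofReal_mul (by positivity)]
      congr 1
      have := gauss_mul_gauss (v := 2 * (t - r)) (w := 2 * (r - s)) (by positivity) (by positivity)
        x y z
      rw [show 2 * (t - r) + 2 * (r - s) = 2 * (t - s) by ring] at this hV
      simp only [hV, m]
      rw [show 2 * (t - r) + 2 * (r - s) = 2 * (t - s) by ring]
      linear_combination ((t - r) ^ (-p) * Real.exp (-(l * (t - r))) * (r - s) ^ (-q) *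
        |z| ^ (-β)) * this
    have hV2 : V ^ (-(β / 2)) = 2 ^ (-(β / 2)) * (t - s) ^ (β / 2) *
        ((t - r) ^ (-(β / 2)) * (r - s) ^ (-(β / 2))) := by
      have : V = 2 * (t - s)⁻¹ * ((t - r) * (r - s)) := by
        rw [hV]; field_simp; ring
      rw [this, Real.mul_rpow (by positivity) (by positivity),
        Real.mul_rpow (by positivity) (by positivity),
        Real.mul_rpow (by positivity) (by positivity), Real.inv_rpow hts.le,
        Real.rpow_neg hts.le, inv_inv]
    simp_rw [e]
    rw [lintegral_const_mul' _ _ ENNReal.ofReal_ne_top]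
    refine (mul_le_mul_right (hmom V m hV0) _).trans (le_of_eq ?_)
    rw [← ENNReal.ofReal_mul (by positivity), ← ENNReal.ofReal_mul (by positivity), hV2,
      show 1 - p - β / 2 - 1 = -p + -(β / 2) by ring, show 1 - q - β / 2 - 1 = -q + -(β / 2) by ring,
      Real.rpow_add h1, Real.rpow_add h2]
    congr 1
    ring
  calc _ ≤ _ := setLIntegral_mono (by fun_prop) key
    _ ≤ ENNReal.ofReal (C * 2 ^ (-(β / 2)) * (t - s) ^ (β / 2) * gauss (2 * (t - s)) (x - y)) *
        ENNReal.ofReal (D * l ^ (-(1 - p - β / 2)) * (t - s) ^ (1 - q - β / 2 - 1)) := by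
      rw [lintegral_const_mul _ (by fun_prop)]
      exact mul_le_mul_right (hbeta l s t hl hst) _
    _ = _ := by
      rw [← ENNReal.ofReal_mul (by positivity)]
      congr 1
      rw [show 1 - q - β / 2 - 1 = -q + -(β / 2) by ring, Real.rpow_add hts, Real.rpow_neg hts.le (β / 2)]
      have := Real.rpow_pos_of_pos hts (β / 2)
      field_simp

/-- Joint measurability of a kernel in its four variables. -/
def MeasurableKernel (f : ParabolicKernel) : Prop :=
  Measurable fun q : ℝ × ℝ × ℝ × ℝ => f q.1 q.2.1 q.2.2.1 q.2.2.2

theorem MeasurableKernel.comp {f : ParabolicKernel} (hf : MeasurableKernel f) {α : Type*}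
    [MeasurableSpace α] {t x s y : α → ℝ} (ht : Measurable t) (hx : Measurable x)
    (hs : Measurable s) (hy : Measurable y) : Measurable fun a => f (t a) (x a) (s a) (y a) :=
  Measurable.comp hf (ht.prodMk (hx.prodMk (hs.prodMk hy)))

theorem MeasurableKernel.stConv {f g : ParabolicKernel} (hf : MeasurableKernel f)
    (hg : MeasurableKernel g) : MeasurableKernel (stConv f g) := by
  have h1 : Measurable fun w : ((ℝ × ℝ × ℝ × ℝ) × ℝ) × ℝ =>
      f w.1.1.1 w.1.1.2.1 w.1.2 w.2 * g w.1.2 w.2 w.1.1.2.2.1 w.1.1.2.2.2 :=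
    (hf.comp (by fun_prop) (by fun_prop) (by fun_prop) (by fun_prop)).mul
      (hg.comp (by fun_prop) (by fun_prop) (by fun_prop) (by fun_prop))
  have h2 := (h1.stronglyMeasurable.integral_prod_right' (ν := (volume : Measure ℝ))).measurable
  have h3 : ∀ S : Set ((ℝ × ℝ × ℝ × ℝ) × ℝ), MeasurableSet S → Measurable fun q : ℝ × ℝ × ℝ × ℝ =>
      ∫ r, S.indicator (fun w : (ℝ × ℝ × ℝ × ℝ) × ℝ =>
        ∫ z, f w.1.1 w.1.2.1 w.2 z * g w.2 z w.1.2.2.1 w.1.2.2.2) (q, r) := fun S hS =>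
    ((h2.indicator hS).stronglyMeasurable.integral_prod_right' (ν := (volume : Measure ℝ))).measurable
  have h4 : MeasurableSet {w : (ℝ × ℝ × ℝ × ℝ) × ℝ | w.1.2.2.1 < w.2 ∧ w.2 ≤ w.1.1} := by
    measurability
  have h5 : MeasurableSet {w : (ℝ × ℝ × ℝ × ℝ) × ℝ | w.1.1 < w.2 ∧ w.2 ≤ w.1.2.2.1} := by
    measurability
  unfold MeasurableKernel
  convert (h3 _ h4).sub (h3 _ h5) using 1
  ext q
  simp only [_root_.stConv, intervalIntegral, Pi.sub_apply]
  rw [← integral_indicator measurableSet_Ioc, ← integral_indicator measurableSet_Ioc]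
  rfl

theorem measurableKernel_heatZ : MeasurableKernel heatZ :=
  Measurable.gauss (f := fun q : ℝ × ℝ × ℝ × ℝ => q.1 - q.2.2.1)
    (g := fun q => q.2.1 - q.2.2.2) (by fun_prop) (by fun_prop)

theorem leviKernel_eq (γ : ℝ) (b : ℝ → ℝ → ℝ) (t x s y : ℝ) :
    leviKernel γ b t x s y = drift γ b t x * gauss1 (t - s) (x - y) := by
  rw [leviKernel, ← (hasDerivAt_gauss_sub (t - s) x y).deriv]
  rfl

theorem abs_drift_le {γ K : ℝ} {b : ℝ → ℝ → ℝ} (hK : ∀ t x, |b t x| ≤ K) (t x : ℝ) :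
    |drift γ b t x| ≤ K * |x| ^ (-γ) := by
  rw [drift, abs_div, Real.rpow_neg (abs_nonneg x), ← div_eq_mul_inv,
    abs_of_nonneg (Real.rpow_nonneg (abs_nonneg x) γ)]
  exact div_le_div_of_nonneg_right (hK t x) (by positivity)

theorem measurable_drift {γ : ℝ} {b : ℝ → ℝ → ℝ} (hb : Measurable (Function.uncurry b)) :
    Measurable (fun q : ℝ × ℝ => drift γ b q.1 q.2) := by
  unfold drift
  refine Measurable.div hb ?_
  fun_prop

theorem measurableKernel_leviKernel {γ : ℝ} {b : ℝ → ℝ → ℝ}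
    (hb : Measurable (Function.uncurry b)) : MeasurableKernel (leviKernel γ b) := by
  unfold MeasurableKernel
  simp_rw [leviKernel_eq]
  exact ((measurable_drift hb).comp (by fun_prop : Measurable fun q : ℝ × ℝ × ℝ × ℝ =>
    (q.1, q.2.1))).mul (Measurable.gauss1 (by fun_prop) (by fun_prop))

theorem measurableKernel_leviTerm {γ : ℝ} {b : ℝ → ℝ → ℝ}
    (hb : Measurable (Function.uncurry b)) (m : ℕ) : MeasurableKernel (leviTerm γ b m) := by
  induction m with
  | zero => exact measurableKernel_leviKernel hb
  | succ m ih => exact (measurableKernel_leviKernel hb).stConv ih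

theorem stConv_of_le {f g : ParabolicKernel} (hf : ∀ t x s y, t ≤ s → f t x s y = 0) {t x s y : ℝ}
    (h : t ≤ s) : stConv f g t x s y = 0 := by
  rw [stConv, intervalIntegral.integral_of_ge h, neg_eq_zero]
  refine setIntegral_eq_zero_of_forall_eq_zero fun r hr => ?_
  simp [hf t x r _ hr.1.le]

theorem leviKernel_of_le {γ : ℝ} {b : ℝ → ℝ → ℝ} {t x s y : ℝ} (h : t ≤ s) :
    leviKernel γ b t x s y = 0 := by
  rw [leviKernel_eq, gauss1_of_nonpos (by linarith), mul_zero]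

theorem leviTerm_of_le {γ : ℝ} {b : ℝ → ℝ → ℝ} (m : ℕ) {t x s y : ℝ} (h : t ≤ s) :
    leviTerm γ b m t x s y = 0 := by
  cases m with
  | zero => exact leviKernel_of_le h
  | succ m => exact stConv_of_le (fun _ _ _ _ => leviKernel_of_le) h

/-- The Gaussian majorant of the iterated kernels. -/
noncomputable def leviMajorant (γ l : ℝ) : ParabolicKernel := fun t x s y =>
  |x| ^ (-γ) * (t - s) ^ (-(1 / 2) : ℝ) * Real.exp (l * (t - s)) * gauss (2 * (t - s)) (x - y)

theorem leviMajorant_of_le {γ l t x s y : ℝ} (h : t ≤ s) : leviMajorant γ l t x s y = 0 := by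
  rw [leviMajorant, gauss_of_nonpos (by linarith), mul_zero]

theorem leviMajorant_nonneg (γ l t x s y : ℝ) : 0 ≤ leviMajorant γ l t x s y := by
  rcases le_or_gt t s with h | h
  · rw [leviMajorant_of_le h]
  · have : 0 < t - s := sub_pos.2 h
    exact mul_nonneg (by positivity) (gauss_nonneg _ _)

/-- A bound for the iterated integral of `|k| * leviMajorant` bounds all convolutions with
functions dominated by the majorant. -/
theorem integrableOn_of_lintegral_le {F : ℝ → ℝ → ℝ} (hF : Measurable (Function.uncurry F))
    {s t B : ℝ} (hst : s ≤ t) (hB : 0 ≤ B)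
    (h : ∫⁻ r in Ioo s t, ∫⁻ z, ENNReal.ofReal |F r z| ≤ ENNReal.ofReal B) :
    IntegrableOn (fun q : ℝ × ℝ => F q.1 q.2) (Ioo s t ×ˢ univ) ∧
    ∫ r in s..t, ∫ z, F r z = ∫ q in Ioo s t ×ˢ univ, F q.1 q.2 ∧
    ∫ q in Ioo s t ×ˢ univ, |F q.1 q.2| ≤ B := by
  have hμ : (volume : Measure (ℝ × ℝ)).restrict (Ioo s t ×ˢ univ) =
      ((volume : Measure ℝ).restrict (Ioo s t)).prod volume := by
    rw [Measure.volume_eq_prod, ← Measure.prod_restrict, Measure.restrict_univ]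
  have hl : ∫⁻ q in Ioo s t ×ˢ univ, ENNReal.ofReal |F q.1 q.2| ≤ ENNReal.ofReal B := by
    rw [hμ, lintegral_prod _ (by
      exact (ENNReal.measurable_ofReal.comp (continuous_abs.measurable.comp hF)).aemeasurable)]
    exact h
  have hi : IntegrableOn (fun q : ℝ × ℝ => F q.1 q.2) (Ioo s t ×ˢ univ) := by
    refine ⟨hF.aestronglyMeasurable, ?_⟩
    simp only [HasFiniteIntegral, Real.enorm_eq_ofReal_abs]
    exact hl.trans_lt ENNReal.ofReal_lt_top
  refine ⟨hi, ?_, ?_⟩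
  · rw [intervalIntegral.integral_of_le hst, integral_Ioc_eq_integral_Ioo, hμ, integral_prod]
    rwa [IntegrableOn, hμ] at hi
  · rw [integral_eq_lintegral_of_nonneg_ae (Eventually.of_forall fun _ => abs_nonneg _)
      (show Measurable fun q : ℝ × ℝ => |F q.1 q.2| from
        continuous_abs.measurable.comp hF).aestronglyMeasurable]
    exact ENNReal.toReal_le_of_le_ofReal hB hl

theorem stConv_of_lintegral_le {f g : ParabolicKernel} (hf : MeasurableKernel f)
    (hg : MeasurableKernel g) {M : ℝ → ℝ → ℝ} {t x s y B : ℝ} (hst : s ≤ t) (hB : 0 ≤ B)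
    (hM : ∀ r ∈ Ioo s t, ∀ z, |f t x r z * g r z s y| ≤ M r z)
    (h : ∫⁻ r in Ioo s t, ∫⁻ z, ENNReal.ofReal (M r z) ≤ ENNReal.ofReal B) :
    StConvIntegrable f g t x s y ∧
    stConv f g t x s y = ∫ q in Ioo s t ×ˢ univ, f t x q.1 q.2 * g q.1 q.2 s y ∧
    ∫ q in Ioo s t ×ˢ univ, |f t x q.1 q.2 * g q.1 q.2 s y| ≤ B ∧
    |stConv f g t x s y| ≤ B := by
  have hm : Measurable (Function.uncurry fun r z => f t x r z * g r z s y) :=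
    (hf.comp measurable_const measurable_const measurable_fst measurable_snd).mul
      (hg.comp measurable_fst measurable_snd measurable_const measurable_const)
  obtain ⟨h1, h2, h3⟩ := integrableOn_of_lintegral_le hm hst hB (le_trans
    (setLIntegral_mono' measurableSet_Ioo fun r hr =>
      lintegral_mono fun z => ENNReal.ofReal_le_ofReal (hM r hr z)) h)
  refine ⟨h1, h2, h3, ?_⟩
  rw [stConv, h2]
  exact (abs_integral_le_integral_abs).trans h3

theorem exists_abs_leviTerm_le {γ K : ℝ} (hγ : γ ∈ Ioo (0 : ℝ) 1) {b : ℝ → ℝ → ℝ}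
    (hb : Measurable (Function.uncurry b)) (hK : ∀ t x, |b t x| ≤ K) :
    ∃ l A : ℝ, 0 < l ∧ 0 ≤ A ∧ ∀ m t x s y,
      |leviTerm γ b m t x s y| ≤ A * (1 / 2) ^ m * leviMajorant γ l t x s y ∧
      (s < t → ∫⁻ r in Ioo s t, ∫⁻ z, ENNReal.ofReal
        (|leviKernel γ b t x r z| * leviMajorant γ l r z s y) ≤
          ENNReal.ofReal (1 / 2 * leviMajorant γ l t x s y)) := by
  have hK0 : 0 ≤ K := (abs_nonneg _).trans (hK 0 0)
  obtain ⟨C, hC, hg1⟩ := exists_abs_gauss1_le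
  obtain ⟨D, hD, hconv⟩ := exists_lintegral_conv_le (β := γ) (p := 1 / 2) (q := 1 / 2) hγ.1.le hγ.2
    (by linarith [hγ.2]) (by linarith [hγ.2]) (by linarith [hγ.1])
  set δ := 1 - 1 / 2 - γ / 2 with hδ
  have hδ0 : 0 < δ := by linarith [hγ.2]
  set l := (2 * (K * C * D + 1)) ^ (1 / δ) with hl
  have hl0 : 0 < l := by positivity
  have hld : l ^ (-δ) = (2 * (K * C * D + 1))⁻¹ := by
    rw [hl, ← Real.rpow_mul (by positivity), ← Real.rpow_neg_one]
    congr 1; field_simp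
  have hk : ∀ t x s y, s < t → |leviKernel γ b t x s y| ≤
      K * C * (|x| ^ (-γ) * (t - s) ^ (-(1 / 2) : ℝ) * gauss (2 * (t - s)) (x - y)) := by
    intro t x s y hst
    have hts : 0 < t - s := sub_pos.2 hst
    rw [leviKernel_eq, abs_mul]
    calc _ ≤ (K * |x| ^ (-γ)) * (C * (t - s) ^ (-(1 / 2) : ℝ) * gauss (2 * (t - s)) (x - y)) :=
        mul_le_mul (abs_drift_le hK t x) (hg1 _ _ hts) (abs_nonneg _) (by positivity)
      _ = _ := by ring
  have hstep : ∀ t x s y, s < t → ∫⁻ r in Ioo s t, ∫⁻ z, ENNReal.ofReal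
        (|leviKernel γ b t x r z| * leviMajorant γ l r z s y) ≤
          ENNReal.ofReal (1 / 2 * leviMajorant γ l t x s y) := by
    intro t x s y hst
    have hts : 0 < t - s := sub_pos.2 hst
    have hg := gauss_nonneg (2 * (t - s)) (x - y)
    have h1 : ∀ r ∈ Ioo s t, ∫⁻ z, ENNReal.ofReal
        (|leviKernel γ b t x r z| * leviMajorant γ l r z s y) ≤
        ENNReal.ofReal (K * C * (|x| ^ (-γ) * Real.exp (l * (t - s)))) * ∫⁻ z, ENNReal.ofReal
        ((t - r) ^ (-(1 / 2) : ℝ) * Real.exp (-(l * (t - r))) * gauss (2 * (t - r)) (x - z) *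
          (|z| ^ (-γ) * (r - s) ^ (-(1 / 2) : ℝ) * gauss (2 * (r - s)) (z - y))) := by
      intro r hr
      rw [← lintegral_const_mul' _ _ ENNReal.ofReal_ne_top]
      refine lintegral_mono fun z => ?_
      rw [← ENNReal.ofReal_mul (by positivity)]
      refine ENNReal.ofReal_le_ofReal ?_
      refine (mul_le_mul_of_nonneg_right (hk t x r z hr.2) (leviMajorant_nonneg _ _ _ _ _ _)).trans
        (le_of_eq ?_)
      have : Real.exp (l * (r - s)) = Real.exp (l * (t - s)) * Real.exp (-(l * (t - r))) := by
        rw [← Real.exp_add]; congr 1; ring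
      rw [leviMajorant, this]
      ring
    calc _ ≤ _ := setLIntegral_mono' measurableSet_Ioo h1
      _ = _ := lintegral_const_mul' _ _ ENNReal.ofReal_ne_top
      _ ≤ _ := mul_le_mul_right (hconv l s t x y hl0 hst) _
      _ ≤ _ := by
        rw [← ENNReal.ofReal_mul (by positivity), hld]
        refine ENNReal.ofReal_le_ofReal ?_
        have h2 : K * C * D * (2 * (K * C * D + 1))⁻¹ ≤ 1 / 2 := by
          rw [← div_eq_mul_inv, div_le_iff₀ (by positivity)]
          linarith
        have h3 := leviMajorant_nonneg γ l t x s y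
        refine le_trans (le_of_eq ?_) (mul_le_mul_of_nonneg_right h2 h3)
        rw [leviMajorant]
        ring
  refine ⟨l, K * C, hl0, by positivity, fun m t x s y => ⟨?_, hstep t x s y⟩⟩
  induction m generalizing t x s y with
  | zero =>
    rcases le_or_gt t s with h | h
    · rw [leviTerm_of_le 0 h, leviMajorant_of_le h, abs_zero, mul_zero]
    · refine (hk t x s y h).trans ?_
      have hts : 0 < t - s := sub_pos.2 h
      have hg := gauss_nonneg (2 * (t - s)) (x - y)
      rw [pow_zero, mul_one, leviMajorant]
      refine mul_le_mul_of_nonneg_left (mul_le_mul_of_nonneg_right ?_ hg) (by positivity)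
      exact le_mul_of_one_le_right (by positivity) (Real.one_le_exp (by positivity))
  | succ m ih =>
    rcases le_or_gt t s with h | h
    · rw [leviTerm_of_le (m + 1) h, leviMajorant_of_le h, abs_zero, mul_zero]
    · have hH := leviMajorant_nonneg γ l t x s y
      refine (stConv_of_lintegral_le (M := fun r z => K * C * (1 / 2) ^ m *
        (|leviKernel γ b t x r z| * leviMajorant γ l r z s y)) (measurableKernel_leviKernel hb)
        (measurableKernel_leviTerm hb m) h.le (by positivity) (fun r _ z => ?_) ?_).2.2.2
      · rw [abs_mul]
        calc _ ≤ |leviKernel γ b t x r z| * (K * C * (1 / 2) ^ m * leviMajorant γ l r z s y) :=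
            mul_le_mul_of_nonneg_left (ih r z s y) (abs_nonneg _)
          _ = _ := by ring
      · simp_rw [ENNReal.ofReal_mul (show 0 ≤ K * C * (1 / 2 : ℝ) ^ m by positivity)]
        simp_rw [lintegral_const_mul' _ _ ENNReal.ofReal_ne_top]
        refine (mul_le_mul_right (hstep t x s y h) _).trans (le_of_eq ?_)
        rw [← ENNReal.ofReal_mul (by positivity)]
        congr 1
        ring

section Series

variable {γ l A : ℝ} {b : ℝ → ℝ → ℝ}

theorem summable_abs_leviTerm
    (hA : ∀ m t x s y, |leviTerm γ b m t x s y| ≤ A * (1 / 2) ^ m * leviMajorant γ l t x s y)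
    (t x s y : ℝ) : Summable fun m => |leviTerm γ b m t x s y| := by
  refine Summable.of_nonneg_of_le (fun _ => abs_nonneg _) (fun m => hA m t x s y) ?_
  exact (summable_geometric_two.mul_left A).mul_right _

theorem abs_leviSeries_le
    (hA : ∀ m t x s y, |leviTerm γ b m t x s y| ≤ A * (1 / 2) ^ m * leviMajorant γ l t x s y)
    (t x s y : ℝ) : |leviSeries γ b t x s y| ≤ 2 * A * leviMajorant γ l t x s y := by
  have h1 := summable_abs_leviTerm hA t x s y
  refine (norm_tsum_le_tsum_norm (f := fun m => leviTerm γ b m t x s y) h1).trans ?_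
  have h2 : HasSum (fun m : ℕ => A * (1 / 2 : ℝ) ^ m * leviMajorant γ l t x s y)
      (2 * A * leviMajorant γ l t x s y) := by
    rw [mul_comm 2 A]
    exact (hasSum_geometric_two.mul_left A).mul_right _
  rw [← h2.tsum_eq]
  exact h1.tsum_le_tsum (fun m => hA m t x s y) h2.summable

theorem measurableKernel_leviSeries (hb : Measurable (Function.uncurry b))
    (hA : ∀ m t x s y, |leviTerm γ b m t x s y| ≤ A * (1 / 2) ^ m * leviMajorant γ l t x s y) :
    MeasurableKernel (leviSeries γ b) := by
  refine measurable_of_tendsto_metrizable (f := fun n (q : ℝ × ℝ × ℝ × ℝ) =>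
    ∑ m ∈ Finset.range n, leviTerm γ b m q.1 q.2.1 q.2.2.1 q.2.2.2)
    (fun n => Finset.measurable_fun_sum _ fun m _ => measurableKernel_leviTerm hb m) ?_
  rw [tendsto_pi_nhds]
  exact fun q => (summable_abs_leviTerm hA _ _ _ _).of_abs.hasSum.tendsto_sum_nat

/-- Convolving a kernel with the Neumann series term by term. -/
theorem stConv_leviSeries (hb : Measurable (Function.uncurry b)) (hA0 : 0 ≤ A)
    (hA : ∀ m t x s y, |leviTerm γ b m t x s y| ≤ A * (1 / 2) ^ m * leviMajorant γ l t x s y)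
    {k : ParabolicKernel} (hk : MeasurableKernel k) {t x s y B : ℝ} (hst : s < t) (hB : 0 ≤ B)
    (h : ∫⁻ r in Ioo s t, ∫⁻ z, ENNReal.ofReal (|k t x r z| * leviMajorant γ l r z s y) ≤
      ENNReal.ofReal B) :
    (∀ m, StConvIntegrable k (leviTerm γ b m) t x s y) ∧
    Summable (fun m => |stConv k (leviTerm γ b m) t x s y|) ∧
    StConvIntegrable k (leviSeries γ b) t x s y ∧
    stConv k (leviSeries γ b) t x s y = ∑' m, stConv k (leviTerm γ b m) t x s y ∧
    stConv k (leviSeries γ b) t x s y =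
      ∫ q in Ioo s t ×ˢ univ, k t x q.1 q.2 * leviSeries γ b q.1 q.2 s y ∧
    |stConv k (leviSeries γ b) t x s y| ≤ 2 * A * B := by
  have hscale : ∀ c : ℝ, 0 ≤ c → ∫⁻ r in Ioo s t, ∫⁻ z, ENNReal.ofReal
      (c * (|k t x r z| * leviMajorant γ l r z s y)) ≤ ENNReal.ofReal (c * B) := by
    intro c hc
    simp_rw [ENNReal.ofReal_mul hc]
    simp_rw [lintegral_const_mul' _ _ ENNReal.ofReal_ne_top]
    exact mul_le_mul_right h _
  have hm := fun m => stConv_of_lintegral_le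
    (M := fun r z => A * (1 / 2) ^ m * (|k t x r z| * leviMajorant γ l r z s y)) hk
    (measurableKernel_leviTerm hb m) hst.le (by positivity) (fun r _ z => by
      rw [abs_mul]
      calc _ ≤ |k t x r z| * (A * (1 / 2) ^ m * leviMajorant γ l r z s y) :=
          mul_le_mul_of_nonneg_left (hA m r z s y) (abs_nonneg _)
        _ = _ := by ring) (hscale (A * (1 / 2) ^ m) (by positivity))
  have hs := stConv_of_lintegral_le
    (M := fun r z => 2 * A * (|k t x r z| * leviMajorant γ l r z s y)) hk
    (measurableKernel_leviSeries hb hA) hst.le (by positivity) (fun r _ z => by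
      rw [abs_mul]
      calc _ ≤ |k t x r z| * (2 * A * leviMajorant γ l r z s y) :=
          mul_le_mul_of_nonneg_left (abs_leviSeries_le hA r z s y) (abs_nonneg _)
        _ = _ := by ring) (hscale (2 * A) (by positivity))
  have hgeo : Summable fun m : ℕ => A * (1 / 2 : ℝ) ^ m * B :=
    (summable_geometric_two.mul_left A).mul_right _
  refine ⟨fun m => (hm m).1, Summable.of_nonneg_of_le (fun _ => abs_nonneg _)
    (fun m => (hm m).2.2.2) hgeo, hs.1, ?_, hs.2.1, hs.2.2.2⟩
  have := hasSum_integral_of_summable_integral_norm (fun m => (hm m).1)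
    (Summable.of_nonneg_of_le (fun m => integral_nonneg fun _ => norm_nonneg _)
      (fun m => (hm m).2.2.1) hgeo)
  rw [hs.2.1]
  simp_rw [fun m => (hm m).2.1]
  rw [this.tsum_eq]
  simp_rw [tsum_mul_left]
  rfl

end Series

theorem exists_lintegral_mul_leviMajorant_le {γ p : ℝ} (hγ : γ ∈ Ioo (0 : ℝ) 1)
    (hp : p + γ / 2 < 1) : ∃ C : ℝ, 0 < C ∧ ∀ l s t x y : ℝ, 0 ≤ l → s < t →
      ∫⁻ r in Ioo s t, ∫⁻ z, ENNReal.ofReal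
        ((t - r) ^ (-p) * gauss (2 * (t - r)) (x - z) * leviMajorant γ l r z s y) ≤
      ENNReal.ofReal (C * Real.exp (l * (t - s)) * (t - s) ^ (1 / 2 - p - γ / 2) *
        gauss (2 * (t - s)) (x - y)) := by
  obtain ⟨D, hD, hconv⟩ := exists_lintegral_conv_le (β := γ) (p := p) (q := 1 / 2) hγ.1.le hγ.2
    hp (by linarith [hγ.2]) (by linarith [hγ.1])
  refine ⟨Real.exp 1 * D, by positivity, fun l s t x y hl hst => ?_⟩
  have hts : 0 < t - s := sub_pos.2 hst
  have h1 : ∀ r ∈ Ioo s t, ∫⁻ z, ENNReal.ofReal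
      ((t - r) ^ (-p) * gauss (2 * (t - r)) (x - z) * leviMajorant γ l r z s y) ≤
      ENNReal.ofReal (Real.exp 1 * Real.exp (l * (t - s))) * ∫⁻ z, ENNReal.ofReal
      ((t - r) ^ (-p) * Real.exp (-((t - s)⁻¹ * (t - r))) * gauss (2 * (t - r)) (x - z) *
        (|z| ^ (-γ) * (r - s) ^ (-(1 / 2) : ℝ) * gauss (2 * (r - s)) (z - y))) := by
    intro r hr
    have hr1 : 0 < t - r := sub_pos.2 hr.2
    have hr2 : 0 < r - s := sub_pos.2 hr.1
    rw [← lintegral_const_mul' _ _ ENNReal.ofReal_ne_top]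
    refine lintegral_mono fun z => ?_
    rw [← ENNReal.ofReal_mul (by positivity)]
    refine ENNReal.ofReal_le_ofReal ?_
    have h2 : Real.exp (l * (r - s)) ≤ Real.exp (l * (t - s)) :=
      Real.exp_le_exp.2 (mul_le_mul_of_nonneg_left (by linarith) hl)
    have h3 : 1 ≤ Real.exp 1 * Real.exp (-((t - s)⁻¹ * (t - r))) := by
      rw [← Real.exp_add]
      refine Real.one_le_exp ?_
      have : (t - s)⁻¹ * (t - r) ≤ 1 := by
        rw [inv_mul_le_iff₀ hts]; linarith
      linarith
    have g1 := gauss_nonneg (2 * (t - r)) (x - z)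
    have g2 := gauss_nonneg (2 * (r - s)) (z - y)
    rw [leviMajorant]
    calc _ = (t - r) ^ (-p) * gauss (2 * (t - r)) (x - z) * (|z| ^ (-γ) * (r - s) ^ (-(1 / 2) : ℝ) *
          gauss (2 * (r - s)) (z - y)) * (1 * Real.exp (l * (r - s))) := by ring
      _ ≤ (t - r) ^ (-p) * gauss (2 * (t - r)) (x - z) * (|z| ^ (-γ) * (r - s) ^ (-(1 / 2) : ℝ) *
          gauss (2 * (r - s)) (z - y)) * ((Real.exp 1 * Real.exp (-((t - s)⁻¹ * (t - r)))) *
          Real.exp (l * (t - s))) := by gcongr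
      _ = _ := by ring
  calc _ ≤ _ := setLIntegral_mono' measurableSet_Ioo h1
    _ = _ := lintegral_const_mul' _ _ ENNReal.ofReal_ne_top
    _ ≤ _ := mul_le_mul_right (hconv (t - s)⁻¹ s t x y (by positivity) hst) _
    _ = _ := by
      rw [← ENNReal.ofReal_mul (by positivity)]
      congr 1
      rw [← Real.rpow_neg_one, ← Real.rpow_mul hts.le,
        show 1 / 2 - p - γ / 2 = -1 * -(1 - p - γ / 2) + -(1 / 2) by ring, Real.rpow_add hts]
      ring

theorem leviSeries_eq_add {γ l A : ℝ} {b : ℝ → ℝ → ℝ}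
    (hA : ∀ m t x s y, |leviTerm γ b m t x s y| ≤ A * (1 / 2) ^ m * leviMajorant γ l t x s y)
    {t x s y : ℝ} (h : stConv (leviKernel γ b) (leviSeries γ b) t x s y =
      ∑' m, stConv (leviKernel γ b) (leviTerm γ b m) t x s y) :
    leviSeries γ b t x s y =
      leviKernel γ b t x s y + stConv (leviKernel γ b) (leviSeries γ b) t x s y := by
  rw [leviSeries, (summable_abs_leviTerm hA t x s y).of_abs.tsum_eq_zero_add, h]
  rfl

/-- The exchange of the two middle coordinates. -/
def middleSwap : (ℝ × ℝ) × (ℝ × ℝ) ≃ᵐ (ℝ × ℝ) × (ℝ × ℝ) where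
  toFun w := ((w.1.1, w.2.1), (w.1.2, w.2.2))
  invFun w := ((w.1.1, w.2.1), (w.1.2, w.2.2))
  left_inv _ := rfl
  right_inv _ := rfl
  measurable_toFun := by
    simp only [Equiv.coe_fn_mk]
    fun_prop
  measurable_invFun := by
    simp only [Equiv.coe_fn_symm_mk]
    fun_prop

theorem measurePreserving_middleSwap : MeasurePreserving middleSwap := by
  have A := volume_preserving_prodAssoc (α₁ := ℝ) (β₁ := ℝ) (γ₁ := ℝ × ℝ)
  have B := volume_preserving_prodAssoc (α₁ := ℝ) (β₁ := ℝ) (γ₁ := ℝ)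
  have S : MeasurePreserving (Prod.swap : ℝ × ℝ → ℝ × ℝ) := Measure.measurePreserving_swap
  have I := MeasurePreserving.id (volume : Measure ℝ)
  exact (A.symm _).comp ((I.prod B).comp ((I.prod (S.prod I)).comp ((I.prod (B.symm _)).comp A)))

theorem exists_gauss_bound {ε : ℝ} (hε : 0 < ε) :
    ∃ C : ℝ, 0 < C ∧ ∀ v x, ε ≤ v → |gauss v x| ≤ C ∧ |gauss1 v x| ≤ C ∧ |gauss2 v x| ≤ C := by
  obtain ⟨C1, hC1, h1⟩ := exists_abs_gauss1_le
  obtain ⟨C2, hC2, h2⟩ := exists_abs_gauss2_le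
  set e := ε ^ (-(1 / 2) : ℝ) with he
  have he0 : 0 < e := by positivity
  have hg : ∀ v x, ε ≤ v → gauss v x ≤ e := fun v x hv =>
    (gauss_le_rpow (hε.trans_le hv) x).trans
      (Real.rpow_le_rpow_of_nonpos hε hv (by norm_num))
  refine ⟨e + C1 * e * e + C2 * ε⁻¹ * e, by positivity, fun v x hv => ⟨?_, ?_, ?_⟩⟩
  · rw [abs_of_nonneg (gauss_nonneg _ _)]
    nlinarith [hg v x hv, show 0 ≤ C1 * e * e by positivity, show 0 ≤ C2 * ε⁻¹ * e by positivity]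
  · have hv0 := hε.trans_le hv
    have := hg (2 * v) x (by linarith)
    have h3 : v ^ (-(1 / 2) : ℝ) ≤ e := Real.rpow_le_rpow_of_nonpos hε hv (by norm_num)
    have h4 := gauss_nonneg (2 * v) x
    calc _ ≤ _ := h1 v x hv0
      _ ≤ C1 * e * e := by gcongr
      _ ≤ _ := by nlinarith [show 0 ≤ C2 * ε⁻¹ * e by positivity]
  · have hv0 := hε.trans_le hv
    have := hg (2 * v) x (by linarith)
    have h3 : v⁻¹ ≤ ε⁻¹ := inv_anti₀ hε hv
    have h4 := gauss_nonneg (2 * v) x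
    calc _ ≤ _ := h2 v x hv0
      _ ≤ C2 * ε⁻¹ * e := by gcongr
      _ ≤ _ := by nlinarith [show 0 ≤ C1 * e * e by positivity]

theorem integrable_kernel_mul {K : ℝ → ℝ} (hK : Measurable K) {M : ℝ} (hM : ∀ x, |K x| ≤ M)
    {f g : ℝ → ℝ} (hf : Integrable f) (hg : Integrable g) :
    Integrable (fun p : ℝ × ℝ => K (p.1 - p.2) * (f p.1 * g p.2)) :=
  Integrable.bdd_mul (c := M) (hf.mul_prod hg)
    (hK.comp (measurable_fst.sub measurable_snd)).aestronglyMeasurable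
    (Eventually.of_forall fun _ => hM _)

/-- A kernel of the form `∫ k(y - x) k(y - z) dy` is positive definite. -/
theorem integral_kernel_mul_self_nonneg {k K : ℝ → ℝ} (hk : Measurable k) {M : ℝ}
    (hM : ∀ x, |k x| ≤ M) (hki : Integrable k)
    (hK : ∀ x z, K (x - z) = ∫ y, k (y - x) * k (y - z)) {f : ℝ → ℝ} (hfm : Measurable f)
    (hf : Integrable f) :
    0 ≤ ∫ p : ℝ × ℝ, K (p.1 - p.2) * (f p.1 * f p.2) := by
  have hM0 : 0 ≤ M := (abs_nonneg _).trans (hM 0)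
  have hm : Measurable (Function.uncurry fun (p : ℝ × ℝ) (y : ℝ) =>
      (k (y - p.1) * k (y - p.2)) * (f p.1 * f p.2)) := by
    unfold Function.uncurry
    fun_prop
  have hi1 : ∀ p : ℝ × ℝ, Integrable fun y => k (y - p.1) * k (y - p.2) := fun p =>
    Integrable.bdd_mul (c := M) (hki.comp_sub_right p.2)
      (hk.comp (measurable_id.sub_const p.1)).aestronglyMeasurable
      (Eventually.of_forall fun _ => hM _)
  have hi : Integrable (Function.uncurry fun (p : ℝ × ℝ) (y : ℝ) =>
      (k (y - p.1) * k (y - p.2)) * (f p.1 * f p.2))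
      ((volume : Measure (ℝ × ℝ)).prod (volume : Measure ℝ)) := by
    rw [integrable_prod_iff hm.aestronglyMeasurable]
    refine ⟨Eventually.of_forall fun p => (hi1 p).mul_const (f p.1 * f p.2), ?_⟩
    refine Integrable.mono' (g := fun p : ℝ × ℝ => (M * ∫ y, |k y|) * |f p.1 * f p.2|)
      ((hf.mul_prod hf).abs.const_mul _)
      hm.aestronglyMeasurable.norm.integral_prod_right' (Eventually.of_forall fun p => ?_)
    rw [Real.norm_eq_abs, abs_of_nonneg (integral_nonneg fun _ => norm_nonneg _)]
    simp only [Function.uncurry, norm_mul, Real.norm_eq_abs, abs_mul]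
    rw [integral_mul_const]
    refine mul_le_mul_of_nonneg_right ?_ (by positivity)
    rw [← integral_sub_right_eq_self (fun y => |k y|) p.2, ← integral_const_mul]
    refine integral_mono ?_ ((hki.comp_sub_right p.2).abs.const_mul M) fun y =>
      mul_le_mul_of_nonneg_right (hM _) (abs_nonneg _)
    simpa [abs_mul] using (hi1 p).abs
  have e1 : ∫ p : ℝ × ℝ, K (p.1 - p.2) * (f p.1 * f p.2) =
      ∫ p : ℝ × ℝ, ∫ y, (k (y - p.1) * k (y - p.2)) * (f p.1 * f p.2) := by
    congr 1; ext p
    rw [hK, integral_mul_const]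
  rw [e1, integral_integral_swap hi]
  refine integral_nonneg fun y => ?_
  have e2 : ∫ p : ℝ × ℝ, (k (y - p.1) * k (y - p.2)) * (f p.1 * f p.2) =
      (∫ x, k (y - x) * f x) * ∫ x, k (y - x) * f x := by
    rw [← integral_prod_mul, Measure.volume_eq_prod]
    congr 1; ext p; ring
  simp only [e2]
  exact mul_self_nonneg _

theorem integrable_gauss1 {v : ℝ} (hv : 0 < v) : Integrable (gauss1 v) := by
  have := (integrable_mul_gauss hv).const_mul (-v⁻¹)
  refine this.congr (Eventually.of_forall fun x => ?_)
  simp only [gauss1]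
  ring

theorem integral_gauss_kernel_nonneg {v : ℝ} (hv : 0 < v) {f : ℝ → ℝ} (hfm : Measurable f)
    (hf : Integrable f) : 0 ≤ ∫ p : ℝ × ℝ, gauss v (p.1 - p.2) * (f p.1 * f p.2) := by
  obtain ⟨C, -, hC⟩ := exists_gauss_bound (half_pos hv)
  have hi := integrable_gauss (v / 2) 0
  simp only [sub_zero] at hi
  refine integral_kernel_mul_self_nonneg (k := gauss (v / 2)) (measurable_const.gauss measurable_id)
    (fun x => (hC (v / 2) x le_rfl).1) hi (fun x z => ?_) hfm hf
  simp_rw [gauss_sub_comm (v / 2) _ x]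
  rw [integral_gauss_mul_gauss (half_pos hv) (half_pos hv), add_halves]

theorem integral_gauss2_kernel_nonpos {v : ℝ} (hv : 0 < v) {f : ℝ → ℝ} (hfm : Measurable f)
    (hf : Integrable f) : ∫ p : ℝ × ℝ, gauss2 v (p.1 - p.2) * (f p.1 * f p.2) ≤ 0 := by
  obtain ⟨C, -, hC⟩ := exists_gauss_bound (half_pos hv)
  have := integral_kernel_mul_self_nonneg (K := fun x => -gauss2 v x) (k := gauss1 (v / 2))
    (measurable_const.gauss1 measurable_id)
    (fun x => (hC (v / 2) x le_rfl).2.1) (integrable_gauss1 (half_pos hv)) (fun x z => by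
      rw [integral_gauss1_mul_gauss1 (half_pos hv), mul_div_cancel₀ v two_ne_zero]) hfm hf
  simp only [neg_mul, integral_neg] at this
  linarith

theorem abs_integral_gauss2_kernel_le {v : ℝ} (hv : 0 < v) {f g : ℝ → ℝ} (hfm : Measurable f)
    (hf : Integrable f) (hgm : Measurable g) (hg : Integrable g) :
    |∫ p : ℝ × ℝ, gauss2 v (p.1 - p.2) * (f p.1 * g p.2)| ≤
      1 / 2 * (-∫ p : ℝ × ℝ, gauss2 v (p.1 - p.2) * (f p.1 * f p.2)) +
      1 / 2 * (-∫ p : ℝ × ℝ, gauss2 v (p.1 - p.2) * (g p.1 * g p.2)) := by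
  obtain ⟨C, -, hC⟩ := exists_gauss_bound hv
  have hi : ∀ {f g : ℝ → ℝ}, Integrable f → Integrable g →
      Integrable (fun p : ℝ × ℝ => gauss2 v (p.1 - p.2) * (f p.1 * g p.2)) := fun hf hg =>
    integrable_kernel_mul (measurable_const.gauss2 measurable_id) (fun x => (hC v x le_rfl).2.2)
      hf hg
  have hsymm : ∫ p : ℝ × ℝ, gauss2 v (p.1 - p.2) * (g p.1 * f p.2) =
      ∫ p : ℝ × ℝ, gauss2 v (p.1 - p.2) * (f p.1 * g p.2) := by
    rw [Measure.volume_eq_prod, ← integral_prod_swap]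
    congr 1; ext p
    rw [Prod.fst_swap, Prod.snd_swap, gauss2_sub_comm, mul_comm (g p.2)]
  have h1 := integral_gauss2_kernel_nonpos hv (hfm.add hgm) (hf.add hg)
  have h2 := integral_gauss2_kernel_nonpos hv (hfm.sub hgm) (hf.sub hg)
  have e1 : ∫ p : ℝ × ℝ, gauss2 v (p.1 - p.2) * ((f + g) p.1 * (f + g) p.2) =
      (∫ p : ℝ × ℝ, gauss2 v (p.1 - p.2) * (f p.1 * f p.2)) +
      (∫ p : ℝ × ℝ, gauss2 v (p.1 - p.2) * (f p.1 * g p.2)) +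
      (∫ p : ℝ × ℝ, gauss2 v (p.1 - p.2) * (g p.1 * f p.2)) +
      (∫ p : ℝ × ℝ, gauss2 v (p.1 - p.2) * (g p.1 * g p.2)) := by
    rw [← integral_add (hi hf hf) (hi hf hg), ← integral_add ((hi hf hf).fun_add (hi hf hg)) (hi hg hf),
      ← integral_add (((hi hf hf).fun_add (hi hf hg)).fun_add (hi hg hf)) (hi hg hg)]
    congr 1; ext p
    simp only [Pi.add_apply]
    ring
  have e2 : ∫ p : ℝ × ℝ, gauss2 v (p.1 - p.2) * ((f - g) p.1 * (f - g) p.2) =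
      (∫ p : ℝ × ℝ, gauss2 v (p.1 - p.2) * (f p.1 * f p.2)) -
      (∫ p : ℝ × ℝ, gauss2 v (p.1 - p.2) * (f p.1 * g p.2)) -
      (∫ p : ℝ × ℝ, gauss2 v (p.1 - p.2) * (g p.1 * f p.2)) +
      (∫ p : ℝ × ℝ, gauss2 v (p.1 - p.2) * (g p.1 * g p.2)) := by
    have i1 : Integrable fun p : ℝ × ℝ => gauss2 v (p.1 - p.2) * (f p.1 * f p.2) -
        gauss2 v (p.1 - p.2) * (f p.1 * g p.2) := (hi hf hf).sub (hi hf hg)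
    have i2 : Integrable fun p : ℝ × ℝ => gauss2 v (p.1 - p.2) * (f p.1 * f p.2) -
        gauss2 v (p.1 - p.2) * (f p.1 * g p.2) - gauss2 v (p.1 - p.2) * (g p.1 * f p.2) :=
      i1.sub (hi hg hf)
    rw [← integral_sub (hi hf hf) (hi hf hg), ← integral_sub i1 (hi hg hf),
      ← integral_add i2 (hi hg hg)]
    congr 1; ext p
    simp only [Pi.sub_apply]
    ring
  rw [e1, hsymm] at h1
  rw [e2, hsymm] at h2
  rw [abs_le]
  constructor <;> linarith

theorem integral_gauss_kernel_le {v : ℝ} (hv : 0 < v) {f : ℝ → ℝ}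
    (hf : Integrable f) (hf2 : Integrable fun x => f x ^ 2) :
    ∫ p : ℝ × ℝ, gauss v (p.1 - p.2) * (f p.1 * f p.2) ≤ ∫ x, f x ^ 2 := by
  obtain ⟨C, -, hC⟩ := exists_gauss_bound hv
  have hg := integrable_gauss v 0
  simp only [sub_zero] at hg
  have h1 : Integrable (fun p : ℝ × ℝ => f p.2 ^ 2 * gauss v (p.1 - p.2)) :=
    hf2.convolution_integrand (ContinuousLinearMap.mul ℝ ℝ) hg
  have h2 : Integrable (fun p : ℝ × ℝ => f p.1 ^ 2 * gauss v (p.1 - p.2)) := by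
    refine h1.swap.congr (Eventually.of_forall fun p => ?_)
    simp only [Function.comp, Prod.fst_swap, Prod.snd_swap, gauss_sub_comm v p.2]
  have e1 : ∫ p : ℝ × ℝ, f p.2 ^ 2 * gauss v (p.1 - p.2) = ∫ x, f x ^ 2 := by
    rw [Measure.volume_eq_prod, integral_prod_symm _ h1]
    simp only [integral_const_mul, integral_gauss hv, mul_one]
  have e2 : ∫ p : ℝ × ℝ, f p.1 ^ 2 * gauss v (p.1 - p.2) = ∫ x, f x ^ 2 := by
    rw [Measure.volume_eq_prod, integral_prod _ h2]
    simp only [integral_const_mul, integral_gauss' hv, mul_one]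
  calc _ ≤ ∫ p : ℝ × ℝ, (1 / 2 * (f p.1 ^ 2 * gauss v (p.1 - p.2)) +
        1 / 2 * (f p.2 ^ 2 * gauss v (p.1 - p.2))) := by
        refine integral_mono (integrable_kernel_mul (measurable_const.gauss measurable_id)
          (fun x => (hC v x le_rfl).1) hf hf) ((h2.const_mul _).add (h1.const_mul _)) fun p => ?_
        have := gauss_nonneg v (p.1 - p.2)
        simp only
        nlinarith [mul_nonneg this (sq_nonneg (f p.1 - f p.2))]
    _ = _ := by
      rw [integral_add (h2.const_mul _) (h1.const_mul _), integral_const_mul, integral_const_mul,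
        e1, e2]
      ring

/-- The square function estimate for the heat semigroup. -/
theorem lintegral_gauss2_kernel_le {ε T : ℝ} (hε : 0 < ε) (hT : ε < T) {f : ℝ → ℝ}
    (hfm : Measurable f) (hf : Integrable f) (hf2 : Integrable fun x => f x ^ 2) :
    ∫⁻ v in Ioo ε T, ENNReal.ofReal (-∫ p : ℝ × ℝ, gauss2 v (p.1 - p.2) * (f p.1 * f p.2)) ≤
      ENNReal.ofReal (2 * ∫ x, f x ^ 2) := by
  obtain ⟨C, hC0, hC⟩ := exists_gauss_bound hε
  have hm : Measurable (Function.uncurry fun (v : ℝ) (p : ℝ × ℝ) =>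
      gauss2 v (p.1 - p.2) * (f p.1 * f p.2)) := by
    unfold Function.uncurry
    exact (Measurable.gauss2 (by fun_prop) (by fun_prop)).mul (by fun_prop)
  have hi : Integrable (Function.uncurry fun (v : ℝ) (p : ℝ × ℝ) =>
      gauss2 v (p.1 - p.2) * (f p.1 * f p.2))
      ((volume.restrict (Ioo ε T)).prod (volume : Measure (ℝ × ℝ))) := by
    have h1 : Integrable (fun _ : ℝ => C) (volume.restrict (Ioo ε T)) := integrable_const _
    refine (h1.mul_prod (hf.mul_prod hf).abs).mono' hm.aestronglyMeasurable ?_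
    have : ∀ᵐ v ∂(volume.restrict (Ioo ε T)), v ∈ Ioo ε T := ae_restrict_mem measurableSet_Ioo
    filter_upwards [Measure.quasiMeasurePreserving_fst.ae this] with w hw
    rw [Function.uncurry, norm_mul, Real.norm_eq_abs, Real.norm_eq_abs]
    exact mul_le_mul_of_nonneg_right (hC w.1 _ hw.1.le).2.2 (abs_nonneg _)
  have hi2 := hi.integral_prod_left
  simp only [Function.uncurry] at hi2
  rw [← ofReal_integral_eq_lintegral_ofReal hi2.fun_neg]
  · refine ENNReal.ofReal_le_ofReal ?_
    rw [integral_neg, integral_integral_swap hi]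
    have e : ∀ p : ℝ × ℝ, ∫ v in Ioo ε T, gauss2 v (p.1 - p.2) * (f p.1 * f p.2) =
        2 * (gauss T (p.1 - p.2) * (f p.1 * f p.2)) -
          2 * (gauss ε (p.1 - p.2) * (f p.1 * f p.2)) := by
      intro p
      rw [integral_mul_const, ← integral_Ioc_eq_integral_Ioo,
        ← intervalIntegral.integral_of_le hT.le]
      have hd : ∀ v ∈ uIcc ε T, HasDerivAt (fun v => 2 * gauss v (p.1 - p.2))
          (gauss2 v (p.1 - p.2)) v := by
        intro v hv
        rw [uIcc_of_le hT.le] at hv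
        exact ((hasDerivAt_gauss_var (hε.trans_le hv.1) _).const_mul 2).congr_deriv (by ring)
      have hii : IntervalIntegrable (fun v => gauss2 v (p.1 - p.2)) volume ε T := by
        refine ContinuousOn.intervalIntegrable ?_
        rw [uIcc_of_le hT.le]
        exact continuousOn_gauss2.comp (f := fun v => (v, p.1 - p.2)) (by fun_prop)
          fun v hv => ⟨hε.trans_le hv.1, mem_univ _⟩
      rw [intervalIntegral.integral_eq_sub_of_hasDerivAt hd hii]
      ring
    simp_rw [e]
    have hk : ∀ v, ε ≤ v → Integrable (fun p : ℝ × ℝ => gauss v (p.1 - p.2) * (f p.1 * f p.2)) :=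
      fun v hv => integrable_kernel_mul (measurable_const.gauss measurable_id)
        (fun x => (hC v x hv).1) hf hf
    rw [integral_sub ((hk T hT.le).const_mul 2) ((hk ε le_rfl).const_mul 2), integral_const_mul,
      integral_const_mul]
    have h1 := integral_gauss_kernel_nonneg (hε.trans hT) hfm hf
    have h2 := integral_gauss_kernel_le hε hf hf2
    linarith
  · refine (ae_restrict_iff' measurableSet_Ioo).2 (Eventually.of_forall fun v hv => ?_)
    have := integral_gauss2_kernel_nonpos (hε.trans hv.1) hfm hf
    simp only [Pi.zero_apply]
    exact neg_nonneg.2 this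

theorem integrable_gauss2_truncated {ε T : ℝ} (hε : 0 < ε) {f g : ℝ × ℝ → ℝ}
    (hf : Integrable f) (hg : Integrable g) :
    Integrable fun w : (ℝ × ℝ) × (ℝ × ℝ) => (Ioo ε T).indicator 1 (w.1.1 - w.2.1) *
      gauss2 (w.1.1 - w.2.1) (w.1.2 - w.2.2) * (g w.1 * f w.2) := by
  obtain ⟨C, hC0, hC⟩ := exists_gauss_bound hε
  refine Integrable.bdd_mul (c := C) (hg.mul_prod hf) ?_ (Eventually.of_forall fun w => ?_)
  · exact (((measurable_one.indicator measurableSet_Ioo).comp (by fun_prop)).mul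
      (Measurable.gauss2 (by fun_prop) (by fun_prop))).aestronglyMeasurable
  · by_cases h : w.1.1 - w.2.1 ∈ Ioo ε T
    · rw [indicator_of_mem h, Pi.one_apply, one_mul]
      exact (hC _ _ h.1.le).2.2
    · rw [indicator_of_notMem h, zero_mul, norm_zero]
      exact hC0.le

/-- The second derivative of the heat potential is bounded in `L²`, uniformly in the truncation
of the kernel. -/
theorem abs_integral_gauss2_truncated_le {ε T : ℝ} (hε : 0 < ε) (hT : ε < T) {f g : ℝ × ℝ → ℝ}
    (hfm : Measurable f) (hf : Integrable f) (hf2 : Integrable fun q => f q ^ 2)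
    (hgm : Measurable g) (hg : Integrable g) (hg2 : Integrable fun q => g q ^ 2) :
    |∫ w : (ℝ × ℝ) × (ℝ × ℝ), (Ioo ε T).indicator 1 (w.1.1 - w.2.1) *
      gauss2 (w.1.1 - w.2.1) (w.1.2 - w.2.2) * (g w.1 * f w.2)| ≤
      (∫ q, f q ^ 2) + ∫ q, g q ^ 2 := by
  have hi := integrable_gauss2_truncated (T := T) hε hf hg
  have hi' := (measurePreserving_middleSwap.integrable_comp_emb
    middleSwap.measurableEmbedding).2 hi
  rw [← measurePreserving_middleSwap.integral_comp middleSwap.measurableEmbedding]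
  simp only [middleSwap, MeasurableEquiv.coe_mk, Equiv.coe_fn_mk, Function.comp_def] at hi' ⊢
  rw [Measure.volume_eq_prod, integral_prod _ hi']
  set S : Set (ℝ × ℝ) := {a | a.1 - a.2 ∈ Ioo ε T} with hS
  have hSm : MeasurableSet S := measurableSet_Ioo.preimage (measurable_fst.sub measurable_snd)
  set Qg : ℝ × ℝ → ℝ := fun a =>
    -∫ p : ℝ × ℝ, gauss2 (a.1 - a.2) (p.1 - p.2) * (g (a.1, p.1) * g (a.1, p.2)) with hQg
  set Qf : ℝ × ℝ → ℝ := fun a =>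
    -∫ p : ℝ × ℝ, gauss2 (a.1 - a.2) (p.1 - p.2) * (f (a.2, p.1) * f (a.2, p.2)) with hQf
  have hQgm : Measurable Qg := by
    have : Measurable fun w : (ℝ × ℝ) × (ℝ × ℝ) =>
        gauss2 (w.1.1 - w.1.2) (w.2.1 - w.2.2) * (g (w.1.1, w.2.1) * g (w.1.1, w.2.2)) :=
      (Measurable.gauss2 (by fun_prop) (by fun_prop)).mul (by fun_prop)
    exact (this.stronglyMeasurable.integral_prod_right' (ν := volume)).measurable.neg
  have hQfm : Measurable Qf := by
    have : Measurable fun w : (ℝ × ℝ) × (ℝ × ℝ) =>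
        gauss2 (w.1.1 - w.1.2) (w.2.1 - w.2.2) * (f (w.1.2, w.2.1) * f (w.1.2, w.2.2)) :=
      (Measurable.gauss2 (by fun_prop) (by fun_prop)).mul (by fun_prop)
    exact (this.stronglyMeasurable.integral_prod_right' (ν := volume)).measurable.neg
  have hfa : ∀ᵐ r : ℝ, Integrable (fun z => f (r, z)) := hf.prod_right_ae
  have hga : ∀ᵐ r : ℝ, Integrable (fun z => g (r, z)) := hg.prod_right_ae
  have hf2a : ∀ᵐ r : ℝ, Integrable (fun z => f (r, z) ^ 2) := hf2.prod_right_ae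
  have hg2a : ∀ᵐ r : ℝ, Integrable (fun z => g (r, z) ^ 2) := hg2.prod_right_ae
  have key : ∀ᵐ a : ℝ × ℝ, ENNReal.ofReal |∫ p : ℝ × ℝ, (Ioo ε T).indicator 1 (a.1 - a.2) *
      gauss2 (a.1 - a.2) (p.1 - p.2) * (g (a.1, p.1) * f (a.2, p.2))| ≤
      S.indicator (fun a => ENNReal.ofReal (1 / 2) * ENNReal.ofReal (Qg a)) a +
      S.indicator (fun a => ENNReal.ofReal (1 / 2) * ENNReal.ofReal (Qf a)) a := by
    filter_upwards [Measure.quasiMeasurePreserving_fst.ae hga,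
      Measure.quasiMeasurePreserving_snd.ae hfa] with a ha1 ha2
    by_cases h : a ∈ S
    · have h0 : 0 < a.1 - a.2 := hε.trans h.1
      rw [indicator_of_mem h, indicator_of_mem h, indicator_of_mem (show a.1 - a.2 ∈ Ioo ε T from h),
        ← ENNReal.ofReal_mul (by norm_num), ← ENNReal.ofReal_mul (by norm_num),
        ← ENNReal.ofReal_add]
      · simp only [Pi.one_apply, one_mul]
        exact ENNReal.ofReal_le_ofReal (abs_integral_gauss2_kernel_le h0 (by fun_prop) ha1
          (by fun_prop) ha2)
      · exact mul_nonneg (by norm_num)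
          (neg_nonneg.2 (integral_gauss2_kernel_nonpos h0 (by fun_prop) ha1))
      · exact mul_nonneg (by norm_num)
          (neg_nonneg.2 (integral_gauss2_kernel_nonpos h0 (by fun_prop) ha2))
    · rw [indicator_of_notMem h, indicator_of_notMem h,
        indicator_of_notMem (show a.1 - a.2 ∉ Ioo ε T from h)]
      simp
  have hG : ∫⁻ a, S.indicator (fun a => ENNReal.ofReal (1 / 2) * ENNReal.ofReal (Qg a)) a ≤
      ENNReal.ofReal (∫ q, g q ^ 2) := by
    rw [Measure.volume_eq_prod, lintegral_prod _ (Measurable.aemeasurable (by measurability)),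
      integral_prod _ hg2, ofReal_integral_eq_lintegral_ofReal hg2.integral_prod_left
        (Eventually.of_forall fun t => integral_nonneg fun _ => sq_nonneg _)]
    refine lintegral_mono_ae ?_
    filter_upwards [hga, hg2a] with t h1 h2
    have e : ∀ r, S.indicator (fun a => ENNReal.ofReal (1 / 2) * ENNReal.ofReal (Qg a)) (t, r) =
        (Ioo ε T).indicator (fun v => ENNReal.ofReal (1 / 2) * ENNReal.ofReal
          (-∫ p : ℝ × ℝ, gauss2 v (p.1 - p.2) * (g (t, p.1) * g (t, p.2)))) (t - r) := fun r => rfl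
    simp_rw [e]
    rw [lintegral_sub_left_eq_self ((Ioo ε T).indicator (fun v => ENNReal.ofReal (1 / 2) *
      ENNReal.ofReal (-∫ p : ℝ × ℝ, gauss2 v (p.1 - p.2) * (g (t, p.1) * g (t, p.2))))) t,
      lintegral_indicator measurableSet_Ioo, lintegral_const_mul' _ _ ENNReal.ofReal_ne_top]
    refine (mul_le_mul_right (lintegral_gauss2_kernel_le hε hT
      (f := fun x => g (t, x)) (by fun_prop) h1 h2) _).trans (le_of_eq ?_)
    rw [← ENNReal.ofReal_mul (by norm_num)]
    congr 1; ring
  have hF : ∫⁻ a, S.indicator (fun a => ENNReal.ofReal (1 / 2) * ENNReal.ofReal (Qf a)) a ≤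
      ENNReal.ofReal (∫ q, f q ^ 2) := by
    rw [Measure.volume_eq_prod, lintegral_prod_symm _ (Measurable.aemeasurable (by measurability)),
      integral_prod _ hf2, ofReal_integral_eq_lintegral_ofReal hf2.integral_prod_left
        (Eventually.of_forall fun t => integral_nonneg fun _ => sq_nonneg _)]
    refine lintegral_mono_ae ?_
    filter_upwards [hfa, hf2a] with r h1 h2
    have e : ∀ t, S.indicator (fun a => ENNReal.ofReal (1 / 2) * ENNReal.ofReal (Qf a)) (t, r) =
        (Ioo ε T).indicator (fun v => ENNReal.ofReal (1 / 2) * ENNReal.ofReal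
          (-∫ p : ℝ × ℝ, gauss2 v (p.1 - p.2) * (f (r, p.1) * f (r, p.2)))) (t - r) := fun t => rfl
    simp_rw [e]
    rw [lintegral_sub_right_eq_self ((Ioo ε T).indicator (fun v => ENNReal.ofReal (1 / 2) *
      ENNReal.ofReal (-∫ p : ℝ × ℝ, gauss2 v (p.1 - p.2) * (f (r, p.1) * f (r, p.2))))) r,
      lintegral_indicator measurableSet_Ioo, lintegral_const_mul' _ _ ENNReal.ofReal_ne_top]
    refine (mul_le_mul_right (lintegral_gauss2_kernel_le hε hT
      (f := fun x => f (r, x)) (by fun_prop) h1 h2) _).trans (le_of_eq ?_)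
    rw [← ENNReal.ofReal_mul (by norm_num)]
    congr 1; ring
  have hnf : 0 ≤ ∫ q, f q ^ 2 := integral_nonneg fun _ => sq_nonneg _
  have hng : 0 ≤ ∫ q, g q ^ 2 := integral_nonneg fun _ => sq_nonneg _
  rw [← ENNReal.ofReal_le_ofReal_iff (by positivity), ENNReal.ofReal_add hnf hng, add_comm]
  refine le_trans ?_ (add_le_add hG hF)
  rw [← lintegral_add_left (by measurability)]
  refine le_trans ?_ (lintegral_mono_ae key)
  have := enorm_integral_le_lintegral_enorm (μ := (volume : Measure (ℝ × ℝ)))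
    (fun a : ℝ × ℝ => ∫ p : ℝ × ℝ, (Ioo ε T).indicator 1 (a.1 - a.2) *
      gauss2 (a.1 - a.2) (p.1 - p.2) * (g (a.1, p.1) * f (a.2, p.2)))
  simpa only [Real.enorm_eq_ofReal_abs] using this

/-- The weighted heat kernel is integrable over space-time. -/
theorem integrable_rpow_mul_exp_mul_gauss {β c : ℝ} (h0 : 0 ≤ β) (h1 : β < 1)
    (hc : 0 < c + 1 - β / 2) (s y : ℝ) :
    Integrable fun q : ℝ × ℝ => (q.1 - s) ^ c * Real.exp (-(q.1 - s)) *
      (|q.2| ^ (-β) * gauss (2 * (q.1 - s)) (q.2 - y)) := by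
  obtain ⟨C, hC, hmom⟩ := exists_lintegral_abs_rpow_mul_gauss_le h0 h1
  have hm : Measurable fun q : ℝ × ℝ => (q.1 - s) ^ c * Real.exp (-(q.1 - s)) *
      (|q.2| ^ (-β) * gauss (2 * (q.1 - s)) (q.2 - y)) :=
    Measurable.mul (by fun_prop) (Measurable.mul (by fun_prop)
      (Measurable.gauss (by fun_prop) (by fun_prop)))
  refine ⟨hm.aestronglyMeasurable, ?_⟩
  rw [hasFiniteIntegral_iff_enorm, Measure.volume_eq_prod, lintegral_prod _ hm.enorm.aemeasurable]
  have hG := (Real.GammaIntegral_convergent hc).integrable_indicator measurableSet_Ioi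
  have hG2 := (hG.comp_sub_right s).const_mul (C * 2 ^ (-(β / 2)))
  refine lt_of_le_of_lt (lintegral_mono fun r => ?_) hG2.2
  rcases le_or_gt r s with hr | hr
  · have : ∀ z, gauss (2 * (r - s)) (z - y) = 0 := fun z => gauss_of_nonpos (by linarith) _
    simp [this]
  · have hrs : 0 < r - s := sub_pos.2 hr
    have e : ∀ z, ‖(r - s) ^ c * Real.exp (-(r - s)) *
        (|z| ^ (-β) * gauss (2 * (r - s)) (z - y))‖ₑ =
        ENNReal.ofReal ((r - s) ^ c * Real.exp (-(r - s))) *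
          ENNReal.ofReal (|z| ^ (-β) * gauss (2 * (r - s)) (z - y)) := by
      intro z
      have := gauss_nonneg (2 * (r - s)) (z - y)
      rw [Real.enorm_eq_ofReal (by positivity), ENNReal.ofReal_mul (by positivity)]
    simp only [e]
    rw [lintegral_const_mul' _ _ ENNReal.ofReal_ne_top]
    refine (mul_le_mul_right (hmom _ y (by positivity)) _).trans (le_of_eq ?_)
    rw [← ENNReal.ofReal_mul (by positivity), indicator_of_mem (show r - s ∈ Ioi 0 from hrs),
      Real.enorm_eq_ofReal (by positivity), Real.mul_rpow (by norm_num) hrs.le,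
      show c + 1 - β / 2 - 1 = c + -(β / 2) by ring, Real.rpow_add hrs]
    congr 1
    ring

/-- A measurable function dominated by a multiple of the majorant `leviMajorant γ l · · s y`. -/
structure IsLeviSource (γ l A s y : ℝ) (h : ℝ × ℝ → ℝ) : Prop where
  mem : γ ∈ Ioo (0 : ℝ) 1
  l_nonneg : 0 ≤ l
  A_nonneg : 0 ≤ A
  measurable : Measurable h
  abs_le : ∀ q, |h q| ≤ A * leviMajorant γ l q.1 q.2 s y

/-- A convolution kernel with the bounds of the heat kernel (`p = 0`) or of its derivative
(`p = 1/2`). -/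
structure IsHeatLike (k : ℝ → ℝ → ℝ) (C p : ℝ) : Prop where
  C_nonneg : 0 ≤ C
  p_nonneg : 0 ≤ p
  p_le : p ≤ 1 / 2
  of_nonpos : ∀ v x, v ≤ 0 → k v x = 0
  measurable : Measurable (Function.uncurry k)
  continuousOn : ContinuousOn (Function.uncurry k) (Ioi 0 ×ˢ univ)
  abs_le : ∀ v x, 0 < v → |k v x| ≤ C * (v ^ (-p) * gauss (2 * v) x)

theorem exists_isHeatLike_gauss : ∃ C, IsHeatLike gauss C 0 := by
  obtain ⟨C, hC, h⟩ := exists_gauss_le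
  refine ⟨C, hC.le, le_rfl, by norm_num, fun v x hv => gauss_of_nonpos hv x, measurable_gauss,
    continuousOn_gauss, fun v x hv => ?_⟩
  rw [neg_zero, Real.rpow_zero, one_mul, abs_of_nonneg (gauss_nonneg v x)]
  exact h v x hv

theorem exists_isHeatLike_gauss1 : ∃ C, IsHeatLike gauss1 C (1 / 2) := by
  obtain ⟨C, hC, h⟩ := exists_abs_gauss1_le
  refine ⟨C, hC.le, by norm_num, by norm_num, fun v x hv => gauss1_of_nonpos hv x,
    measurable_fst.gauss1 measurable_snd, continuousOn_gauss1, fun v x hv => ?_⟩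
  rw [← mul_assoc]
  exact h v x hv

/-- The potential of the function `h` with respect to the convolution kernel `k`. -/
noncomputable def heatPot (k : ℝ → ℝ → ℝ) (h : ℝ × ℝ → ℝ) (t x : ℝ) : ℝ :=
  ∫ q : ℝ × ℝ, k (t - q.1) (x - q.2) * h q

namespace IsLeviSource

variable {γ l A s y : ℝ} {h : ℝ × ℝ → ℝ}

theorem eq_zero (hh : IsLeviSource γ l A s y h) {q : ℝ × ℝ} (hq : q.1 ≤ s) : h q = 0 := by
  have := hh.abs_le q
  rw [leviMajorant_of_le hq, mul_zero] at this
  exact abs_nonpos_iff.1 this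

theorem abs_exp_mul_le (hh : IsLeviSource γ l A s y h) (β : ℝ) {q : ℝ × ℝ} (hq : q.2 ≠ 0) :
    |Real.exp (-((l + 1) * (q.1 - s))) * |q.2| ^ (-β) * h q| ≤
      A * ((q.1 - s) ^ (-(1 / 2) : ℝ) * Real.exp (-(q.1 - s)) *
      (|q.2| ^ (-(γ + β)) * gauss (2 * (q.1 - s)) (q.2 - y))) := by
  have h1 : Real.exp (-((l + 1) * (q.1 - s))) * Real.exp (l * (q.1 - s)) =
      Real.exp (-(q.1 - s)) := by rw [← Real.exp_add]; congr 1; ring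
  have h2 : |q.2| ^ (-(γ + β)) = |q.2| ^ (-γ) * |q.2| ^ (-β) := by
    rw [← Real.rpow_add (abs_pos.2 hq)]; congr 1; ring
  rw [abs_mul, abs_of_nonneg (by positivity)]
  refine (mul_le_mul_of_nonneg_left (hh.abs_le q) (by positivity)).trans (le_of_eq ?_)
  rw [leviMajorant, ← h1, h2]
  ring

theorem integrable_exp_mul (hh : IsLeviSource γ l A s y h) {β : ℝ} (h0 : 0 ≤ γ + β) (h1 : γ + β < 1) :
    Integrable fun q => Real.exp (-((l + 1) * (q.1 - s))) * |q.2| ^ (-β) * h q := by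
  have hm := hh.measurable
  refine ((integrable_rpow_mul_exp_mul_gauss (β := γ + β) (c := -(1 / 2))
    h0 h1 (by linarith) s y).const_mul A).mono'
    (Measurable.aestronglyMeasurable (by fun_prop)) ?_
  have : ∀ᵐ z : ℝ, z ≠ 0 := Measure.ae_ne volume 0
  filter_upwards [Measure.quasiMeasurePreserving_snd.ae this] with q hq
  exact hh.abs_exp_mul_le β hq

theorem integrable_Iio_mul (hh : IsLeviSource γ l A s y h) {β : ℝ} (h0 : 0 ≤ γ + β) (h1 : γ + β < 1)
    (T : ℝ) : Integrable fun q : ℝ × ℝ => (Iio T).indicator 1 q.1 * (|q.2| ^ (-β) * h q) := by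
  have hm := hh.measurable
  refine ((hh.integrable_exp_mul h0 h1).abs.const_mul
    (Real.exp ((l + 1) * (T - s)))).mono' (Measurable.aestronglyMeasurable ?_)
    (Eventually.of_forall fun q => ?_)
  · exact ((measurable_one.indicator measurableSet_Iio).comp measurable_fst).mul (by fun_prop)
  · by_cases hq : q.1 ∈ Iio T
    · rw [indicator_of_mem hq, Pi.one_apply, one_mul, Real.norm_eq_abs, mul_assoc,
        abs_mul (Real.exp _), abs_of_pos (Real.exp_pos _), ← mul_assoc, ← Real.exp_add]
      refine le_mul_of_one_le_left (abs_nonneg _) (Real.one_le_exp ?_)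
      have h2 := hh.l_nonneg
      have h3 : q.1 < T := hq
      nlinarith
    · rw [indicator_of_notMem hq, zero_mul, norm_zero]
      positivity

theorem integrable_Iio (hh : IsLeviSource γ l A s y h) (T : ℝ) :
    Integrable fun q : ℝ × ℝ => (Iio T).indicator 1 q.1 * h q := by
  have := hh.integrable_Iio_mul (β := 0) (by linarith [hh.mem.1]) (by linarith [hh.mem.2]) T
  simpa using this

theorem exists_abs_le (hh : IsLeviSource γ l A s y h) {η : ℝ} (hη : 0 < η) (T : ℝ) :
    ∃ C, 0 ≤ C ∧ ∀ q : ℝ × ℝ, s + η ≤ q.1 → q.1 ≤ T → |h q| ≤ C * |q.2| ^ (-γ) := by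
  have hA := hh.A_nonneg
  refine ⟨A * (η ^ (-(1 / 2) : ℝ) * Real.exp (l * (T - s)) * η ^ (-(1 / 2) : ℝ)),
    by positivity, fun q h1 h2 => ?_⟩
  have hq : η ≤ q.1 - s := by linarith
  have hq0 : 0 < q.1 - s := by linarith
  have e1 : (q.1 - s) ^ (-(1 / 2) : ℝ) ≤ η ^ (-(1 / 2) : ℝ) :=
    Real.rpow_le_rpow_of_nonpos hη hq (by norm_num)
  have e2 : Real.exp (l * (q.1 - s)) ≤ Real.exp (l * (T - s)) :=
    Real.exp_le_exp.2 (mul_le_mul_of_nonneg_left (by linarith) hh.l_nonneg)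
  have e3 : gauss (2 * (q.1 - s)) (q.2 - y) ≤ η ^ (-(1 / 2) : ℝ) :=
    (gauss_le_rpow (by linarith) _).trans (Real.rpow_le_rpow_of_nonpos hη (by linarith) (by norm_num))
  have e4 := gauss_nonneg (2 * (q.1 - s)) (q.2 - y)
  calc |h q| ≤ _ := hh.abs_le q
    _ = A * ((q.1 - s) ^ (-(1 / 2) : ℝ) * Real.exp (l * (q.1 - s)) *
        gauss (2 * (q.1 - s)) (q.2 - y)) * |q.2| ^ (-γ) := by rw [leviMajorant]; ring
    _ ≤ _ := by gcongr

theorem integrable_kernel (hh : IsLeviSource γ l A s y h) {k : ℝ → ℝ → ℝ} {C p : ℝ}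
    (hk : IsHeatLike k C p) (t x : ℝ) : Integrable fun q : ℝ × ℝ => k (t - q.1) (x - q.2) * h q := by
  have hm : Measurable (Function.uncurry fun r z => k (t - r) (x - z) * h (r, z)) :=
    (hk.measurable.comp (by fun_prop : Measurable fun q : ℝ × ℝ => (t - q.1, x - q.2))).mul
      hh.measurable
  have hz : ∀ q : ℝ × ℝ, q ∉ Ioo s t ×ˢ (univ : Set ℝ) → k (t - q.1) (x - q.2) * h q = 0 := by
    intro q hq
    simp only [mem_prod, mem_Ioo, mem_univ, and_true, not_and_or, not_lt] at hq
    rcases hq with hq | hq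
    · rw [hh.eq_zero hq, mul_zero]
    · rw [hk.of_nonpos _ _ (by linarith), zero_mul]
  rcases le_or_gt t s with hts | hts
  · refine (integrable_zero _ _ _).congr (Eventually.of_forall fun q => (hz q ?_).symm)
    rw [Ioo_eq_empty (by linarith), empty_prod]
    exact notMem_empty q
  · obtain ⟨D, hD, hconv⟩ := exists_lintegral_mul_leviMajorant_le (p := p) hh.mem
      (by linarith [hk.p_le, hh.mem.2])
    have hC := hk.C_nonneg
    have hA := hh.A_nonneg
    have hts' : 0 < t - s := sub_pos.2 hts
    have hg := gauss_nonneg (2 * (t - s)) (x - y)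
    have := (integrableOn_of_lintegral_le hm hts.le (B := C * A * (D * Real.exp (l * (t - s)) *
      (t - s) ^ (1 / 2 - p - γ / 2) * gauss (2 * (t - s)) (x - y))) (by positivity) ?_).1
    · refine (integrable_indicator_iff (measurableSet_Ioo.prod MeasurableSet.univ)).2 this |>.congr
        (Eventually.of_forall fun q => ?_)
      by_cases hq : q ∈ Ioo s t ×ˢ (univ : Set ℝ)
      · rw [indicator_of_mem hq]
      · rw [indicator_of_notMem hq]
        exact (hz q hq).symm
    · rw [ENNReal.ofReal_mul (by positivity)]
      refine le_trans ?_ (mul_le_mul_right (hconv l s t x y hh.l_nonneg hts) _)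
      rw [← lintegral_const_mul' _ _ ENNReal.ofReal_ne_top]
      refine setLIntegral_mono' measurableSet_Ioo fun r hr => ?_
      rw [← lintegral_const_mul' _ _ ENNReal.ofReal_ne_top]
      refine lintegral_mono fun z => ?_
      rw [← ENNReal.ofReal_mul (by positivity)]
      refine ENNReal.ofReal_le_ofReal ?_
      have hg := gauss_nonneg (2 * (t - r)) (x - z)
      have hr' := sub_pos.2 hr.2
      rw [abs_mul]
      calc _ ≤ (C * ((t - r) ^ (-p) * gauss (2 * (t - r)) (x - z))) *
          (A * leviMajorant γ l r z s y) :=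
          mul_le_mul (hk.abs_le _ _ (sub_pos.2 hr.2)) (hh.abs_le (r, z)) (abs_nonneg _)
            (by positivity)
        _ = _ := by ring

theorem heatPot_eq_setIntegral (hh : IsLeviSource γ l A s y h) {k : ℝ → ℝ → ℝ} {C p : ℝ}
    (hk : IsHeatLike k C p) (t x : ℝ) :
    heatPot k h t x = ∫ q in Ioo s t ×ˢ univ, k (t - q.1) (x - q.2) * h q := by
  rw [heatPot, setIntegral_eq_integral_of_forall_compl_eq_zero]
  intro q hq
  simp only [mem_prod, mem_Ioo, mem_univ, and_true, not_and_or, not_lt] at hq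
  rcases hq with hq | hq
  · rw [hh.eq_zero hq, mul_zero]
  · rw [hk.of_nonpos _ _ (by linarith), zero_mul]

end IsLeviSource

/-- The kernel `k` cut off at times `≤ ε`. -/
noncomputable def truncKernel (ε : ℝ) (k : ℝ → ℝ → ℝ) (v x : ℝ) : ℝ :=
  (Ioi ε).indicator 1 v * k v x

theorem IsHeatLike.exists_abs_trunc_le {k : ℝ → ℝ → ℝ} {C p ε : ℝ} (hk : IsHeatLike k C p)
    (hε : 0 < ε) : ∃ M, 0 ≤ M ∧ ∀ v x, |truncKernel ε k v x| ≤ M := by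
  have hC := hk.C_nonneg
  refine ⟨C * (ε ^ (-p) * ε ^ (-(1 / 2) : ℝ)), by positivity, fun v x => ?_⟩
  rw [truncKernel]
  by_cases hv : v ∈ Ioi ε
  · have hv' : ε < v := hv
    rw [indicator_of_mem hv, Pi.one_apply, one_mul]
    refine (hk.abs_le v x (hε.trans hv')).trans ?_
    have h1 : v ^ (-p) ≤ ε ^ (-p) :=
      Real.rpow_le_rpow_of_nonpos hε hv'.le (by linarith [hk.p_nonneg])
    have h2 : gauss (2 * v) x ≤ ε ^ (-(1 / 2) : ℝ) :=
      (gauss_le_rpow (by linarith) x).trans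
        (Real.rpow_le_rpow_of_nonpos hε (by linarith) (by norm_num))
    have := gauss_nonneg (2 * v) x
    gcongr
  · rw [indicator_of_notMem hv, zero_mul, abs_zero]
    positivity

theorem measurable_truncKernel {ε : ℝ} {k : ℝ → ℝ → ℝ} (hk : Measurable (Function.uncurry k)) :
    Measurable (Function.uncurry (truncKernel ε k)) :=
  ((measurable_one.indicator measurableSet_Ioi).comp measurable_fst).mul hk

theorem truncKernel_of_le {ε : ℝ} {k : ℝ → ℝ → ℝ} {v x : ℝ} (hv : v ≤ ε) :
    truncKernel ε k v x = 0 := by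
  rw [truncKernel, indicator_of_notMem (by simpa using hv), zero_mul]

theorem truncKernel_of_lt {ε : ℝ} {k : ℝ → ℝ → ℝ} {v x : ℝ} (hv : ε < v) :
    truncKernel ε k v x = k v x := by
  rw [truncKernel, indicator_of_mem (by simpa using hv), Pi.one_apply, one_mul]

namespace IsLeviSource

variable {γ l A s y : ℝ} {h : ℝ × ℝ → ℝ}

theorem abs_trunc_mul_le {ε M T t x : ℝ} {k : ℝ → ℝ → ℝ} (hε : 0 < ε)
    (hM : ∀ v x, |truncKernel ε k v x| ≤ M) (ht : t ≤ T) (q : ℝ × ℝ) :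
    |truncKernel ε k (t - q.1) (x - q.2) * h q| ≤ M * |(Iio T).indicator 1 q.1 * h q| := by
  by_cases hq : q.1 ∈ Iio T
  · rw [indicator_of_mem hq, Pi.one_apply, one_mul, abs_mul]
    exact mul_le_mul_of_nonneg_right (hM _ _) (abs_nonneg _)
  · have : T ≤ q.1 := not_lt.1 hq
    rw [truncKernel_of_le (by linarith), zero_mul, abs_zero]
    have := (abs_nonneg _).trans (hM 0 0)
    positivity

theorem continuous_heatPot_trunc (hh : IsLeviSource γ l A s y h) {k : ℝ → ℝ → ℝ} {C p ε : ℝ}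
    (hk : IsHeatLike k C p) (hε : 0 < ε) :
    Continuous (Function.uncurry (heatPot (truncKernel ε k) h)) := by
  obtain ⟨M, hM0, hM⟩ := hk.exists_abs_trunc_le hε
  have hmt := measurable_truncKernel (ε := ε) hk.measurable
  rw [continuous_iff_continuousAt]
  intro a
  unfold Function.uncurry heatPot
  refine continuousAt_of_dominated
    (bound := fun q => M * |(Iio (a.1 + 1)).indicator 1 q.1 * h q|) ?_ ?_
    ((hh.integrable_Iio (a.1 + 1)).abs.const_mul M) ?_
  · exact Eventually.of_forall fun b => ((hmt.comp (by fun_prop : Measurable fun q : ℝ × ℝ =>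
      (b.1 - q.1, b.2 - q.2))).mul hh.measurable).aestronglyMeasurable
  · have : ∀ᶠ b : ℝ × ℝ in 𝓝 a, b.1 < a.1 + 1 :=
      (continuous_fst.tendsto a).eventually (Iio_mem_nhds (by linarith))
    filter_upwards [this] with b hb
    exact Eventually.of_forall fun q => abs_trunc_mul_le hε hM hb.le q
  · have : ∀ᵐ r : ℝ, r ≠ a.1 - ε := Measure.ae_ne volume _
    filter_upwards [Measure.quasiMeasurePreserving_fst.ae this] with q hq
    refine ContinuousAt.mul ?_ continuousAt_const
    rcases lt_or_gt_of_ne hq with hq | hq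
    · have h1 : ∀ᶠ b : ℝ × ℝ in 𝓝 a, ε < b.1 - q.1 :=
        ((continuous_fst.sub continuous_const).tendsto a).eventually
          (Ioi_mem_nhds (by simp only [Pi.sub_apply]; linarith))
      have h2 : ContinuousAt (fun b : ℝ × ℝ => k (b.1 - q.1) (b.2 - q.2)) a := by
        refine ContinuousAt.comp (g := Function.uncurry k) (f := fun b : ℝ × ℝ =>
          (b.1 - q.1, b.2 - q.2)) (hk.continuousOn.continuousAt ?_) (by fun_prop)
        exact (isOpen_Ioi.prod isOpen_univ).mem_nhds
          ⟨by simp only [mem_Ioi]; linarith, mem_univ _⟩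
      exact h2.congr (h1.mono fun b hb => (truncKernel_of_lt hb).symm)
    · have h1 : ∀ᶠ b : ℝ × ℝ in 𝓝 a, b.1 - q.1 < ε :=
        ((continuous_fst.sub continuous_const).tendsto a).eventually
          (Iio_mem_nhds (by simp only [Pi.sub_apply]; linarith))
      exact continuousAt_const (y := (0 : ℝ)) |>.congr
        (h1.mono fun b hb => (truncKernel_of_le hb.le).symm)

theorem integrable_trunc (hh : IsLeviSource γ l A s y h) {k : ℝ → ℝ → ℝ} {C p ε : ℝ}
    (hk : IsHeatLike k C p) (hε : 0 < ε) (t x : ℝ) :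
    Integrable fun q : ℝ × ℝ => truncKernel ε k (t - q.1) (x - q.2) * h q := by
  obtain ⟨M, hM0, hM⟩ := hk.exists_abs_trunc_le hε
  have hmt := measurable_truncKernel (ε := ε) hk.measurable
  exact ((hh.integrable_Iio t).abs.const_mul M).mono' ((hmt.comp (by fun_prop :
    Measurable fun q : ℝ × ℝ => (t - q.1, x - q.2))).mul hh.measurable).aestronglyMeasurable
    (Eventually.of_forall fun q => abs_trunc_mul_le hε hM le_rfl q)

theorem hasDerivAt_heatPot_trunc (hh : IsLeviSource γ l A s y h) {k k' : ℝ → ℝ → ℝ}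
    {C p C' p' ε : ℝ} (hk : IsHeatLike k C p) (hk' : IsHeatLike k' C' p')
    (hd : ∀ v x, HasDerivAt (k v) (k' v x) x) (hε : 0 < ε) (t x : ℝ) :
    HasDerivAt (fun x => heatPot (truncKernel ε k) h t x) (heatPot (truncKernel ε k') h t x) x := by
  obtain ⟨M, hM0, hM⟩ := hk'.exists_abs_trunc_le hε
  refine (hasDerivAt_integral_of_dominated_loc_of_deriv_le (s := univ) univ_mem
    (F' := fun x q => truncKernel ε k' (t - q.1) (x - q.2) * h q)
    (bound := fun q => M * |(Iio t).indicator 1 q.1 * h q|)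
    (Eventually.of_forall fun x => (hh.integrable_trunc hk hε t x).aestronglyMeasurable)
    (hh.integrable_trunc hk hε t x) (hh.integrable_trunc hk' hε t x).aestronglyMeasurable
    (Eventually.of_forall fun q x _ => abs_trunc_mul_le hε hM le_rfl q)
    ((hh.integrable_Iio t).abs.const_mul M) (Eventually.of_forall fun q x _ => ?_)).2
  exact ((HasDerivAt.comp_sub_const x q.2 (hd (t - q.1) (x - q.2))).const_mul _).mul_const _

theorem exists_abs_heatPot_sub_trunc_le (hh : IsLeviSource γ l A s y h) {k : ℝ → ℝ → ℝ}
    {C p : ℝ} (hk : IsHeatLike k C p) {η : ℝ} (hη : 0 < η) (T : ℝ) :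
    ∃ D, 0 ≤ D ∧ ∀ ε t x, 0 < ε → ε ≤ η → s + 2 * η ≤ t → t ≤ T →
      |heatPot k h t x - heatPot (truncKernel ε k) h t x| ≤ D * ε ^ (1 - p - γ / 2) := by
  obtain ⟨B, hB, hbound⟩ := hh.exists_abs_le hη T
  obtain ⟨C1, hC1, hmom⟩ := exists_lintegral_abs_rpow_mul_gauss_le hh.mem.1.le hh.mem.2
  have hC := hk.C_nonneg
  have ha : 0 < 1 - p - γ / 2 := by linarith [hk.p_le, hh.mem.2]
  refine ⟨C * B * C1 / (1 - p - γ / 2), by positivity, fun ε t x hε hεη hst htT => ?_⟩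
  rw [heatPot, heatPot, ← integral_sub (hh.integrable_kernel hk t x) (hh.integrable_trunc hk hε t x)]
  have hmt := measurable_truncKernel (ε := ε) hk.measurable
  have hm : Measurable fun q : ℝ × ℝ => k (t - q.1) (x - q.2) * h q -
      truncKernel ε k (t - q.1) (x - q.2) * h q :=
    ((hk.measurable.comp (by fun_prop : Measurable fun q : ℝ × ℝ => (t - q.1, x - q.2))).mul
      hh.measurable).sub ((hmt.comp (by fun_prop : Measurable fun q : ℝ × ℝ =>
        (t - q.1, x - q.2))).mul hh.measurable)
  rw [← ENNReal.ofReal_le_ofReal_iff (by positivity), ← Real.enorm_eq_ofReal_abs]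
  refine (enorm_integral_le_lintegral_enorm _).trans ?_
  rw [Measure.volume_eq_prod, lintegral_prod _ hm.enorm.aemeasurable]
  have key : ∀ r, ∫⁻ z, ‖k (t - r) (x - z) * h (r, z) -
      truncKernel ε k (t - r) (x - z) * h (r, z)‖ₑ ≤ (Ico (t - ε) t).indicator (fun r =>
      ENNReal.ofReal (C * B * C1) * ENNReal.ofReal ((t - r) ^ ((1 - p - γ / 2) - 1))) r := by
    intro r
    by_cases hr : r ∈ Ico (t - ε) t
    · have hr0 : 0 < t - r := sub_pos.2 hr.2
      have hr1 := hr.1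
      rw [indicator_of_mem hr]
      have e : ∀ z, ‖k (t - r) (x - z) * h (r, z) - truncKernel ε k (t - r) (x - z) * h (r, z)‖ₑ ≤
          ENNReal.ofReal (C * B * (t - r) ^ (-p)) *
            ENNReal.ofReal (|z| ^ (-γ) * gauss (2 * (t - r)) (z - x)) := by
        intro z
        have hg := gauss_nonneg (2 * (t - r)) (x - z)
        rw [truncKernel_of_le (by linarith), zero_mul, sub_zero, Real.enorm_eq_ofReal_abs, abs_mul,
          ← ENNReal.ofReal_mul (by positivity), gauss_sub_comm _ z x]
        refine ENNReal.ofReal_le_ofReal ((mul_le_mul (hk.abs_le _ _ hr0)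
          (hbound (r, z) (by simp only; linarith) (by simp only; linarith)) (abs_nonneg _)
          (by positivity)).trans (le_of_eq ?_))
        ring
      refine (lintegral_mono e).trans ?_
      rw [lintegral_const_mul' _ _ ENNReal.ofReal_ne_top]
      refine (mul_le_mul_right (hmom _ x (by positivity)) _).trans ?_
      rw [← ENNReal.ofReal_mul (by positivity), ← ENNReal.ofReal_mul (by positivity),
        Real.mul_rpow (by norm_num) hr0.le,
        show 1 - p - γ / 2 - 1 = -p + -(γ / 2) by ring, Real.rpow_add hr0]
      refine ENNReal.ofReal_le_ofReal ?_
      have h2 : (2 : ℝ) ^ (-(γ / 2)) ≤ 1 :=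
        Real.rpow_le_one_of_one_le_of_nonpos (by norm_num) (by linarith [hh.mem.1])
      calc _ = 2 ^ (-(γ / 2)) * (C * B * C1 * ((t - r) ^ (-p) * (t - r) ^ (-(γ / 2)))) := by ring
        _ ≤ _ := mul_le_of_le_one_left (by positivity) h2
    · have : ∀ z, k (t - r) (x - z) * h (r, z) - truncKernel ε k (t - r) (x - z) * h (r, z) = 0 := by
        intro z
        simp only [mem_Ico, not_and_or, not_le, not_lt] at hr
        rcases hr with hr | hr
        · rw [truncKernel_of_lt (by linarith), sub_self]
        · rw [hk.of_nonpos _ _ (by linarith), truncKernel_of_le (by linarith), sub_self]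
      simp [this]
  refine (lintegral_mono key).trans ?_
  rw [lintegral_indicator measurableSet_Ico, setLIntegral_congr Ioo_ae_eq_Ico.symm,
    lintegral_const_mul _ (by fun_prop), lintegral_Ioo_sub_right_rpow (by linarith) ha,
    ← ENNReal.ofReal_mul (by positivity), sub_sub_cancel]
  exact le_of_eq (by congr 1; ring)

theorem tendstoUniformlyOn_heatPot_trunc (hh : IsLeviSource γ l A s y h) {k : ℝ → ℝ → ℝ}
    {C p : ℝ} (hk : IsHeatLike k C p) {η : ℝ} (hη : 0 < η) (T : ℝ) :
    TendstoUniformlyOn (fun ε => Function.uncurry (heatPot (truncKernel ε k) h))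
      (Function.uncurry (heatPot k h)) (𝓝[>] 0) (Ioo (s + 2 * η) T ×ˢ univ) := by
  obtain ⟨D, hD, hbound⟩ := hh.exists_abs_heatPot_sub_trunc_le hk hη T
  have ha : 0 < 1 - p - γ / 2 := by linarith [hk.p_le, hh.mem.2]
  have hlim : Tendsto (fun ε : ℝ => D * ε ^ (1 - p - γ / 2)) (𝓝[>] 0) (𝓝 0) := by
    have := ((Real.continuous_rpow_const ha.le).tendsto 0).const_mul D
    rw [Real.zero_rpow ha.ne', mul_zero] at this
    exact this.mono_left nhdsWithin_le_nhds
  rw [Metric.tendstoUniformlyOn_iff]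
  intro e he
  filter_upwards [hlim.eventually (Iio_mem_nhds he), self_mem_nhdsWithin,
    mem_nhdsWithin_of_mem_nhds (Iic_mem_nhds hη)] with ε h1 h2 h3 a ha
  exact (hbound ε a.1 a.2 h2 h3 ha.1.1.le ha.1.2.le).trans_lt h1

theorem continuousOn_heatPot (hh : IsLeviSource γ l A s y h) {k : ℝ → ℝ → ℝ} {C p : ℝ}
    (hk : IsHeatLike k C p) :
    ContinuousOn (Function.uncurry (heatPot k h)) (Ioi s ×ˢ univ) := by
  rintro a ⟨ha, -⟩
  have ha' : s < a.1 := ha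
  have hη : 0 < (a.1 - s) / 4 := by linarith
  have h1 := (hh.tendstoUniformlyOn_heatPot_trunc hk hη (a.1 + 1)).continuousOn
    (Eventually.frequently (by
      filter_upwards [self_mem_nhdsWithin] with ε hε
      exact (hh.continuous_heatPot_trunc hk hε).continuousOn))
  refine (h1.continuousAt ?_).continuousWithinAt
  exact (isOpen_Ioo.prod isOpen_univ).mem_nhds ⟨⟨by linarith, by linarith⟩, mem_univ _⟩

theorem hasDerivAt_heatPot (hh : IsLeviSource γ l A s y h) {k k' : ℝ → ℝ → ℝ} {C p C' p' : ℝ}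
    (hk : IsHeatLike k C p) (hk' : IsHeatLike k' C' p') (hd : ∀ v x, HasDerivAt (k v) (k' v x) x)
    {t : ℝ} (ht : s < t) (x : ℝ) :
    HasDerivAt (fun x => heatPot k h t x) (heatPot k' h t x) x := by
  have hη : 0 < (t - s) / 4 := by linarith
  have ht' : t ∈ Ioo (s + 2 * ((t - s) / 4)) (t + 1) := ⟨by linarith, by linarith⟩
  have h1 : TendstoUniformlyOn (fun ε x => heatPot (truncKernel ε k') h t x)
      (fun x => heatPot k' h t x) (𝓝[>] 0) univ := by
    have := (hh.tendstoUniformlyOn_heatPot_trunc hk' hη (t + 1)).comp (fun x => (t, x))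
    refine this.mono fun x _ => ?_
    exact ⟨ht', mem_univ _⟩
  refine hasDerivAt_of_tendstoUniformlyOn isOpen_univ h1
    (f := fun ε x => heatPot (truncKernel ε k) h t x) ?_ (fun x _ => ?_) (mem_univ x)
  · filter_upwards [self_mem_nhdsWithin] with ε hε x _
    exact hh.hasDerivAt_heatPot_trunc hk hk' hd hε t x
  · exact (hh.tendstoUniformlyOn_heatPot_trunc hk hη (t + 1)).tendsto_at
      (x := (t, x)) ⟨ht', mem_univ _⟩

end IsLeviSource

/-- A bounded weakly singular kernel with a Gaussian profile maps `L¹` to locally integrable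
functions, with absolute convergence. -/
theorem integrable_gauss_mul_prod {κ c s : ℝ} (h0 : 0 ≤ κ) (h1 : κ < 1) (hc : 0 < c - κ / 2 + 1)
    {g : ℝ × ℝ → ℝ} (hgm : Measurable g) (hg : Integrable g) (hgs : ∀ q, q.1 ≤ s → g q = 0) (T : ℝ) :
    Integrable fun w : (ℝ × ℝ) × (ℝ × ℝ) => (Iio T).indicator 1 w.1.1 *
      ((w.1.1 - w.2.1) ^ c * (|w.1.2| ^ (-κ) * gauss (2 * (w.1.1 - w.2.1)) (w.1.2 - w.2.2))) *
        g w.2 := by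
  obtain ⟨C, hC, hmom⟩ := exists_lintegral_abs_rpow_mul_gauss_le h0 h1
  have hi : Measurable ((Iio T).indicator (1 : ℝ → ℝ)) := measurable_one.indicator measurableSet_Iio
  have hm : Measurable fun w : (ℝ × ℝ) × (ℝ × ℝ) => (Iio T).indicator 1 w.1.1 *
      ((w.1.1 - w.2.1) ^ c * (|w.1.2| ^ (-κ) * gauss (2 * (w.1.1 - w.2.1)) (w.1.2 - w.2.2))) *
        g w.2 :=
    ((hi.comp (by fun_prop)).mul (Measurable.mul (by fun_prop) (Measurable.mul (by fun_prop)
      (Measurable.gauss (by fun_prop) (by fun_prop))))).mul (by fun_prop)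
  refine ⟨hm.aestronglyMeasurable, ?_⟩
  set a := c - κ / 2 + 1 with ha
  rw [hasFiniteIntegral_iff_enorm, Measure.volume_eq_prod,
    lintegral_prod_symm _ hm.enorm.aemeasurable]
  have key : ∀ q : ℝ × ℝ, ∫⁻ p : ℝ × ℝ, ‖(Iio T).indicator 1 p.1 *
      ((p.1 - q.1) ^ c * (|p.2| ^ (-κ) * gauss (2 * (p.1 - q.1)) (p.2 - q.2))) * g q‖ₑ ≤
      ENNReal.ofReal (C * ((T - s) ^ a / a)) * ‖g q‖ₑ := by
    intro q
    rcases le_or_gt q.1 s with hq | hq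
    · simp [hgs q hq]
    simp only [enorm_mul _ (g q)]
    rw [lintegral_mul_const _ (by
      refine Measurable.enorm ?_
      exact (hi.comp measurable_fst).mul (Measurable.mul (by fun_prop) (Measurable.mul (by fun_prop)
        (Measurable.gauss (by fun_prop) (by fun_prop)))))]
    refine mul_le_mul_left ?_ _
    rw [Measure.volume_eq_prod, lintegral_prod _ (by
      refine (Measurable.enorm ?_).aemeasurable
      exact (hi.comp measurable_fst).mul (Measurable.mul (by fun_prop) (Measurable.mul (by fun_prop)
        (Measurable.gauss (by fun_prop) (by fun_prop)))))]
    have h2 : ∀ t, ∫⁻ x, ‖(Iio T).indicator 1 t *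
        ((t - q.1) ^ c * (|x| ^ (-κ) * gauss (2 * (t - q.1)) (x - q.2)))‖ₑ ≤
        (Ioo q.1 T).indicator (fun t => ENNReal.ofReal C * ENNReal.ofReal ((t - q.1) ^ (a - 1))) t := by
      intro t
      by_cases ht : t ∈ Ioo q.1 T
      · have ht0 : 0 < t - q.1 := sub_pos.2 ht.1
        rw [indicator_of_mem ht, indicator_of_mem (show t ∈ Iio T from ht.2)]
        have e : ∀ x, ‖(1 : ℝ → ℝ) t * ((t - q.1) ^ c * (|x| ^ (-κ) *
            gauss (2 * (t - q.1)) (x - q.2)))‖ₑ = ENNReal.ofReal ((t - q.1) ^ c) *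
            ENNReal.ofReal (|x| ^ (-κ) * gauss (2 * (t - q.1)) (x - q.2)) := by
          intro x
          have := gauss_nonneg (2 * (t - q.1)) (x - q.2)
          rw [Pi.one_apply, one_mul, Real.enorm_eq_ofReal (by positivity),
            ENNReal.ofReal_mul (by positivity)]
        simp_rw [e]
        rw [lintegral_const_mul' _ _ ENNReal.ofReal_ne_top]
        refine (mul_le_mul_right (hmom _ q.2 (by positivity)) _).trans ?_
        rw [← ENNReal.ofReal_mul (by positivity), ← ENNReal.ofReal_mul (by positivity),
          Real.mul_rpow (by norm_num) ht0.le, show a - 1 = c + -(κ / 2) by rw [ha]; ring,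
          Real.rpow_add ht0]
        refine ENNReal.ofReal_le_ofReal ?_
        have h2 : (2 : ℝ) ^ (-(κ / 2)) ≤ 1 :=
          Real.rpow_le_one_of_one_le_of_nonpos (by norm_num) (by linarith)
        calc _ = 2 ^ (-(κ / 2)) * (C * ((t - q.1) ^ c * (t - q.1) ^ (-(κ / 2)))) := by ring
          _ ≤ _ := mul_le_of_le_one_left (by positivity) h2
      · simp only [mem_Ioo, not_and_or, not_lt] at ht
        rcases ht with ht | ht
        · simp [gauss_of_nonpos (show 2 * (t - q.1) ≤ 0 by linarith)]
        · simp [indicator_of_notMem (show t ∉ Iio T by simpa using ht)]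
    refine (lintegral_mono h2).trans ?_
    rw [lintegral_indicator measurableSet_Ioo, lintegral_const_mul _ (by fun_prop)]
    rcases le_or_gt T q.1 with hT | hT
    · simp [Ioo_eq_empty (not_lt.2 hT)]
    · rw [lintegral_Ioo_sub_left_rpow hT hc, ← ENNReal.ofReal_mul hC.le]
      have h3 : (T - q.1) ^ a ≤ (T - s) ^ a :=
        Real.rpow_le_rpow (by linarith) (by linarith) hc.le
      refine ENNReal.ofReal_le_ofReal ?_
      gcongr
  refine lt_of_le_of_lt (lintegral_mono key) ?_
  rw [lintegral_const_mul' _ _ ENNReal.ofReal_ne_top]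
  exact ENNReal.mul_lt_top ENNReal.ofReal_lt_top hg.2

theorem abs_rpow_sub_rpow_le {κ δ a b : ℝ} (hκ : 0 < κ) (hδ : 0 ≤ δ) (h1 : κ + δ ≤ 1)
    (ha : 0 ≤ a) (hb : 0 < b) :
    |a ^ κ - b ^ κ| ≤ |a - b| ^ (κ + δ) * b ^ (-δ) := by
  rcases le_or_gt |a - b| b with hab | hab
  · have e1 : |a ^ κ - b ^ κ| ≤ |a - b| * b ^ (κ - 1) := by
      set u := a / b with hu
      have hu0 : 0 ≤ u := by positivity
      have hau : a = u * b := by rw [hu]; field_simp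
      have h2 : |u ^ κ - 1| ≤ |u - 1| := by
        rcases le_total u 1 with h | h
        · have h3 : u ≤ u ^ κ := by
            rcases hu0.eq_or_lt with h0 | h0
            · rw [← h0, Real.zero_rpow hκ.ne']
            · calc u = u ^ (1 : ℝ) := (Real.rpow_one u).symm
                _ ≤ u ^ κ := Real.rpow_le_rpow_of_exponent_ge h0 h (by linarith)
          have h4 : u ^ κ ≤ 1 := Real.rpow_le_one hu0 h hκ.le
          rw [abs_of_nonpos (by linarith), abs_of_nonpos (by linarith)]
          linarith
        · have h3 : u ^ κ ≤ u := by
            calc u ^ κ ≤ u ^ (1 : ℝ) := Real.rpow_le_rpow_of_exponent_le h (by linarith)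
              _ = u := Real.rpow_one u
          have h4 : 1 ≤ u ^ κ := Real.one_le_rpow h hκ.le
          rw [abs_of_nonneg (by linarith), abs_of_nonneg (by linarith)]
          linarith
      have e2 : a ^ κ - b ^ κ = (u ^ κ - 1) * b ^ κ := by
        rw [hau, Real.mul_rpow hu0 hb.le]; ring
      have e3 : a - b = (u - 1) * b := by rw [hau]; ring
      rw [e2, e3, abs_mul, abs_mul, abs_of_pos hb, abs_of_pos (Real.rpow_pos_of_pos hb κ),
        mul_assoc, ← Real.rpow_one_add' hb.le (by linarith), show 1 + (κ - 1) = κ by ring]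
      gcongr
    rcases (abs_nonneg (a - b)).eq_or_lt with h0 | h0
    · rw [← h0, zero_mul] at e1
      exact e1.trans (by positivity)
    · refine e1.trans ?_
      have e4 : |a - b| = |a - b| ^ (κ + δ) * |a - b| ^ (1 - κ - δ) := by
        rw [← Real.rpow_add h0, show κ + δ + (1 - κ - δ) = 1 by ring, Real.rpow_one]
      have e5 : b ^ (-δ) = b ^ (1 - κ - δ) * b ^ (κ - 1) := by
        rw [← Real.rpow_add hb]; congr 1; ring
      have e6 : |a - b| ^ (1 - κ - δ) ≤ b ^ (1 - κ - δ) :=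
        Real.rpow_le_rpow h0.le hab (by linarith)
      calc |a - b| * b ^ (κ - 1) = |a - b| ^ (κ + δ) * (|a - b| ^ (1 - κ - δ) * b ^ (κ - 1)) := by
            rw [← mul_assoc, ← e4]
        _ ≤ |a - b| ^ (κ + δ) * (b ^ (1 - κ - δ) * b ^ (κ - 1)) := by gcongr
        _ = _ := by rw [e5]
  · have h0 : 0 < |a - b| := hb.trans hab
    have hmono : |a ^ κ - b ^ κ| ≤ |a - b| ^ κ := by
      rcases le_total a b with h | h
      · have : b - a ≤ b := by linarith
        rw [abs_of_nonpos (by linarith)] at hab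
        linarith
      · have h3 := Real.rpow_add_le_add_rpow (sub_nonneg.2 h) hb.le hκ.le (by linarith)
        rw [sub_add_cancel] at h3
        rw [abs_of_nonneg (sub_nonneg.2 (Real.rpow_le_rpow hb.le h hκ.le)),
          abs_of_nonneg (sub_nonneg.2 h)]
        linarith
    refine hmono.trans ?_
    rw [Real.rpow_add h0, mul_assoc]
    refine le_mul_of_one_le_right (by positivity) ?_
    rw [Real.rpow_neg hb.le, ← div_eq_mul_inv, one_le_div (by positivity)]
    exact Real.rpow_le_rpow hb.le hab.le hδ

/-- The temporal factor of `spaceTimeWeight`. -/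
noncomputable def timeWeight (l v : ℝ) : ℝ := v * Real.exp (-((l + 1) * v))

theorem abs_timeWeight_sub_le {l a b : ℝ} (hl : 0 ≤ l) (ha : 0 ≤ a) (hb : 0 ≤ b) :
    |timeWeight l a - timeWeight l b| ≤ |a - b| := by
  have hd : ∀ v ∈ Ici (0 : ℝ), HasDerivWithinAt (timeWeight l)
      ((1 - (l + 1) * v) * Real.exp (-((l + 1) * v))) (Ici 0) v := by
    intro v _
    have := (hasDerivAt_id v).mul (((hasDerivAt_id v).const_mul (l + 1)).neg.exp)
    refine HasDerivAt.hasDerivWithinAt (this.congr_deriv ?_)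
    simp only [id, Pi.neg_apply]
    ring
  have hbound : ∀ v ∈ Ici (0 : ℝ), ‖(1 - (l + 1) * v) * Real.exp (-((l + 1) * v))‖ ≤ 1 := by
    intro v hv
    have hv0 : 0 ≤ (l + 1) * v := mul_nonneg (by linarith) hv
    rw [norm_mul, Real.norm_eq_abs, Real.norm_eq_abs, abs_of_pos (Real.exp_pos _), Real.exp_neg,
      ← div_eq_mul_inv, div_le_one (Real.exp_pos _)]
    have := Real.add_one_le_exp ((l + 1) * v)
    rw [abs_le]
    constructor <;> linarith
  have := (convex_Ici (0 : ℝ)).norm_image_sub_le_of_norm_hasDerivWithin_le hd hbound hb ha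
  simpa using this

theorem le_timeWeight {l η T v : ℝ} (hl : 0 ≤ l) (hη : 0 < η) (h1 : η ≤ v) (h2 : v ≤ T) :
    η * Real.exp (-((l + 1) * T)) ≤ timeWeight l v := by
  unfold timeWeight
  have : Real.exp (-((l + 1) * T)) ≤ Real.exp (-((l + 1) * v)) :=
    Real.exp_le_exp.2 (neg_le_neg (mul_le_mul_of_nonneg_left h2 (by linarith)))
  exact mul_le_mul h1 this (Real.exp_pos _).le (hη.le.trans h1)

/-- The weight that turns an `IsLeviSource` into a square integrable function. -/
noncomputable def spaceTimeWeight (γ l s : ℝ) (q : ℝ × ℝ) : ℝ :=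
  timeWeight l (q.1 - s) * |q.2| ^ (γ / 2)

theorem measurable_spaceTimeWeight (γ l s : ℝ) : Measurable (spaceTimeWeight γ l s) := by
  unfold spaceTimeWeight timeWeight
  fun_prop

theorem spaceTimeWeight_pos {γ l s : ℝ} {q : ℝ × ℝ} (h1 : s < q.1) (h2 : q.2 ≠ 0) :
    0 < spaceTimeWeight γ l s q := by
  have : 0 < q.1 - s := sub_pos.2 h1
  unfold spaceTimeWeight timeWeight
  have := abs_pos.2 h2
  positivity

/-- The kernel of the commutator of the weight with the second derivative of the heat potential. -/
noncomputable def commKernel (γ l s : ℝ) (h : ℝ × ℝ → ℝ) (p q : ℝ × ℝ) : ℝ :=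
  gauss2 (p.1 - q.1) (p.2 - q.2) *
    ((1 - spaceTimeWeight γ l s q / spaceTimeWeight γ l s p) * h q)

namespace IsLeviSource

variable {γ l A s y : ℝ} {h : ℝ × ℝ → ℝ}

theorem integrable_weight_mul (hh : IsLeviSource γ l A s y h) :
    Integrable fun q => spaceTimeWeight γ l s q * h q := by
  have hm := hh.measurable
  have hw := measurable_spaceTimeWeight γ l s
  refine ((integrable_rpow_mul_exp_mul_gauss (β := γ / 2) (c := 1 / 2)
    (by linarith [hh.mem.1]) (by linarith [hh.mem.2]) (by linarith [hh.mem.2]) s y).const_mul A).mono'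
    (hw.mul hm).aestronglyMeasurable ?_
  have : ∀ᵐ z : ℝ, z ≠ 0 := Measure.ae_ne volume 0
  filter_upwards [Measure.quasiMeasurePreserving_snd.ae this] with q hq
  rcases le_or_gt q.1 s with hs | hs
  · rw [hh.eq_zero hs, mul_zero, norm_zero, gauss_of_nonpos (by linarith)]
    simp
  · have hqs : 0 < q.1 - s := sub_pos.2 hs
    have h1 := hh.abs_exp_mul_le (-(γ / 2)) hq
    rw [neg_neg, show γ + -(γ / 2) = γ / 2 by ring] at h1
    have e : spaceTimeWeight γ l s q * h q = (q.1 - s) *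
        (Real.exp (-((l + 1) * (q.1 - s))) * |q.2| ^ (γ / 2) * h q) := by
      rw [spaceTimeWeight, timeWeight]; ring
    rw [e, Real.norm_eq_abs, abs_mul, abs_of_pos hqs]
    refine (mul_le_mul_of_nonneg_left h1 hqs.le).trans (le_of_eq ?_)
    have : (q.1 - s) ^ (1 / 2 : ℝ) = (q.1 - s) * (q.1 - s) ^ (-(1 / 2) : ℝ) := by
      rw [← Real.rpow_one_add' hqs.le (by norm_num)]; norm_num
    rw [this]
    ring

theorem integrable_weight_mul_sq (hh : IsLeviSource γ l A s y h) :
    Integrable fun q => (spaceTimeWeight γ l s q * h q) ^ 2 := by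
  have hm := hh.measurable
  have hw := measurable_spaceTimeWeight γ l s
  refine ((integrable_rpow_mul_exp_mul_gauss (β := γ) (c := 1 / 2)
    (by linarith [hh.mem.1]) (by linarith [hh.mem.2]) (by linarith [hh.mem.2]) s y).const_mul
    (A ^ 2)).mono' ((hw.mul hm).pow_const 2).aestronglyMeasurable ?_
  have : ∀ᵐ z : ℝ, z ≠ 0 := Measure.ae_ne volume 0
  filter_upwards [Measure.quasiMeasurePreserving_snd.ae this] with q hq
  rcases le_or_gt q.1 s with hs | hs
  · rw [hh.eq_zero hs, mul_zero, gauss_of_nonpos (by linarith)]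
    simp
  · have hqs : 0 < q.1 - s := sub_pos.2 hs
    have h1 := hh.abs_exp_mul_le (-(γ / 2)) hq
    rw [neg_neg, show γ + -(γ / 2) = γ / 2 by ring] at h1
    have e : spaceTimeWeight γ l s q * h q = (q.1 - s) *
        (Real.exp (-((l + 1) * (q.1 - s))) * |q.2| ^ (γ / 2) * h q) := by
      rw [spaceTimeWeight, timeWeight]; ring
    have hg := gauss_nonneg (2 * (q.1 - s)) (q.2 - y)
    have hA := hh.A_nonneg
    have hqq := abs_pos.2 hq
    have h2 : gauss (2 * (q.1 - s)) (q.2 - y) ≤ (q.1 - s) ^ (-(1 / 2) : ℝ) :=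
      (gauss_le_rpow (by linarith) _).trans
        (Real.rpow_le_rpow_of_nonpos hqs (by linarith) (by norm_num))
    have h3 : Real.exp (-(q.1 - s)) ≤ 1 := Real.exp_le_one_iff.2 (by linarith)
    rw [e, Real.norm_eq_abs, abs_of_nonneg (sq_nonneg _), mul_pow, ← sq_abs (_ * h q)]
    have e1 : (q.1 - s) ^ (1 / 2 : ℝ) = (q.1 - s) ^ 2 * (q.1 - s) ^ (-(1 / 2) : ℝ) *
        (q.1 - s) ^ (-(1 / 2) : ℝ) * (q.1 - s) ^ (-(1 / 2) : ℝ) := by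
      rw [← Real.rpow_natCast, ← Real.rpow_add hqs, ← Real.rpow_add hqs, ← Real.rpow_add hqs]
      norm_num
    have e2 : |q.2| ^ (-γ) = |q.2| ^ (-(γ / 2)) * |q.2| ^ (-(γ / 2)) := by
      rw [← Real.rpow_add hqq]; congr 1; ring
    set g := gauss (2 * (q.1 - s)) (q.2 - y)
    set E := Real.exp (-(q.1 - s)) with hE
    have hE0 : 0 < E := Real.exp_pos _
    set u := (q.1 - s) ^ (-(1 / 2) : ℝ)
    have hu0 : 0 < u := by positivity
    set z := |q.2| ^ (-(γ / 2))
    have hz0 : 0 < z := by positivity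
    calc _ ≤ (q.1 - s) ^ 2 * (A * (u * E * (z * g))) ^ 2 := by gcongr
      _ = A ^ 2 * ((q.1 - s) ^ 2 * u * u * g * E * E * (z * z * g)) := by ring
      _ ≤ A ^ 2 * ((q.1 - s) ^ 2 * u * u * u * 1 * E * (z * z * g)) := by gcongr
      _ = _ := by rw [e1, e2]; ring

theorem exists_abs_commKernel_le (hh : IsLeviSource γ l A s y h) {η : ℝ} (hη : 0 < η) (T : ℝ) :
    ∃ C, 0 ≤ C ∧ ∀ p q : ℝ × ℝ, s + η ≤ p.1 → p.1 ≤ T → p.2 ≠ 0 → q.2 ≠ 0 →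
      |commKernel γ l s h p q| ≤
        C * (((p.1 - q.1) ^ (0 : ℝ) * (|p.2| ^ (-(γ / 2)) *
            gauss (2 * (p.1 - q.1)) (p.2 - q.2))) * (|q.2| ^ (γ / 2) * |h q|) +
          ((p.1 - q.1) ^ ((γ / 2 + (1 - γ) / 2) / 2 - 1) * (|p.2| ^ (-(γ / 2)) *
            gauss (2 * (p.1 - q.1)) (p.2 - q.2))) * (|q.2| ^ (-((1 - γ) / 2)) * |h q|)) := by
  obtain ⟨C0, hC0, hb0⟩ := exists_abs_gauss2_le
  obtain ⟨C1, hC1, hb1⟩ := exists_abs_rpow_mul_abs_gauss2_le (p := γ / 2 + (1 - γ) / 2)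
    (by linarith)
  have hl := hh.l_nonneg
  set m := η * Real.exp (-((l + 1) * (T - s))) with hm
  have hm0 : 0 < m := by positivity
  refine ⟨C0 / m + C1, by positivity, fun p q hp1 hp2 hp hq => ?_⟩
  have hγ1 := hh.mem.1
  have hγ2 := hh.mem.2
  rcases le_or_gt q.1 s with hqs | hqs
  · rw [commKernel, hh.eq_zero hqs]
    simp
  rcases le_or_gt p.1 q.1 with hpq | hpq
  · rw [commKernel, gauss2_of_nonpos (by linarith), zero_mul, abs_zero,
      gauss_of_nonpos (by linarith)]
    simp
  have hv : 0 < p.1 - q.1 := sub_pos.2 hpq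
  have hpp := abs_pos.2 hp
  have hqq := abs_pos.2 hq
  have hps : 0 < p.1 - s := by linarith
  have hwp : m ≤ timeWeight l (p.1 - s) := le_timeWeight hl hη (by linarith) (by linarith)
  have hwp0 := hm0.trans_le hwp
  set a := timeWeight l (p.1 - s) with ha
  set b := timeWeight l (q.1 - s) with hb
  set X := |p.2| ^ (γ / 2) with hX
  set Z := |q.2| ^ (γ / 2) with hZ
  have hX0 : 0 < X := by positivity
  have hZ0 : 0 < Z := by positivity
  have hab : |a - b| ≤ p.1 - q.1 := by
    have := abs_timeWeight_sub_le hl hps.le (show 0 ≤ q.1 - s by linarith)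
    rwa [sub_sub_sub_cancel_right, abs_of_pos hv] at this
  have hXZ : |X - Z| ≤ |p.2 - q.2| ^ (γ / 2 + (1 - γ) / 2) * |q.2| ^ (-((1 - γ) / 2)) := by
    refine (abs_rpow_sub_rpow_le (δ := (1 - γ) / 2) (by linarith) (by linarith) (by linarith) hpp.le hqq).trans ?_
    exact mul_le_mul_of_nonneg_right (Real.rpow_le_rpow (abs_nonneg _)
      (abs_abs_sub_abs_le p.2 q.2) (by linarith)) (by positivity)
  have hXinv : |p.2| ^ (-(γ / 2)) = X⁻¹ := Real.rpow_neg hpp.le _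
  have e : 1 - spaceTimeWeight γ l s q / spaceTimeWeight γ l s p =
      (a - b) * a⁻¹ * X⁻¹ * Z + X⁻¹ * (X - Z) := by
    rw [spaceTimeWeight, spaceTimeWeight, ← ha, ← hb, ← hX, ← hZ]
    field_simp
    ring
  have hest : |1 - spaceTimeWeight γ l s q / spaceTimeWeight γ l s p| ≤
      (p.1 - q.1) * m⁻¹ * X⁻¹ * Z + X⁻¹ * (|p.2 - q.2| ^ (γ / 2 + (1 - γ) / 2) *
        |q.2| ^ (-((1 - γ) / 2))) := by
    rw [e]
    refine (abs_add_le _ _).trans (add_le_add ?_ ?_)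
    · rw [abs_mul, abs_mul, abs_mul, abs_of_pos (inv_pos.2 hwp0), abs_of_pos (inv_pos.2 hX0),
        abs_of_pos hZ0]
      gcongr
    · rw [abs_mul, abs_of_pos (inv_pos.2 hX0)]
      gcongr
  have hG := gauss_nonneg (2 * (p.1 - q.1)) (p.2 - q.2)
  have hb0' := hb0 (p.1 - q.1) (p.2 - q.2) hv
  have hb1' := hb1 (p.1 - q.1) (p.2 - q.2) hv
  set g2 := gauss2 (p.1 - q.1) (p.2 - q.2)
  set G := gauss (2 * (p.1 - q.1)) (p.2 - q.2)
  set D := |p.2 - q.2| ^ (γ / 2 + (1 - γ) / 2)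
  set Y := |q.2| ^ (-((1 - γ) / 2))
  have hY0 : 0 < Y := by positivity
  set W := (p.1 - q.1) ^ ((γ / 2 + (1 - γ) / 2) / 2 - 1)
  have hW0 : 0 < W := by positivity
  rw [commKernel, abs_mul, abs_mul, Real.rpow_zero, one_mul, hXinv]
  have s1 : |g2| * (p.1 - q.1) ≤ C0 * G := by
    calc |g2| * (p.1 - q.1) ≤ (C0 * (p.1 - q.1)⁻¹ * G) * (p.1 - q.1) := by gcongr
      _ = _ := by field_simp
  calc |g2| * (|1 - spaceTimeWeight γ l s q / spaceTimeWeight γ l s p| * |h q|)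
      ≤ |g2| * (((p.1 - q.1) * m⁻¹ * X⁻¹ * Z + X⁻¹ * (D * Y)) * |h q|) := by gcongr
    _ = (|g2| * (p.1 - q.1)) * (m⁻¹ * X⁻¹ * Z * |h q|) + (D * |g2|) * (X⁻¹ * Y * |h q|) := by ring
    _ ≤ (C0 * G) * (m⁻¹ * X⁻¹ * Z * |h q|) + (C1 * W * G) * (X⁻¹ * Y * |h q|) := by gcongr
    _ = C0 / m * (X⁻¹ * G * (Z * |h q|)) + C1 * (W * (X⁻¹ * G) * (Y * |h q|)) := by
      rw [div_eq_mul_inv]; ring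
    _ ≤ (C0 / m + C1) * (X⁻¹ * G * (Z * |h q|)) + (C0 / m + C1) * (W * (X⁻¹ * G) * (Y * |h q|)) := by
      gcongr
      · linarith
      · have : 0 < C0 / m := by positivity
        linarith
    _ = _ := by ring

theorem measurable_commKernel (hh : IsLeviSource γ l A s y h) :
    Measurable fun w : (ℝ × ℝ) × (ℝ × ℝ) => commKernel γ l s h w.1 w.2 := by
  have hm := hh.measurable
  have hw := measurable_spaceTimeWeight γ l s
  unfold commKernel
  exact (Measurable.gauss2 (by fun_prop) (by fun_prop)).mul (by fun_prop)

theorem ae_snd_ne_zero : ∀ᵐ w : (ℝ × ℝ) × (ℝ × ℝ), w.1.2 ≠ 0 ∧ w.2.2 ≠ 0 := by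
  have h0 : ∀ᵐ z : ℝ, z ≠ 0 := Measure.ae_ne volume 0
  have h1 : ∀ᵐ p : ℝ × ℝ, p.2 ≠ 0 := Measure.quasiMeasurePreserving_snd.ae h0
  filter_upwards [Measure.quasiMeasurePreserving_fst.ae h1,
    Measure.quasiMeasurePreserving_snd.ae h1] with w h2 h3
  exact ⟨h2, h3⟩

theorem integrable_commKernel (hh : IsLeviSource γ l A s y h) {η : ℝ} (hη : 0 < η) (T : ℝ) :
    Integrable fun w : (ℝ × ℝ) × (ℝ × ℝ) =>
      (Ioo (s + η) T).indicator 1 w.1.1 * commKernel γ l s h w.1 w.2 := by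
  obtain ⟨C, hC, hbound⟩ := hh.exists_abs_commKernel_le hη T
  have hm := hh.measurable
  have hγ1 := hh.mem.1
  have hγ2 := hh.mem.2
  have hind : Measurable ((Iio T).indicator (1 : ℝ → ℝ)) :=
    measurable_one.indicator measurableSet_Iio
  have i1 := integrable_gauss_mul_prod (κ := γ / 2) (c := 0) (s := s) (by linarith) (by linarith)
    (by linarith) (g := fun q => |(Iio T).indicator 1 q.1 * (|q.2| ^ (-(-(γ / 2))) * h q)|)
    (((hind.comp measurable_fst).mul (by fun_prop)).abs)
    (hh.integrable_Iio_mul (β := -(γ / 2)) (by linarith) (by linarith) T).abs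
    (fun q hq => by rw [hh.eq_zero hq]; simp) T
  have i2 := integrable_gauss_mul_prod (κ := γ / 2) (c := (γ / 2 + (1 - γ) / 2) / 2 - 1) (s := s)
    (by linarith) (by linarith) (by linarith)
    (g := fun q => |(Iio T).indicator 1 q.1 * (|q.2| ^ (-((1 - γ) / 2)) * h q)|)
    (((hind.comp measurable_fst).mul (by fun_prop)).abs)
    (hh.integrable_Iio_mul (β := (1 - γ) / 2) (by linarith) (by linarith) T).abs
    (fun q hq => by rw [hh.eq_zero hq]; simp) T
  refine ((i1.add i2).const_mul C).mono'
    (((measurable_one.indicator measurableSet_Ioo).comp (by fun_prop)).mul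
      hh.measurable_commKernel).aestronglyMeasurable ?_
  filter_upwards [ae_snd_ne_zero] with w hw
  have hnn : ∀ (c g : ℝ), 0 ≤ g → 0 ≤ (Iio T).indicator 1 w.1.1 * ((w.1.1 - w.2.1) ^ c *
      (|w.1.2| ^ (-(γ / 2)) * gauss (2 * (w.1.1 - w.2.1)) (w.1.2 - w.2.2))) * g := by
    intro c g hg
    have h1 : 0 ≤ (Iio T).indicator (1 : ℝ → ℝ) w.1.1 := indicator_nonneg (fun _ _ => zero_le_one) _
    rcases le_or_gt w.1.1 w.2.1 with h | h
    · rw [gauss_of_nonpos (by linarith)]; simp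
    · have := gauss_nonneg (2 * (w.1.1 - w.2.1)) (w.1.2 - w.2.2)
      have : 0 < w.1.1 - w.2.1 := sub_pos.2 h
      positivity
  by_cases hwt : w.1.1 ∈ Ioo (s + η) T
  · rcases le_or_gt w.1.1 w.2.1 with hpq | hpq
    · rw [commKernel, gauss2_of_nonpos (by linarith)]
      simp only [zero_mul, mul_zero, norm_zero, Pi.add_apply]
      exact mul_nonneg hC (add_nonneg (hnn _ _ (abs_nonneg _)) (hnn _ _ (abs_nonneg _)))
    · have hq : w.2.1 ∈ Iio T := hpq.trans hwt.2
      rw [indicator_of_mem hwt, Pi.one_apply, one_mul, Real.norm_eq_abs]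
      refine (hbound w.1 w.2 hwt.1.le hwt.2.le hw.1 hw.2).trans (le_of_eq ?_)
      simp only [Pi.add_apply]
      rw [indicator_of_mem (show w.1.1 ∈ Iio T from hwt.2), indicator_of_mem hq]
      simp only [Pi.one_apply, one_mul, neg_neg, abs_mul, abs_of_nonneg (Real.rpow_nonneg
        (abs_nonneg w.2.2) _)]
  · rw [indicator_of_notMem hwt, zero_mul, norm_zero]
    exact mul_nonneg hC (add_nonneg (hnn _ _ (abs_nonneg _)) (hnn _ _ (abs_nonneg _)))

end IsLeviSource

/-- Smooth functions with compact support in `(s, ∞) × ℝ`. -/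
structure IsTestFunction (s : ℝ) (φ : ℝ × ℝ → ℝ) : Prop where
  contDiff : ContDiff ℝ ∞ φ
  hasCompactSupport : HasCompactSupport φ
  tsupport_subset : tsupport φ ⊆ Ioi s ×ˢ univ

/-- The coordinate box `(s + η, T) × (-R, R)`. -/
def timeBox (s η T R : ℝ) : Set (ℝ × ℝ) := Ioo (s + η) T ×ˢ Ioo (-R) R

theorem measurableSet_timeBox (s η T R : ℝ) : MeasurableSet (timeBox s η T R) :=
  measurableSet_Ioo.prod measurableSet_Ioo

namespace IsTestFunction

variable {s : ℝ} {φ : ℝ × ℝ → ℝ}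

theorem exists_box (hφ : IsTestFunction s φ) : ∃ η T R M : ℝ, 0 < η ∧ 0 < R ∧ 0 ≤ M ∧
    (∀ q, q ∉ timeBox s η T R → φ q = 0 ∧ fderiv ℝ φ q = 0) ∧
    ∀ q, |φ q| ≤ M ∧ ‖fderiv ℝ φ q‖ ≤ M := by
  have hK : IsCompact (tsupport φ) := hφ.hasCompactSupport
  obtain ⟨δ, hδ, hthick⟩ := hK.exists_thickening_subset_open
    (isOpen_Ioi.prod isOpen_univ) hφ.tsupport_subset
  obtain ⟨R, hR⟩ := hK.isBounded.subset_closedBall 0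
  obtain ⟨M1, hM1⟩ := hφ.contDiff.continuous.bounded_above_of_compact_support
    hφ.hasCompactSupport
  obtain ⟨M2, hM2⟩ := (hφ.contDiff.continuous_fderiv (by simp)).bounded_above_of_compact_support
    (hφ.hasCompactSupport.fderiv ℝ)
  refine ⟨δ / 2, |R| + 1, |R| + 1, max M1 M2, by linarith, by positivity,
    (norm_nonneg _).trans ((hM1 0).trans (le_max_left _ _)), fun q hq => ?_,
    fun q => ⟨(hM1 q).trans (le_max_left _ _), (hM2 q).trans (le_max_right _ _)⟩⟩
  have hq' : q ∉ tsupport φ := by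
    intro hmem
    apply hq
    have h1 : (q.1 - δ / 2, q.2) ∈ Metric.thickening δ (tsupport φ) := by
      rw [Metric.mem_thickening_iff]
      refine ⟨q, hmem, ?_⟩
      rw [Prod.dist_eq, Real.dist_eq]
      simp only [sub_sub_cancel_left, abs_neg, dist_self]
      rw [abs_of_pos (by linarith), max_eq_left (by linarith)]
      linarith
    have h2 : s < q.1 - δ / 2 := (hthick h1).1
    have h3 := hR hmem
    rw [mem_closedBall_zero_iff, Prod.norm_def] at h3
    have h4 : |q.1| ≤ R := (le_max_left _ _).trans h3
    have h5 : |q.2| ≤ R := (le_max_right _ _).trans h3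
    have h6 := le_abs_self R
    rw [abs_le] at h4 h5
    exact ⟨⟨by linarith, by linarith⟩, ⟨by linarith, by linarith⟩⟩
  refine ⟨image_eq_zero_of_notMem_tsupport hq', ?_⟩
  by_contra hne
  exact hq' (support_fderiv_subset ℝ hne)

theorem add (hφ : IsTestFunction s φ) {ψ : ℝ × ℝ → ℝ} (hψ : IsTestFunction s ψ) :
    IsTestFunction s (φ + ψ) :=
  ⟨hφ.contDiff.add hψ.contDiff, hφ.hasCompactSupport.add hψ.hasCompactSupport,
    (tsupport_add φ ψ).trans (union_subset hφ.tsupport_subset hψ.tsupport_subset)⟩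

theorem smul (hφ : IsTestFunction s φ) (c : ℝ) : IsTestFunction s (c • φ) :=
  ⟨hφ.contDiff.const_smul c, hφ.hasCompactSupport.smul_left (f := fun _ => c),
    (tsupport_smul_subset_right (fun _ => c) φ).trans hφ.tsupport_subset⟩

theorem hasDerivAt_snd (hφ : IsTestFunction s φ) (t x : ℝ) :
    HasDerivAt (fun x => φ (t, x)) (fderiv ℝ φ (t, x) (0, 1)) x := by
  have h1 : HasFDerivAt φ (fderiv ℝ φ (t, x)) (t, x) :=
    (hφ.contDiff.differentiable (by simp) _).hasFDerivAt
  have h2 : HasDerivAt (fun x : ℝ => (t, x)) ((0 : ℝ), (1 : ℝ)) x :=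
    (hasDerivAt_const x t).prodMk (hasDerivAt_id x)
  exact h1.comp_hasDerivAt x h2

theorem hasDerivAt_fst (hφ : IsTestFunction s φ) (t x : ℝ) :
    HasDerivAt (fun t => φ (t, x)) (fderiv ℝ φ (t, x) (1, 0)) t := by
  have h1 : HasFDerivAt φ (fderiv ℝ φ (t, x)) (t, x) :=
    (hφ.contDiff.differentiable (by simp) _).hasFDerivAt
  have h2 : HasDerivAt (fun t : ℝ => (t, x)) ((1 : ℝ), (0 : ℝ)) t :=
    (hasDerivAt_id t).prodMk (hasDerivAt_const t x)
  exact h1.comp_hasDerivAt t h2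

theorem continuous_fderiv_apply (hφ : IsTestFunction s φ) (e : ℝ × ℝ) :
    Continuous fun q => fderiv ℝ φ q e :=
  (hφ.contDiff.continuous_fderiv (by simp)).clm_apply continuous_const

theorem hasCompactSupport_fderiv_apply (hφ : IsTestFunction s φ) (e : ℝ × ℝ) :
    HasCompactSupport fun q => fderiv ℝ φ q e :=
  hφ.hasCompactSupport.fderiv_apply ℝ e

/-- Slices of compactly supported continuous functions are integrable. -/
theorem _root_.integrable_slice {φ : ℝ × ℝ → ℝ} (hc : Continuous φ) (hs : HasCompactSupport φ)
    (t : ℝ) : Integrable fun x => φ (t, x) := by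
  refine Continuous.integrable_of_hasCompactSupport (by fun_prop) ?_
  refine HasCompactSupport.of_support_subset_isCompact (hs.image continuous_snd) fun x hx => ?_
  exact ⟨(t, x), subset_tsupport φ hx, rfl⟩

theorem integral_gauss1_mul_fderiv (hφ : IsTestFunction s φ) (v t z : ℝ) :
    ∫ x, gauss1 v (x - z) * fderiv ℝ φ (t, x) (0, 1) = -∫ x, gauss2 v (x - z) * φ (t, x) := by
  rcases le_or_gt v 0 with hv | hv
  · simp [gauss1_of_nonpos hv, gauss2_of_nonpos hv]
  obtain ⟨C, -, hC⟩ := exists_gauss_bound hv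
  have i1 := integrable_slice hφ.contDiff.continuous hφ.hasCompactSupport t
  have i2 := integrable_slice (hφ.continuous_fderiv_apply (0, 1))
    (hφ.hasCompactSupport_fderiv_apply (0, 1)) t
  have m1 : AEStronglyMeasurable (fun x => gauss1 v (x - z)) :=
    (Measurable.gauss1 (by fun_prop) (by fun_prop)).aestronglyMeasurable
  have m2 : AEStronglyMeasurable (fun x => gauss2 v (x - z)) :=
    (Measurable.gauss2 (by fun_prop) (by fun_prop)).aestronglyMeasurable
  refine integral_mul_deriv_eq_deriv_mul_of_integrable (fun x _ => hasDerivAt_gauss1_sub v x z)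
    (fun x _ => hφ.hasDerivAt_snd t x) ?_ ?_ ?_
  · exact i2.bdd_mul (c := C) m1 (Eventually.of_forall fun x => (hC v _ le_rfl).2.1)
  · exact i1.bdd_mul (c := C) m2 (Eventually.of_forall fun x => (hC v _ le_rfl).2.2)
  · exact i1.bdd_mul (c := C) m1 (Eventually.of_forall fun x => (hC v _ le_rfl).2.1)

end IsTestFunction

theorem integrable_indicator_box {β : ℝ} (h1 : β < 1) (s η T : ℝ) {R : ℝ}
    (hR : 0 < R) :
    Integrable ((timeBox s η T R).indicator fun q : ℝ × ℝ => |q.2| ^ (-β)) := by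
  have i1 : Integrable ((Ioo (s + η) T).indicator (1 : ℝ → ℝ)) :=
    (integrable_indicator_iff measurableSet_Ioo).2 (integrable_const (1 : ℝ))
  have i2 : Integrable ((Ioo (-R) R).indicator fun z : ℝ => |z| ^ (-β)) := by
    refine (integrable_indicator_iff measurableSet_Ioo).2 ⟨Measurable.aestronglyMeasurable
      (by fun_prop), ?_⟩
    have := lintegral_Ioo_abs_rpow hR (b := 1 - β) (by linarith)
    rw [hasFiniteIntegral_iff_enorm]
    refine lt_of_le_of_lt (le_trans (le_of_eq ?_) this) ENNReal.ofReal_lt_top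
    refine lintegral_congr fun z => ?_
    rw [Real.enorm_eq_ofReal (by positivity), show 1 - β - 1 = -β by ring]
  refine (i1.mul_prod i2).congr (Eventually.of_forall fun q => ?_)
  by_cases hq1 : q.1 ∈ Ioo (s + η) T <;> by_cases hq2 : q.2 ∈ Ioo (-R) R <;>
    simp [timeBox, indicator, hq1, hq2, mem_prod]

/-- The reciprocal of the weight is square integrable on boxes. -/
theorem integrable_indicator_inv_weight {γ l : ℝ} (hγ : γ ∈ Ioo (0 : ℝ) 1) (hl : 0 ≤ l) (s : ℝ)
    {η : ℝ} (hη : 0 < η) (T : ℝ) {R : ℝ} (hR : 0 < R) :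
    Integrable ((timeBox s η T R).indicator fun q => (spaceTimeWeight γ l s q)⁻¹) ∧
    Integrable fun q => ((timeBox s η T R).indicator (fun q => (spaceTimeWeight γ l s q)⁻¹) q) ^ 2 := by
  have hw := measurable_spaceTimeWeight γ l s
  set m := η * Real.exp (-((l + 1) * (T - s))) with hm
  have hm0 : 0 < m := by positivity
  have hle : ∀ q ∈ timeBox s η T R, (spaceTimeWeight γ l s q)⁻¹ ≤ m⁻¹ * |q.2| ^ (-(γ / 2)) ∧
      0 ≤ (spaceTimeWeight γ l s q)⁻¹ := by
    intro q hq
    have h1 : s + η < q.1 := hq.1.1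
    have h2 : q.1 < T := hq.1.2
    have h3 : m ≤ timeWeight l (q.1 - s) := le_timeWeight hl hη (by linarith) (by linarith)
    rw [spaceTimeWeight, mul_inv, Real.rpow_neg (abs_nonneg _)]
    have h4 := hm0.trans_le h3
    constructor
    · gcongr
    · positivity
  have hmeas : Measurable ((timeBox s η T R).indicator fun q => (spaceTimeWeight γ l s q)⁻¹) :=
    hw.inv.indicator (measurableSet_timeBox s η T R)
  constructor
  · refine ((integrable_indicator_box (β := γ / 2) (by linarith [hγ.2]) s η T hR).const_mul
      m⁻¹).mono' hmeas.aestronglyMeasurable (Eventually.of_forall fun q => ?_)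
    by_cases hq : q ∈ timeBox s η T R
    · rw [indicator_of_mem hq, indicator_of_mem hq, Real.norm_eq_abs, abs_of_nonneg (hle q hq).2]
      exact (hle q hq).1
    · simp [indicator_of_notMem hq]
  · refine ((integrable_indicator_box (β := γ) hγ.2 s η T hR).const_mul
      (m⁻¹ ^ 2)).mono' (hmeas.pow_const 2).aestronglyMeasurable (Eventually.of_forall fun q => ?_)
    by_cases hq : q ∈ timeBox s η T R
    · rw [indicator_of_mem hq, indicator_of_mem hq, Real.norm_eq_abs, abs_of_nonneg (sq_nonneg _)]
      have h1 := pow_le_pow_left₀ (hle q hq).2 (hle q hq).1 2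
      refine h1.trans (le_of_eq ?_)
      rw [mul_pow, ← Real.rpow_natCast (|q.2| ^ (-(γ / 2))), ← Real.rpow_mul (abs_nonneg _)]
      congr 2
      push_cast
      ring
    · simp [indicator_of_notMem hq]

theorem IsTestFunction.integrable_div_weight {γ l s : ℝ} {φ : ℝ × ℝ → ℝ} (hφ : IsTestFunction s φ)
    (hγ : γ ∈ Ioo (0 : ℝ) 1) (hl : 0 ≤ l) :
    Measurable (fun q => φ q / spaceTimeWeight γ l s q) ∧
    Integrable (fun q => φ q / spaceTimeWeight γ l s q) ∧
    Integrable (fun q => (φ q / spaceTimeWeight γ l s q) ^ 2) := by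
  obtain ⟨η, T, R, M, hη, hR, hM, hbox, hb⟩ := hφ.exists_box
  obtain ⟨i1, i2⟩ := integrable_indicator_inv_weight hγ hl s hη T hR
  have hw := measurable_spaceTimeWeight γ l s
  have hm : Measurable (fun q => φ q / spaceTimeWeight γ l s q) :=
    hφ.contDiff.continuous.measurable.div hw
  have e : ∀ q, φ q / spaceTimeWeight γ l s q = φ q *
      (timeBox s η T R).indicator (fun q => (spaceTimeWeight γ l s q)⁻¹) q := by
    intro q
    by_cases hq : q ∈ timeBox s η T R
    · rw [indicator_of_mem hq, div_eq_mul_inv]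
    · rw [(hbox q hq).1]; simp
  refine ⟨hm, ?_, ?_⟩
  · simp_rw [e]
    exact i1.bdd_mul (c := M) hφ.contDiff.continuous.aestronglyMeasurable
      (Eventually.of_forall fun q => (hb q).1)
  · simp_rw [e, mul_pow]
    refine i2.bdd_mul (c := M ^ 2) (hφ.contDiff.continuous.pow 2).aestronglyMeasurable
      (Eventually.of_forall fun q => ?_)
    rw [norm_pow]
    exact pow_le_pow_left₀ (norm_nonneg _) (hb q).1 2

theorem integral_gauss1_truncated_mul_fderiv {s ε T : ℝ} {φ f : ℝ × ℝ → ℝ}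
    (hφ : IsTestFunction s φ) (hε : 0 < ε) (hf : Integrable f) :
    ∫ w : (ℝ × ℝ) × (ℝ × ℝ), (Ioo ε T).indicator 1 (w.1.1 - w.2.1) *
      gauss1 (w.1.1 - w.2.1) (w.1.2 - w.2.2) * (fderiv ℝ φ w.1 (0, 1) * f w.2) =
    -∫ w : (ℝ × ℝ) × (ℝ × ℝ), (Ioo ε T).indicator 1 (w.1.1 - w.2.1) *
      gauss2 (w.1.1 - w.2.1) (w.1.2 - w.2.2) * (φ w.1 * f w.2) := by
  have hφi := hφ.contDiff.continuous.integrable_of_hasCompactSupport hφ.hasCompactSupport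
    (μ := volume)
  have hdi := (hφ.continuous_fderiv_apply (0, 1)).integrable_of_hasCompactSupport
    (hφ.hasCompactSupport_fderiv_apply (0, 1)) (μ := volume)
  have i2 := integrable_gauss2_truncated (T := T) hε hf hφi
  have i1 : Integrable fun w : (ℝ × ℝ) × (ℝ × ℝ) => (Ioo ε T).indicator 1 (w.1.1 - w.2.1) *
      gauss1 (w.1.1 - w.2.1) (w.1.2 - w.2.2) * (fderiv ℝ φ w.1 (0, 1) * f w.2) := by
    obtain ⟨C, hC0, hC⟩ := exists_gauss_bound hε
    refine Integrable.bdd_mul (c := C) (hdi.mul_prod hf) ?_ (Eventually.of_forall fun w => ?_)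
    · exact (((measurable_one.indicator measurableSet_Ioo).comp (by fun_prop)).mul
        (Measurable.gauss1 (by fun_prop) (by fun_prop))).aestronglyMeasurable
    · by_cases h : w.1.1 - w.2.1 ∈ Ioo ε T
      · rw [indicator_of_mem h, Pi.one_apply, one_mul]
        exact (hC _ _ h.1.le).2.1
      · rw [indicator_of_notMem h, zero_mul, norm_zero]
        exact hC0.le
  rw [Measure.volume_eq_prod, integral_prod_symm _ i1, integral_prod_symm _ i2, ← integral_neg]
  refine integral_congr_ae ?_
  filter_upwards [i1.prod_left_ae, i2.prod_left_ae] with q j1 j2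
  rw [Measure.volume_eq_prod] at j1 j2 ⊢
  rw [integral_prod _ j1, integral_prod _ j2, ← integral_neg]
  refine integral_congr_ae (Eventually.of_forall fun t => ?_)
  have e1 : ∀ x, (Ioo ε T).indicator 1 (t - q.1) * gauss1 (t - q.1) (x - q.2) *
      (fderiv ℝ φ (t, x) (0, 1) * f q) = (Ioo ε T).indicator 1 (t - q.1) * f q *
      (gauss1 (t - q.1) (x - q.2) * fderiv ℝ φ (t, x) (0, 1)) := fun x => by ring
  have e2 : ∀ x, (Ioo ε T).indicator 1 (t - q.1) * gauss2 (t - q.1) (x - q.2) *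
      (φ (t, x) * f q) = (Ioo ε T).indicator 1 (t - q.1) * f q *
      (gauss2 (t - q.1) (x - q.2) * φ (t, x)) := fun x => by ring
  simp only [e1, e2]
  rw [integral_const_mul, integral_const_mul, hφ.integral_gauss1_mul_fderiv, mul_neg]

theorem norm_indicator_one_le {α : Type*} (S : Set α) (a : α) :
    ‖S.indicator (1 : α → ℝ) a‖ ≤ 1 :=
  (norm_indicator_le_norm_self _ _).trans (by simp)

/-- Cutting off the times `t - r ∉ (1 / (n + 2), n + 2)` does not change the integral in the limit. -/
theorem tendsto_integral_truncated {F : (ℝ × ℝ) × (ℝ × ℝ) → ℝ} (hF : Integrable F)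
    (h0 : ∀ w, w.1.1 ≤ w.2.1 → F w = 0) :
    Tendsto (fun n : ℕ => ∫ w, (Ioo (1 / ((n : ℝ) + 2)) (n + 2)).indicator 1 (w.1.1 - w.2.1) * F w)
      atTop (𝓝 (∫ w, F w)) := by
  refine tendsto_integral_of_dominated_convergence (fun w => ‖F w‖) (fun n => ?_) hF.norm
    (fun n => Eventually.of_forall fun w => ?_) (Eventually.of_forall fun w => ?_)
  · exact ((measurable_one.indicator measurableSet_Ioo).comp
      (by fun_prop)).aestronglyMeasurable.mul hF.aestronglyMeasurable
  · rw [norm_mul]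
    exact mul_le_of_le_one_left (norm_nonneg _) (norm_indicator_one_le _ _)
  · rcases le_or_gt w.1.1 w.2.1 with h | h
    · simp [h0 w h]
    · refine tendsto_const_nhds.congr' ?_
      have hv : 0 < w.1.1 - w.2.1 := sub_pos.2 h
      obtain ⟨n1, hn1⟩ := exists_nat_gt (w.1.1 - w.2.1)
      obtain ⟨n2, hn2⟩ := exists_nat_gt (1 / (w.1.1 - w.2.1))
      filter_upwards [eventually_ge_atTop n1, eventually_ge_atTop n2] with n h1 h2
      have h1' : (n1 : ℝ) ≤ n := by exact_mod_cast h1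
      have h2' : (n2 : ℝ) ≤ n := by exact_mod_cast h2
      have h3 : 1 / ((n : ℝ) + 2) < w.1.1 - w.2.1 := by
        rw [one_div_lt (by positivity) hv]
        linarith
      rw [indicator_of_mem (show w.1.1 - w.2.1 ∈ Ioo (1 / ((n : ℝ) + 2)) (n + 2) from
        ⟨h3, by linarith⟩), Pi.one_apply, one_mul]

/-- Bounded functions supported at early times. -/
structure IsEarlyBounded (T M : ℝ) (ψ : ℝ × ℝ → ℝ) : Prop where
  measurable : Measurable ψ
  eq_zero : ∀ p, T ≤ p.1 → ψ p = 0
  abs_le : ∀ p, |ψ p| ≤ M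

theorem IsTestFunction.exists_isEarlyBounded {s : ℝ} {φ : ℝ × ℝ → ℝ} (hφ : IsTestFunction s φ) :
    ∃ T M, IsEarlyBounded T M φ ∧ IsEarlyBounded T M (fun p => fderiv ℝ φ p (0, 1)) ∧
      IsEarlyBounded T M (fun p => fderiv ℝ φ p (1, 0)) := by
  obtain ⟨η, T, R, M, -, -, -, hbox, hb⟩ := hφ.exists_box
  have hout : ∀ p : ℝ × ℝ, T ≤ p.1 → p ∉ timeBox s η T R := fun p hp hm => absurd hm.1.2 hp.not_gt
  refine ⟨T, M, ⟨hφ.contDiff.continuous.measurable, fun p hp => (hbox p (hout p hp)).1,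
    fun p => (hb p).1⟩, ⟨(hφ.continuous_fderiv_apply _).measurable, fun p hp => ?_, fun p => ?_⟩,
    ⟨(hφ.continuous_fderiv_apply _).measurable, fun p hp => ?_, fun p => ?_⟩⟩
  · simp [(hbox p (hout p hp)).2]
  · refine ((fderiv ℝ φ p).le_opNorm (0, 1)).trans ?_
    simpa [Prod.norm_def] using (hb p).2
  · simp [(hbox p (hout p hp)).2]
  · refine ((fderiv ℝ φ p).le_opNorm (1, 0)).trans ?_
    simpa [Prod.norm_def] using (hb p).2

namespace IsLeviSource

variable {γ l A s y : ℝ} {h : ℝ × ℝ → ℝ}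

theorem integrable_kernel_mul_prod (hh : IsLeviSource γ l A s y h) {k : ℝ → ℝ → ℝ} {C p T M : ℝ}
    (hk : IsHeatLike k C p) {ψ : ℝ × ℝ → ℝ} (hψ : IsEarlyBounded T M ψ) :
    Integrable fun w : (ℝ × ℝ) × (ℝ × ℝ) =>
      k (w.1.1 - w.2.1) (w.1.2 - w.2.2) * (ψ w.1 * h w.2) := by
  have hind : Measurable ((Iio T).indicator (1 : ℝ → ℝ)) := measurable_one.indicator measurableSet_Iio
  have hC := hk.C_nonneg
  have hM : 0 ≤ M := (abs_nonneg _).trans (hψ.abs_le 0)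
  have i1 := integrable_gauss_mul_prod (κ := 0) (c := -p) (s := s) le_rfl one_pos
    (by linarith [hk.p_le]) (g := fun q => |(Iio T).indicator 1 q.1 * h q|)
    ((hind.comp measurable_fst).mul hh.measurable).abs (hh.integrable_Iio T).abs
    (fun q hq => by rw [hh.eq_zero hq]; simp) T
  have hψm := hψ.measurable
  have hhm := hh.measurable
  refine (i1.const_mul (C * M)).mono' (Measurable.aestronglyMeasurable
    ((hk.measurable.comp (by fun_prop : Measurable fun w : (ℝ × ℝ) × (ℝ × ℝ) =>
      (w.1.1 - w.2.1, w.1.2 - w.2.2))).mul (by fun_prop))) (Eventually.of_forall fun w => ?_)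
  have hG := gauss_nonneg (2 * (w.1.1 - w.2.1)) (w.1.2 - w.2.2)
  have hI : 0 ≤ (Iio T).indicator (1 : ℝ → ℝ) w.1.1 := indicator_nonneg (fun _ _ => zero_le_one) _
  rcases le_or_gt w.1.1 w.2.1 with hw | hw
  · rw [hk.of_nonpos _ _ (by linarith), gauss_of_nonpos (by linarith)]
    simp
  have hv : 0 < w.1.1 - w.2.1 := sub_pos.2 hw
  by_cases hT : w.1.1 ∈ Iio T
  · have hq : w.2.1 ∈ Iio T := hw.trans hT
    rw [indicator_of_mem hT, indicator_of_mem hq, norm_mul, norm_mul]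
    simp only [Pi.one_apply, one_mul, neg_zero, Real.rpow_zero, Real.norm_eq_abs]
    calc _ ≤ (C * ((w.1.1 - w.2.1) ^ (-p) * gauss (2 * (w.1.1 - w.2.1)) (w.1.2 - w.2.2))) *
        (M * |h w.2|) := mul_le_mul (hk.abs_le _ _ hv)
          (mul_le_mul_of_nonneg_right (hψ.abs_le _) (abs_nonneg _)) (by positivity) (by positivity)
      _ = _ := by ring
  · rw [hψ.eq_zero _ (not_lt.1 hT)]
    simp only [zero_mul, mul_zero, norm_zero]
    positivity

theorem integral_heatPot_mul (hh : IsLeviSource γ l A s y h) {k : ℝ → ℝ → ℝ} {C p T M : ℝ}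
    (hk : IsHeatLike k C p) {ψ : ℝ × ℝ → ℝ} (hψ : IsEarlyBounded T M ψ) :
    Integrable (fun a : ℝ × ℝ => heatPot k h a.1 a.2 * ψ a) ∧
    ∫ a : ℝ × ℝ, heatPot k h a.1 a.2 * ψ a = ∫ w : (ℝ × ℝ) × (ℝ × ℝ),
      k (w.1.1 - w.2.1) (w.1.2 - w.2.2) * (ψ w.1 * h w.2) := by
  have i := hh.integrable_kernel_mul_prod hk hψ
  have e : ∀ a : ℝ × ℝ, heatPot k h a.1 a.2 * ψ a =
      ∫ q : ℝ × ℝ, k (a.1 - q.1) (a.2 - q.2) * (ψ a * h q) := by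
    intro a
    rw [heatPot, ← integral_mul_const]
    refine integral_congr_ae (Eventually.of_forall fun q => ?_)
    simp only
    ring
  constructor
  · simp_rw [e]
    exact i.integral_prod_left
  · simp_rw [e]
    rw [Measure.volume_eq_prod (ℝ × ℝ) (ℝ × ℝ), integral_prod _ i]

/-- The commutator applied to the constant function. -/
noncomputable def _root_.commPot (γ l s : ℝ) (h : ℝ × ℝ → ℝ) (p : ℝ × ℝ) : ℝ :=
  ∫ q, commKernel γ l s h p q

theorem integrableOn_commPot (hh : IsLeviSource γ l A s y h) {η : ℝ} (hη : 0 < η) (T R : ℝ) :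
    IntegrableOn (commPot γ l s h) (timeBox s η T R) := by
  have i := (hh.integrable_commKernel hη T).integral_prod_left
  refine (i.integrableOn (s := timeBox s η T R)).congr_fun (fun p hp => ?_)
    (measurableSet_timeBox s η T R)
  have hp1 : p.1 ∈ Ioo (s + η) T := hp.1
  simp only [indicator_of_mem hp1, Pi.one_apply, one_mul]
  rfl

theorem integral_commPot_mul (hh : IsLeviSource γ l A s y h) {φ : ℝ × ℝ → ℝ}
    (hφ : IsTestFunction s φ) :
    Integrable (fun w : (ℝ × ℝ) × (ℝ × ℝ) => commKernel γ l s h w.1 w.2 * φ w.1) ∧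
    Integrable (fun p => commPot γ l s h p * φ p) ∧
    ∫ p, commPot γ l s h p * φ p = ∫ w : (ℝ × ℝ) × (ℝ × ℝ), commKernel γ l s h w.1 w.2 * φ w.1 := by
  obtain ⟨η, T, R, M, hη, hR, hM, hbox, hb⟩ := hφ.exists_box
  have i0 := (hh.integrable_commKernel hη T).bdd_mul (c := M)
    (f := fun w : (ℝ × ℝ) × (ℝ × ℝ) => φ w.1)
    (hφ.contDiff.continuous.comp continuous_fst).aestronglyMeasurable
    (Eventually.of_forall fun w => (hb w.1).1)
  have i : Integrable (fun w : (ℝ × ℝ) × (ℝ × ℝ) => commKernel γ l s h w.1 w.2 * φ w.1) := by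
    refine i0.congr (Eventually.of_forall fun w => ?_)
    by_cases hw : w.1 ∈ timeBox s η T R
    · have hw1 : w.1.1 ∈ Ioo (s + η) T := hw.1
      simp only [indicator_of_mem hw1, Pi.one_apply, one_mul]
      ring
    · simp [(hbox _ hw).1]
  have e : ∀ p, commPot γ l s h p * φ p = ∫ q, commKernel γ l s h p q * φ p := by
    intro p
    rw [commPot, ← integral_mul_const]
  refine ⟨i, ?_, ?_⟩
  · simp_rw [e]
    exact i.integral_prod_left
  · simp_rw [e]
    rw [Measure.volume_eq_prod (ℝ × ℝ) (ℝ × ℝ), integral_prod _ i]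

theorem abs_functional_le (hh : IsLeviSource γ l A s y h) {φ : ℝ × ℝ → ℝ}
    (hφ : IsTestFunction s φ) :
    |(-∫ p : ℝ × ℝ, heatPot gauss1 h p.1 p.2 * fderiv ℝ φ p (0, 1)) -
      ∫ p, commPot γ l s h p * φ p| ≤
    (∫ q, (spaceTimeWeight γ l s q * h q) ^ 2) + ∫ q, (φ q / spaceTimeWeight γ l s q) ^ 2 := by
  obtain ⟨C, hk⟩ := exists_isHeatLike_gauss1
  obtain ⟨T, M, hE, hE1, -⟩ := hφ.exists_isEarlyBounded
  obtain ⟨hgm, hg, hg2⟩ := hφ.integrable_div_weight hh.mem hh.l_nonneg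
  obtain ⟨j2, -, e2⟩ := hh.integral_commPot_mul hφ
  have j1 := hh.integrable_kernel_mul_prod hk hE1
  rw [(hh.integral_heatPot_mul hk hE1).2, e2]
  have t1 := tendsto_integral_truncated j1
    (fun w hw => by rw [gauss1_of_nonpos (by linarith), zero_mul])
  have t2 := tendsto_integral_truncated j2
    (fun w hw => by rw [commKernel, gauss2_of_nonpos (by linarith)]; simp)
  refine le_of_tendsto ((t1.neg.sub t2).abs) (Eventually.of_forall fun n => ?_)
  set ε : ℝ := 1 / ((n : ℝ) + 2)
  have hε : 0 < ε := by positivity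
  have hεn : ε < (n : ℝ) + 2 := by
    have hn : (0 : ℝ) ≤ n := n.cast_nonneg
    have : ε ≤ 1 := by
      rw [div_le_one (by positivity)]
      linarith
    linarith
  refine le_trans (le_of_eq ?_) (abs_integral_gauss2_truncated_le hε hεn
    ((measurable_spaceTimeWeight γ l s).mul hh.measurable) hh.integrable_weight_mul
    hh.integrable_weight_mul_sq hgm hg hg2)
  congr 1
  set S : (ℝ × ℝ) × (ℝ × ℝ) → ℝ := fun w =>
    (Ioo ε ((n : ℝ) + 2)).indicator 1 (w.1.1 - w.2.1) with hS
  have hφi := hφ.contDiff.continuous.integrable_of_hasCompactSupport hφ.hasCompactSupport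
    (μ := volume)
  have i3 := integrable_gauss2_truncated (T := (n : ℝ) + 2) hε (hh.integrable_Iio T) hφi
  have e1 : ∫ w, S w * (gauss1 (w.1.1 - w.2.1) (w.1.2 - w.2.2) *
      (fderiv ℝ φ w.1 (0, 1) * h w.2)) = -∫ w : (ℝ × ℝ) × (ℝ × ℝ), S w *
      gauss2 (w.1.1 - w.2.1) (w.1.2 - w.2.2) *
        (φ w.1 * ((Iio T).indicator 1 w.2.1 * h w.2)) := by
    rw [← integral_gauss1_truncated_mul_fderiv hφ hε (hh.integrable_Iio T)]
    refine integral_congr_ae (Eventually.of_forall fun w => ?_)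
    simp only
    by_cases hw : w.2.1 ∈ Iio T
    · rw [indicator_of_mem hw, Pi.one_apply, one_mul, mul_assoc]
    · rcases le_or_gt w.1.1 w.2.1 with h1 | h1
      · rw [gauss1_of_nonpos (by linarith)]; simp
      · have : T ≤ w.2.1 := not_lt.1 hw
        have h2 : fderiv ℝ φ w.1 (0, 1) = 0 := hE1.eq_zero w.1 (by linarith)
        rw [h2]; simp
  have j2S : Integrable fun w => S w * (commKernel γ l s h w.1 w.2 * φ w.1) := by
    refine j2.bdd_mul (c := 1) ((measurable_one.indicator measurableSet_Ioo).comp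
      (by fun_prop)).aestronglyMeasurable
      (Eventually.of_forall fun w => norm_indicator_one_le _ _)
  change (-∫ w, S w * (gauss1 (w.1.1 - w.2.1) (w.1.2 - w.2.2) *
      (fderiv ℝ φ w.1 (0, 1) * h w.2))) - ∫ w, S w * (commKernel γ l s h w.1 w.2 * φ w.1) = _
  rw [e1, neg_neg, ← integral_sub i3 j2S]
  refine integral_congr_ae ?_
  filter_upwards [ae_snd_ne_zero] with w hw
  rcases le_or_gt w.1.1 w.2.1 with h1 | h1
  · rw [commKernel, gauss2_of_nonpos (by linarith)]; simp
  rcases le_or_gt w.2.1 s with h2 | h2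
  · rw [commKernel, hh.eq_zero h2]; simp
  have hpos := (spaceTimeWeight_pos (γ := γ) (l := l) (h2.trans h1) hw.1).ne'
  change S w * _ * _ - S w * _ = S w * _ * _
  by_cases hwT : w.2.1 ∈ Iio T
  · rw [indicator_of_mem hwT, Pi.one_apply, one_mul, commKernel]
    field_simp
    ring
  · have : T ≤ w.2.1 := not_lt.1 hwT
    rw [hE.eq_zero w.1 (by linarith)]
    simp

end IsLeviSource

/-- A linear functional bounded by `M + ‖J ·‖ ^ 2` is represented through the linear map `J`. -/
theorem exists_inner_eq_of_abs_le {V E : Type*} [AddCommGroup V] [Module ℝ V]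
    [NormedAddCommGroup E] [InnerProductSpace ℝ E] [CompleteSpace E] (J : V →ₗ[ℝ] E)
    (L : V →ₗ[ℝ] ℝ) {M : ℝ} (h : ∀ φ, |L φ| ≤ M + ‖J φ‖ ^ 2) :
    ∃ w : E, ∀ φ, L φ = inner ℝ w (J φ) := by
  have hM : 0 ≤ M := by simpa using h 0
  have hsc : ∀ (c : ℝ) φ, |c| * |L φ| ≤ M + c ^ 2 * ‖J φ‖ ^ 2 := by
    intro c φ
    have := h (c • φ)
    rwa [map_smul, map_smul, smul_eq_mul, abs_mul, norm_smul, mul_pow, Real.norm_eq_abs,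
      sq_abs] at this
  have hker : LinearMap.ker J ≤ LinearMap.ker L := by
    intro φ hφ
    rw [LinearMap.mem_ker] at hφ ⊢
    by_contra hne
    have h1 := hsc ((M + 1) / |L φ|) φ
    have h2 : 0 < |L φ| := abs_pos.2 hne
    rw [hφ, norm_zero, abs_of_nonneg (by positivity), div_mul_cancel₀ _ h2.ne'] at h1
    norm_num at h1
  have hbd : ∀ φ, |L φ| ≤ (M + 1) * ‖J φ‖ := by
    intro φ
    rcases eq_or_ne (J φ) 0 with h0 | h0
    · have : L φ = 0 := hker h0
      simp [this, h0]
    · have ha : 0 < ‖J φ‖ := norm_pos_iff.2 h0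
      have h1 := hsc ‖J φ‖⁻¹ φ
      rw [abs_of_nonneg (by positivity), ← mul_pow, inv_mul_cancel₀ ha.ne', one_pow,
        inv_mul_le_iff₀ ha] at h1
      linarith
  let f : LinearMap.range J →ₗ[ℝ] ℝ :=
    ((LinearMap.ker J).liftQ L hker).comp (J.quotKerEquivRange.symm : _ →ₗ[ℝ] _)
  have hf : ∀ φ, f ⟨J φ, LinearMap.mem_range_self J φ⟩ = L φ := by
    intro φ
    have : J.quotKerEquivRange.symm ⟨J φ, LinearMap.mem_range_self J φ⟩ =
        (LinearMap.ker J).mkQ φ := by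
      rw [LinearEquiv.symm_apply_eq]
      ext
      simp
    simp only [f, LinearMap.comp_apply, LinearEquiv.coe_coe, this]
    simp
  let F : LinearMap.range J →L[ℝ] ℝ := f.mkContinuous (M + 1) (by
    rintro ⟨_, φ, rfl⟩
    rw [hf]
    exact hbd φ)
  obtain ⟨g, hg, -⟩ := exists_extension_norm_eq (LinearMap.range J) F
  refine ⟨(InnerProductSpace.toDual ℝ E).symm g, fun φ => ?_⟩
  rw [InnerProductSpace.toDual_symm_apply, ← hf φ]
  exact (hg ⟨J φ, LinearMap.mem_range_self J φ⟩).symm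

theorem locallyIntegrableOn_of_timeBox {s : ℝ} {f : ℝ × ℝ → ℝ}
    (hf : ∀ η T R : ℝ, 0 < η → 0 < R → IntegrableOn f (timeBox s η T R)) :
    LocallyIntegrableOn f (Ioi s ×ˢ univ) := by
  intro p hp
  have hps : s < p.1 := hp.1
  refine ⟨timeBox s ((p.1 - s) / 2) (p.1 + 1) (|p.2| + 1), mem_nhdsWithin_of_mem_nhds ?_,
    hf _ _ _ (by linarith) (by positivity)⟩
  refine (isOpen_Ioo.prod isOpen_Ioo).mem_nhds ⟨⟨by linarith, by linarith⟩, ⟨?_, ?_⟩⟩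
  · linarith [neg_abs_le p.2]
  · linarith [le_abs_self p.2]

/-- The space of test functions. -/
def testFunctions (s : ℝ) : Submodule ℝ (ℝ × ℝ → ℝ) where
  carrier := {φ | IsTestFunction s φ}
  add_mem' h1 h2 := h1.add h2
  zero_mem' := ⟨contDiff_const, HasCompactSupport.zero, by simp [tsupport]⟩
  smul_mem' c _ h := h.smul c

namespace IsLeviSource

variable {γ l A s y : ℝ} {h : ℝ × ℝ → ℝ}

/-- The first derivative of the heat potential has a locally integrable weak derivative. -/
theorem exists_weak_deriv (hh : IsLeviSource γ l A s y h) : ∃ w : ℝ × ℝ → ℝ,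
    LocallyIntegrableOn w (Ioi s ×ˢ univ) ∧ ∀ φ, IsTestFunction s φ →
      ∫ p : ℝ × ℝ, heatPot gauss1 h p.1 p.2 * fderiv ℝ φ p (0, 1) = -∫ p, w p * φ p := by
  obtain ⟨C, hk⟩ := exists_isHeatLike_gauss1
  have hL2 : ∀ φ, IsTestFunction s φ → MemLp (fun q => φ q / spaceTimeWeight γ l s q) 2 := by
    intro φ hφ
    obtain ⟨h1, -, h3⟩ := hφ.integrable_div_weight hh.mem hh.l_nonneg
    exact (memLp_two_iff_integrable_sq h1.aestronglyMeasurable).2 h3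
  have hi1 : ∀ φ, IsTestFunction s φ →
      Integrable fun p : ℝ × ℝ => heatPot gauss1 h p.1 p.2 * fderiv ℝ φ p (0, 1) := by
    intro φ hφ
    obtain ⟨T, M, -, hE1, -⟩ := hφ.exists_isEarlyBounded
    exact (hh.integral_heatPot_mul hk hE1).1
  have hi2 : ∀ φ, IsTestFunction s φ → Integrable fun p => commPot γ l s h p * φ p :=
    fun φ hφ => (hh.integral_commPot_mul hφ).2.1
  let J : testFunctions s →ₗ[ℝ] Lp ℝ 2 (volume : Measure (ℝ × ℝ)) :=
    { toFun := fun φ => (hL2 φ φ.2).toLp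
      map_add' := fun φ ψ => by
        rw [← MemLp.toLp_add]
        refine MemLp.toLp_congr _ _ (Eventually.of_forall fun q => ?_)
        simp [add_div]
      map_smul' := fun c φ => by
        rw [RingHom.id_apply, ← MemLp.toLp_const_smul]
        refine MemLp.toLp_congr _ _ (Eventually.of_forall fun q => ?_)
        simp [mul_div_assoc] }
  let L : testFunctions s →ₗ[ℝ] ℝ :=
    { toFun := fun φ => (-∫ p : ℝ × ℝ, heatPot gauss1 h p.1 p.2 * fderiv ℝ φ.1 p (0, 1)) -
        ∫ p, commPot γ l s h p * φ.1 p
      map_add' := fun φ ψ => by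
        have e1 : ∀ p : ℝ × ℝ, heatPot gauss1 h p.1 p.2 * fderiv ℝ (φ + ψ).1 p (0, 1) =
            heatPot gauss1 h p.1 p.2 * fderiv ℝ φ.1 p (0, 1) +
            heatPot gauss1 h p.1 p.2 * fderiv ℝ ψ.1 p (0, 1) := by
          intro p
          have d1 := φ.2.contDiff.differentiable (by simp) p
          have d2 := ψ.2.contDiff.differentiable (by simp) p
          rw [Submodule.coe_add, fderiv_add d1 d2, add_apply, mul_add]
        have e2 : ∀ p : ℝ × ℝ, commPot γ l s h p * (φ + ψ).1 p =
            commPot γ l s h p * φ.1 p + commPot γ l s h p * ψ.1 p := by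
          intro p
          rw [Submodule.coe_add, Pi.add_apply, mul_add]
        simp only [e1, e2]
        rw [integral_add (hi1 _ φ.2) (hi1 _ ψ.2), integral_add (hi2 _ φ.2) (hi2 _ ψ.2)]
        ring
      map_smul' := fun c φ => by
        have e1 : ∀ p : ℝ × ℝ, heatPot gauss1 h p.1 p.2 * fderiv ℝ (c • φ).1 p (0, 1) =
            c * (heatPot gauss1 h p.1 p.2 * fderiv ℝ φ.1 p (0, 1)) := by
          intro p
          have d1 := φ.2.contDiff.differentiable (by simp) p
          rw [Submodule.coe_smul, fderiv_const_smul d1, smul_apply,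
            smul_eq_mul]
          ring
        have e2 : ∀ p : ℝ × ℝ, commPot γ l s h p * (c • φ).1 p =
            c * (commPot γ l s h p * φ.1 p) := by
          intro p
          rw [Submodule.coe_smul, Pi.smul_apply, smul_eq_mul]
          ring
        simp only [e1, e2, RingHom.id_apply, smul_eq_mul]
        rw [integral_const_mul, integral_const_mul]
        ring }
  have hJ : ∀ φ : testFunctions s, ‖J φ‖ ^ 2 = ∫ q, (φ.1 q / spaceTimeWeight γ l s q) ^ 2 := by
    intro φ
    rw [← real_inner_self_eq_norm_sq, L2.inner_def]
    refine integral_congr_ae ?_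
    filter_upwards [(hL2 φ φ.2).coeFn_toLp] with q hq
    change inner ℝ ((hL2 φ φ.2).toLp _ q) ((hL2 φ φ.2).toLp _ q) = _
    rw [hq, real_inner_self_eq_norm_sq, Real.norm_eq_abs, sq_abs]
  obtain ⟨w, hw⟩ := exists_inner_eq_of_abs_le J L
    (M := ∫ q, (spaceTimeWeight γ l s q * h q) ^ 2) fun φ => by
      rw [hJ]
      exact hh.abs_functional_le φ.2
  have hw2 : MemLp w 2 := Lp.memLp w
  have hwφ : ∀ φ : testFunctions s, L φ = ∫ q, w q / spaceTimeWeight γ l s q * φ.1 q := by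
    intro φ
    rw [hw, L2.inner_def]
    refine integral_congr_ae ?_
    filter_upwards [(hL2 φ φ.2).coeFn_toLp] with q hq
    change inner ℝ (w q) ((hL2 φ φ.2).toLp _ q) = _
    rw [hq]
    simp only [inner, RCLike.re_to_real, star_trivial]
    ring
  refine ⟨fun p => commPot γ l s h p + w p / spaceTimeWeight γ l s p,
    locallyIntegrableOn_of_timeBox fun η T R hη hR => ?_, fun φ hφ => ?_⟩
  · refine (hh.integrableOn_commPot hη T R).add ?_
    obtain ⟨i1, i2⟩ := integrable_indicator_inv_weight hh.mem hh.l_nonneg s hη T hR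
    have := hw2.integrable_mul ((memLp_two_iff_integrable_sq i1.aestronglyMeasurable).2 i2)
    refine (this.integrableOn (s := timeBox s η T R)).congr_fun (fun p hp => ?_)
      (measurableSet_timeBox s η T R)
    simp only [Pi.mul_apply, indicator_of_mem hp, div_eq_mul_inv]
  · have i3 : Integrable fun q => w q / spaceTimeWeight γ l s q * φ q := by
      refine (hw2.integrable_mul (hL2 φ hφ)).congr (Eventually.of_forall fun q => ?_)
      simp only [Pi.mul_apply]
      ring
    have e := hwφ ⟨φ, hφ⟩
    change (-∫ p : ℝ × ℝ, heatPot gauss1 h p.1 p.2 * fderiv ℝ φ p (0, 1)) -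
        ∫ p, commPot γ l s h p * φ p = _ at e
    simp only [add_mul]
    rw [integral_add (hi2 φ hφ) i3]
    linarith

end IsLeviSource

theorem sqrt_mul_gauss_sqrt_mul {v : ℝ} (hv : 0 < v) (u : ℝ) :
    √v * gauss v (√v * u) = gauss 1 u := by
  have h1 : √v = v ^ (1 / 2 : ℝ) := Real.sqrt_eq_rpow v
  have h2 : v ^ (1 / 2 : ℝ) * v ^ (-(1 / 2) : ℝ) = 1 := by
    rw [← Real.rpow_add hv]; norm_num
  rw [gauss, gauss, mul_pow, Real.sq_sqrt hv.le, mul_div_cancel_left₀ _ hv.ne', mul_one, div_one,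
    Real.mul_rpow (by positivity) hv.le, h1]
  calc _ = (v ^ (1 / 2 : ℝ) * v ^ (-(1 / 2) : ℝ)) * ((2 * Real.pi) ^ (-(1 / 2) : ℝ) *
      Real.exp (-(1 / 2) * u ^ 2)) := by ring
    _ = _ := by rw [h2, one_mul]

/-- The heat kernel is an approximate identity. -/
theorem tendsto_integral_gauss_mul {f : ℝ → ℝ → ℝ} {M L z : ℝ} (hm : ∀ v, Measurable (f v))
    (hM : ∀ v x, |f v x| ≤ M)
    (hf : Tendsto (Function.uncurry f) (𝓝[>] 0 ×ˢ 𝓝 z) (𝓝 L)) :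
    Tendsto (fun v => ∫ x, gauss v (x - z) * f v x) (𝓝[>] 0) (𝓝 L) := by
  have e : ∀ v, 0 < v → ∫ x, gauss v (x - z) * f v x = ∫ u, gauss 1 u * f v (√v * u + z) := by
    intro v hv
    have hs : 0 < √v := Real.sqrt_pos.2 hv
    rw [← integral_add_right_eq_self _ z]
    simp only [add_sub_cancel_right]
    have := Measure.integral_comp_mul_left (fun x => gauss v x * f v (x + z)) √v
    rw [abs_of_pos (inv_pos.2 hs), smul_eq_mul, eq_inv_mul_iff_mul_eq₀ hs.ne'] at this
    rw [← this, ← integral_const_mul]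
    refine integral_congr_ae (Eventually.of_forall fun u => ?_)
    simp only
    rw [← mul_assoc, sqrt_mul_gauss_sqrt_mul hv]
  have hg : Integrable (gauss 1) := by simpa using integrable_gauss 1 0
  have hg1 : ∫ u, gauss 1 u = 1 := by simpa using integral_gauss one_pos 0
  have key : Tendsto (fun v => ∫ u, gauss 1 u * f v (√v * u + z)) (𝓝[>] 0)
      (𝓝 (∫ u, gauss 1 u * L)) := by
    refine tendsto_integral_filter_of_dominated_convergence (fun u => M * gauss 1 u)
      (Eventually.of_forall fun v => ?_) (Eventually.of_forall fun v =>
        Eventually.of_forall fun u => ?_) (hg.const_mul M) (Eventually.of_forall fun u => ?_)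
    · exact hg.aestronglyMeasurable.mul
        ((hm v).comp (by fun_prop)).aestronglyMeasurable
    · rw [norm_mul, Real.norm_eq_abs, Real.norm_eq_abs, abs_of_nonneg (gauss_nonneg 1 u), mul_comm]
      exact mul_le_mul_of_nonneg_right (hM _ _) (gauss_nonneg 1 u)
    · refine Tendsto.const_mul _ (hf.comp (Tendsto.prodMk tendsto_id ?_))
      have : Tendsto (fun v => √v * u + z) (𝓝 0) (𝓝 (√0 * u + z)) :=
        Continuous.tendsto (by fun_prop) 0
      simp only [Real.sqrt_zero, zero_mul, zero_add] at this
      exact this.mono_left nhdsWithin_le_nhds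
  rw [integral_mul_const, hg1, one_mul] at key
  refine key.congr' ?_
  filter_upwards [self_mem_nhdsWithin] with v hv
  exact (e v hv).symm

theorem IsHeatLike.integrable_mul {k : ℝ → ℝ → ℝ} {C p T M : ℝ} (hk : IsHeatLike k C p)
    {ψ : ℝ × ℝ → ℝ} (hψ : IsEarlyBounded T M ψ) (q : ℝ × ℝ) :
    Integrable fun a : ℝ × ℝ => k (a.1 - q.1) (a.2 - q.2) * ψ a := by
  have hC := hk.C_nonneg
  have hM : 0 ≤ M := (abs_nonneg _).trans (hψ.abs_le 0)
  have i := (integrable_rpow_mul_exp_mul_gauss (β := 0) (c := -p) le_rfl one_pos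
    (by linarith [hk.p_le]) q.1 q.2).const_mul (C * M * Real.exp (T - q.1))
  have hψm := hψ.measurable
  refine i.mono' (Measurable.aestronglyMeasurable ((hk.measurable.comp (by fun_prop : Measurable
    fun a : ℝ × ℝ => (a.1 - q.1, a.2 - q.2))).mul hψm)) (Eventually.of_forall fun a => ?_)
  rcases le_or_gt a.1 q.1 with ha | ha
  · rw [hk.of_nonpos _ _ (by linarith), gauss_of_nonpos (by linarith)]
    simp
  have hv : 0 < a.1 - q.1 := sub_pos.2 ha
  have hG := gauss_nonneg (2 * (a.1 - q.1)) (a.2 - q.2)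
  rcases le_or_gt T a.1 with hT | hT
  · rw [hψ.eq_zero a hT, mul_zero, norm_zero]
    positivity
  · rw [norm_mul, Real.norm_eq_abs, Real.norm_eq_abs, neg_zero, Real.rpow_zero, one_mul]
    have h1 : 1 ≤ Real.exp (T - q.1) * Real.exp (-(a.1 - q.1)) := by
      rw [← Real.exp_add]
      exact Real.one_le_exp (by linarith)
    calc _ ≤ (C * ((a.1 - q.1) ^ (-p) * gauss (2 * (a.1 - q.1)) (a.2 - q.2))) * M :=
          mul_le_mul (hk.abs_le _ _ hv) (hψ.abs_le a) (abs_nonneg _) (by positivity)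
      _ ≤ (C * ((a.1 - q.1) ^ (-p) * gauss (2 * (a.1 - q.1)) (a.2 - q.2))) * M *
          (Real.exp (T - q.1) * Real.exp (-(a.1 - q.1))) :=
        le_mul_of_one_le_right (by positivity) h1
      _ = _ := by ring

theorem ContinuousOn.comp_sub {k : ℝ → ℝ → ℝ}
    (hk : ContinuousOn (Function.uncurry k) (Ioi 0 ×ˢ univ)) (s y : ℝ) :
    ContinuousOn (fun p : ℝ × ℝ => k (p.1 - s) (p.2 - y)) (Ioi s ×ˢ univ) := by
  refine ContinuousOn.comp (g := Function.uncurry k) (f := fun p : ℝ × ℝ => (p.1 - s, p.2 - y))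
    hk (by fun_prop) fun p hp => ?_
  exact ⟨sub_pos.2 (mem_Ioi.1 hp.1), mem_univ _⟩

theorem locallyIntegrableOn_gauss2 (s y : ℝ) :
    LocallyIntegrableOn (fun p : ℝ × ℝ => gauss2 (p.1 - s) (p.2 - y)) (Ioi s ×ˢ univ) :=
  (continuousOn_gauss2.comp_sub s y).locallyIntegrableOn (measurableSet_Ioi.prod MeasurableSet.univ)

namespace IsTestFunction

variable {s : ℝ} {φ : ℝ × ℝ → ℝ}

theorem hasDerivAt_integral_gauss (hφ : IsTestFunction s φ) {r t : ℝ} (hrt : r < t) (z : ℝ) :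
    HasDerivAt (fun t => ∫ x, gauss (t - r) (x - z) * φ (t, x))
      (∫ x, (gauss (t - r) (x - z) * fderiv ℝ φ (t, x) (1, 0) -
        1 / 2 * (gauss1 (t - r) (x - z) * fderiv ℝ φ (t, x) (0, 1)))) t := by
  obtain ⟨η, T, R, M, hη, hR, hM, hbox, hb⟩ := hφ.exists_box
  set ε := (t - r) / 2 with hε
  have hε0 : 0 < ε := by linarith
  obtain ⟨C, hC0, hC⟩ := exists_gauss_bound hε0
  have hφc := hφ.contDiff.continuous
  have hi1 := integrable_slice hφc hφ.hasCompactSupport t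
  have hi2 := integrable_slice (hφ.continuous_fderiv_apply (1, 0))
    (hφ.hasCompactSupport_fderiv_apply (1, 0)) t
  have hi3 := integrable_slice (hφ.continuous_fderiv_apply (0, 1))
    (hφ.hasCompactSupport_fderiv_apply (0, 1)) t
  have m0 : ∀ t', AEStronglyMeasurable (fun x => gauss (t' - r) (x - z)) := fun t' =>
    (Measurable.gauss (by fun_prop) (by fun_prop)).aestronglyMeasurable
  have m1 : AEStronglyMeasurable (fun x => gauss1 (t - r) (x - z)) :=
    (Measurable.gauss1 (by fun_prop) (by fun_prop)).aestronglyMeasurable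
  have m2 : AEStronglyMeasurable (fun x => gauss2 (t - r) (x - z)) :=
    (Measurable.gauss2 (by fun_prop) (by fun_prop)).aestronglyMeasurable
  have hle : ε ≤ t - r := by linarith
  have j0 := hi1.bdd_mul (c := C) (m0 t) (Eventually.of_forall fun x => (hC _ _ hle).1)
  have j1 := hi2.bdd_mul (c := C) (m0 t) (Eventually.of_forall fun x => (hC _ _ hle).1)
  have j2 := hi1.bdd_mul (c := C) m2 (Eventually.of_forall fun x => (hC _ _ hle).2.2)
  have j3 := hi3.bdd_mul (c := C) m1 (Eventually.of_forall fun x => (hC _ _ hle).2.1)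
  have key := (hasDerivAt_integral_of_dominated_loc_of_deriv_le (𝕜 := ℝ)
    (F := fun t x => gauss (t - r) (x - z) * φ (t, x))
    (F' := fun t x => 1 / 2 * gauss2 (t - r) (x - z) * φ (t, x) +
      gauss (t - r) (x - z) * fderiv ℝ φ (t, x) (1, 0)) (x₀ := t) (s := Ioi (r + ε))
    (bound := (Ioo (-R) R).indicator fun _ => 1 / 2 * C * M + C * M) (μ := volume)
    (Ioi_mem_nhds (by linarith)) (Eventually.of_forall fun t' => ?_) j0 ?_
    (Eventually.of_forall fun x t' ht' => ?_) ?_ (Eventually.of_forall fun x t' ht' => ?_)).2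
  · refine key.congr_deriv (Eq.symm ?_)
    have e2 : ∀ x, 1 / 2 * gauss2 (t - r) (x - z) * φ (t, x) =
      1 / 2 * (gauss2 (t - r) (x - z) * φ (t, x)) := fun x => by ring
    simp only [e2]
    rw [integral_sub j1 (j3.const_mul _), integral_add (j2.const_mul _) j1, integral_const_mul,
      integral_const_mul, hφ.integral_gauss1_mul_fderiv]
    ring
  · exact (m0 t').mul (by fun_prop : Continuous fun x => φ (t', x)).aestronglyMeasurable
  · refine ((j2.const_mul (1 / 2)).add j1).aestronglyMeasurable.congr
      (Eventually.of_forall fun x => ?_)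
    simp only [Pi.add_apply]
    ring
  · have hv : ε ≤ t' - r := by
      have : r + ε < t' := ht'
      linarith
    by_cases hx : x ∈ Ioo (-R) R
    · rw [indicator_of_mem hx]
      refine (norm_add_le _ _).trans (add_le_add ?_ ?_)
      · rw [norm_mul, norm_mul]
        have h1 := (hC (t' - r) (x - z) hv).2.2
        have h2 := (hb (t', x)).1
        rw [← Real.norm_eq_abs] at h1 h2
        have : ‖(1 / 2 : ℝ)‖ = 1 / 2 := by norm_num
        rw [this]
        gcongr
      · rw [norm_mul]
        have h1 := (hC (t' - r) (x - z) hv).1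
        rw [← Real.norm_eq_abs] at h1
        have h2 : ‖fderiv ℝ φ (t', x) (1, 0)‖ ≤ M := by
          refine ((fderiv ℝ φ (t', x)).le_opNorm (1, 0)).trans ?_
          simpa [Prod.norm_def] using (hb (t', x)).2
        gcongr
    · have hout : (t', x) ∉ timeBox s η T R := fun h => hx h.2
      rw [(hbox _ hout).1, (hbox _ hout).2, indicator_of_notMem hx]
      simp
  · exact (integrable_indicator_iff measurableSet_Ioo).2 (integrable_const _)
  · have hv : 0 < t' - r := by
      have : r + ε < t' := ht'
      linarith
    have h1 := (hasDerivAt_gauss_var hv (x - z)).comp t' ((hasDerivAt_id t').sub_const r)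
    have h2 := hφ.hasDerivAt_fst t' x
    rw [mul_one] at h1
    exact h1.mul h2

/-- The heat kernel is a fundamental solution of the adjoint heat equation in the weak sense. -/
theorem integral_heat_adjoint (hφ : IsTestFunction s φ) (q : ℝ × ℝ) :
    ∫ p : ℝ × ℝ, (gauss (p.1 - q.1) (p.2 - q.2) * fderiv ℝ φ p (1, 0) -
      1 / 2 * (gauss1 (p.1 - q.1) (p.2 - q.2) * fderiv ℝ φ p (0, 1))) = -φ q := by
  obtain ⟨C0, hk0⟩ := exists_isHeatLike_gauss
  obtain ⟨C1, hk1⟩ := exists_isHeatLike_gauss1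
  obtain ⟨T, M, hE, hEx, hEt⟩ := hφ.exists_isEarlyBounded
  have i : Integrable fun p : ℝ × ℝ => (gauss (p.1 - q.1) (p.2 - q.2) * fderiv ℝ φ p (1, 0) -
      1 / 2 * (gauss1 (p.1 - q.1) (p.2 - q.2) * fderiv ℝ φ p (0, 1))) :=
    (hk0.integrable_mul hEt q).sub ((hk1.integrable_mul hEx q).const_mul _)
  rw [Measure.volume_eq_prod] at i ⊢
  rw [integral_prod _ i]
  have i' := i.integral_prod_left
  set F : ℝ → ℝ := fun t => ∫ x, gauss (t - q.1) (x - q.2) * φ (t, x) with hF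
  have hd : ∀ t, q.1 < t → HasDerivAt F _ t := fun t ht => hφ.hasDerivAt_integral_gauss ht q.2
  rw [← setIntegral_eq_integral_of_forall_compl_eq_zero (s := Ioi q.1)]
  · have hF0 : Tendsto F (𝓝[>] q.1) (𝓝 (φ q)) := by
      have h1 := tendsto_integral_gauss_mul (f := fun v x => φ (q.1 + v, x)) (M := M) (L := φ q)
        (z := q.2) (fun v => by
          have := hφ.contDiff.continuous
          exact Continuous.measurable (by fun_prop)) (fun v x => hE.abs_le _) ?_
      · have h2 : Tendsto (fun t => t - q.1) (𝓝[>] q.1) (𝓝[>] 0) := by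
          refine tendsto_nhdsWithin_iff.2 ⟨?_, ?_⟩
          · have : Tendsto (fun t => t - q.1) (𝓝 q.1) (𝓝 (q.1 - q.1)) :=
              Continuous.tendsto (by fun_prop) _
            rw [sub_self] at this
            exact this.mono_left nhdsWithin_le_nhds
          · filter_upwards [self_mem_nhdsWithin] with t ht
            exact sub_pos.2 (mem_Ioi.1 ht)
        refine (h1.comp h2).congr fun t => ?_
        simp [hF]
      · have h3 : Tendsto (fun a : ℝ × ℝ => φ (q.1 + a.1, a.2)) (𝓝 (0, q.2))
            (𝓝 (φ (q.1 + 0, q.2))) := by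
          have := hφ.contDiff.continuous
          exact Continuous.tendsto (by fun_prop) _
        rw [add_zero, nhds_prod_eq] at h3
        exact h3.mono_left (prod_mono nhdsWithin_le_nhds le_rfl)
    have key := integral_Ioi_of_hasDerivAt_of_tendsto (a := q.1) (m := 0)
      (f := Function.update F q.1 (φ q))
      (f' := fun t => ∫ x, (gauss (t - q.1) (x - q.2) * fderiv ℝ φ (t, x) (1, 0) -
        1 / 2 * (gauss1 (t - q.1) (x - q.2) * fderiv ℝ φ (t, x) (0, 1)))) ?_ ?_ i'.integrableOn ?_
    · rw [Function.update_self, zero_sub] at key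
      exact key
    · rw [continuousWithinAt_update_same, Ici_sdiff_left]
      exact hF0
    · intro t ht
      refine (hd t ht).congr_of_eventuallyEq ?_
      filter_upwards [Ioi_mem_nhds ht] with t' ht'
      exact Function.update_of_ne (ne_of_gt ht') _ _
    · refine tendsto_const_nhds.congr' ?_
      filter_upwards [eventually_gt_atTop q.1, eventually_ge_atTop T] with t h1 h2
      rw [Function.update_of_ne h1.ne', hF]
      simp [hE.eq_zero (t, _) h2]
  · intro t ht
    have ht' : t - q.1 ≤ 0 := sub_nonpos.2 (not_lt.1 ht)
    simp [gauss_of_nonpos ht', gauss1_of_nonpos ht']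

theorem integrable_mul (hφ : IsTestFunction s φ) {f : ℝ × ℝ → ℝ}
    (hf : LocallyIntegrableOn f (Ioi s ×ˢ univ)) : Integrable fun p => f p * φ p := by
  have h1 := hf.integrableOn_compact_subset hφ.tsupport_subset hφ.hasCompactSupport
  obtain ⟨T, M, hE, -, -⟩ := hφ.exists_isEarlyBounded
  have h2 : Integrable (fun p => φ p * f p) (volume.restrict (tsupport φ)) :=
    Integrable.bdd_mul (c := M) h1 hφ.contDiff.continuous.aestronglyMeasurable
    (Eventually.of_forall hE.abs_le)
  have h3 := (integrableOn_iff_integrable_of_support_subset (fun p hp => subset_tsupport φ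
    (fun h0 => hp (by simp [h0])))).1 h2
  simpa only [mul_comm] using h3

theorem setIntegral_mul (hφ : IsTestFunction s φ) (f : ℝ × ℝ → ℝ) :
    ∫ p in Ioi s ×ˢ univ, f p * φ p = ∫ p, f p * φ p := by
  refine setIntegral_eq_integral_of_forall_compl_eq_zero fun p hp => ?_
  rw [image_eq_zero_of_notMem_tsupport fun h => hp (hφ.tsupport_subset h), mul_zero]

theorem setIntegral_mul_fderiv (hφ : IsTestFunction s φ) (f : ℝ × ℝ → ℝ) (e : ℝ × ℝ) :
    ∫ p in Ioi s ×ˢ univ, f p * fderiv ℝ φ p e = ∫ p, f p * fderiv ℝ φ p e := by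
  refine setIntegral_eq_integral_of_forall_compl_eq_zero fun p hp => ?_
  have : fderiv ℝ φ p = 0 := by
    by_contra hne
    exact hp (hφ.tsupport_subset (support_fderiv_subset ℝ hne))
  rw [this]
  simp

theorem integral_gauss1_mul_fderiv_prod (hφ : IsTestFunction s φ) (y : ℝ) :
    ∫ p : ℝ × ℝ, gauss1 (p.1 - s) (p.2 - y) * fderiv ℝ φ p (0, 1) =
      -∫ p : ℝ × ℝ, gauss2 (p.1 - s) (p.2 - y) * φ p := by
  obtain ⟨C1, hk1⟩ := exists_isHeatLike_gauss1
  obtain ⟨T, M, -, hEx, -⟩ := hφ.exists_isEarlyBounded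
  have i1 := hk1.integrable_mul hEx (s, y)
  have i2 := hφ.integrable_mul (locallyIntegrableOn_gauss2 s y)
  rw [Measure.volume_eq_prod] at i1 i2 ⊢
  rw [integral_prod _ i1, integral_prod _ i2, ← integral_neg]
  exact integral_congr_ae (Eventually.of_forall fun t => hφ.integral_gauss1_mul_fderiv (t - s) t y)

end IsTestFunction

namespace IsLeviSource

variable {γ l A s y : ℝ} {h : ℝ × ℝ → ℝ}

theorem locallyIntegrableOn (hh : IsLeviSource γ l A s y h) :
    LocallyIntegrableOn h (Ioi s ×ˢ univ) := by
  refine locallyIntegrableOn_of_timeBox fun η T R hη hR => ?_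
  refine (hh.integrable_Iio T).integrableOn.congr_fun (fun q hq => ?_)
    (measurableSet_timeBox s η T R)
  have : q.1 ∈ Iio T := hq.1.2
  simp only [indicator_of_mem this, Pi.one_apply, one_mul]

/-- The heat potential of `h` solves the inhomogeneous heat equation weakly. -/
theorem integral_heatPot_mul_fderiv_time (hh : IsLeviSource γ l A s y h) {φ : ℝ × ℝ → ℝ}
    (hφ : IsTestFunction s φ) :
    ∫ p : ℝ × ℝ, heatPot gauss h p.1 p.2 * fderiv ℝ φ p (1, 0) =
      1 / 2 * (∫ p : ℝ × ℝ, heatPot gauss1 h p.1 p.2 * fderiv ℝ φ p (0, 1)) - ∫ p, h p * φ p := by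
  obtain ⟨C0, hk0⟩ := exists_isHeatLike_gauss
  obtain ⟨C1, hk1⟩ := exists_isHeatLike_gauss1
  obtain ⟨T, M, -, hEx, hEt⟩ := hφ.exists_isEarlyBounded
  have i0 := hh.integrable_kernel_mul_prod hk0 hEt
  have i1 := (hh.integrable_kernel_mul_prod hk1 hEx).const_mul (1 / 2)
  rw [(hh.integral_heatPot_mul hk0 hEt).2, (hh.integral_heatPot_mul hk1 hEx).2]
  have key : ∫ w : (ℝ × ℝ) × (ℝ × ℝ), (gauss (w.1.1 - w.2.1) (w.1.2 - w.2.2) *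
      (fderiv ℝ φ w.1 (1, 0) * h w.2) - 1 / 2 * (gauss1 (w.1.1 - w.2.1) (w.1.2 - w.2.2) *
      (fderiv ℝ φ w.1 (0, 1) * h w.2))) = -∫ p, h p * φ p := by
    have i2 : Integrable fun w : (ℝ × ℝ) × (ℝ × ℝ) => (gauss (w.1.1 - w.2.1) (w.1.2 - w.2.2) *
      (fderiv ℝ φ w.1 (1, 0) * h w.2) - 1 / 2 * (gauss1 (w.1.1 - w.2.1) (w.1.2 - w.2.2) *
      (fderiv ℝ φ w.1 (0, 1) * h w.2))) := i0.sub i1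
    rw [Measure.volume_eq_prod (ℝ × ℝ) (ℝ × ℝ), integral_prod_symm _ i2, ← integral_neg]
    refine integral_congr_ae (Eventually.of_forall fun q => ?_)
    simp only
    rw [← mul_neg, ← hφ.integral_heat_adjoint q, ← integral_const_mul]
    refine integral_congr_ae (Eventually.of_forall fun p => ?_)
    simp only
    ring
  rw [integral_sub i0 i1, integral_const_mul] at key
  linarith

theorem isStrongSolution (hh : IsLeviSource γ l A s y h) {a : ℝ → ℝ → ℝ}
    (ha : ∀ t x, s < t → h (t, x) = a t x * (gauss1 (t - s) (x - y) + heatPot gauss1 h t x)) :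
    IsStrongSolution a s (fun t x => gauss (t - s) (x - y) + heatPot gauss h t x) := by
  obtain ⟨C0, hk0⟩ := exists_isHeatLike_gauss
  obtain ⟨C1, hk1⟩ := exists_isHeatLike_gauss1
  obtain ⟨w, hw, hwφ⟩ := hh.exists_weak_deriv
  have hQ : MeasurableSet (Ioi s ×ˢ (univ : Set ℝ)) := measurableSet_Ioi.prod MeasurableSet.univ
  have hu : ContinuousOn (fun p : ℝ × ℝ => gauss (p.1 - s) (p.2 - y) + heatPot gauss h p.1 p.2)
      (Ioi s ×ˢ univ) := (continuousOn_gauss.comp_sub s y).add (hh.continuousOn_heatPot hk0)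
  have hux : ContinuousOn (fun p : ℝ × ℝ => gauss1 (p.1 - s) (p.2 - y) + heatPot gauss1 h p.1 p.2)
      (Ioi s ×ˢ univ) := (continuousOn_gauss1.comp_sub s y).add (hh.continuousOn_heatPot hk1)
  have hl : LocallyIntegrableOn (fun p : ℝ × ℝ => gauss2 (p.1 - s) (p.2 - y) + w p)
      (Ioi s ×ˢ univ) := (locallyIntegrableOn_gauss2 s y).add hw
  have hxx : ∀ φ, IsTestFunction s φ → ∫ p : ℝ × ℝ, (gauss1 (p.1 - s) (p.2 - y) +
      heatPot gauss1 h p.1 p.2) * fderiv ℝ φ p (0, 1) =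
      -∫ p : ℝ × ℝ, (gauss2 (p.1 - s) (p.2 - y) + w p) * φ p := by
    intro φ hφ
    obtain ⟨T, M, -, hEx, -⟩ := hφ.exists_isEarlyBounded
    simp only [add_mul]
    rw [integral_add (hk1.integrable_mul hEx (s, y)) (hh.integral_heatPot_mul hk1 hEx).1,
      integral_add (hφ.integrable_mul (locallyIntegrableOn_gauss2 s y)) (hφ.integrable_mul hw),
      hwφ φ hφ, hφ.integral_gauss1_mul_fderiv_prod y]
    ring
  refine ⟨fun p => 1 / 2 * (gauss2 (p.1 - s) (p.2 - y) + w p) + h p,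
    fun p => gauss1 (p.1 - s) (p.2 - y) + heatPot gauss1 h p.1 p.2,
    fun p => gauss2 (p.1 - s) (p.2 - y) + w p, hu, hux, fun t x ht => ?_,
    ⟨hu.locallyIntegrableOn hQ, ?_, fun φ h1 h2 h3 => ?_⟩,
    ⟨hux.locallyIntegrableOn hQ, hl, fun φ h1 h2 h3 => ?_⟩, Eventually.of_forall fun q hq => ?_⟩
  · exact (hasDerivAt_gauss_sub (t - s) x y).add (hh.hasDerivAt_heatPot hk0 hk1
      (fun v x => hasDerivAt_gauss v x) ht x)
  · have := hl.smul (1 / 2 : ℝ)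
    exact this.add hh.locallyIntegrableOn
  · have hφ : IsTestFunction s φ := ⟨h1, h2, h3⟩
    obtain ⟨T, M, -, hEx, hEt⟩ := hφ.exists_isEarlyBounded
    rw [hφ.setIntegral_mul_fderiv, hφ.setIntegral_mul]
    have e := hxx φ hφ
    have e0 := hφ.integral_heat_adjoint (s, y)
    have hφ0 : φ (s, y) = 0 :=
      image_eq_zero_of_notMem_tsupport fun hm => lt_irrefl s (hφ.tsupport_subset hm).1
    have i0 := hk0.integrable_mul hEt (s, y)
    have i1 := hk1.integrable_mul hEx (s, y)
    rw [integral_sub i0 (i1.const_mul _), integral_const_mul, hφ0] at e0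
    have e1 : ∀ p : ℝ × ℝ, (1 / 2 * (gauss2 (p.1 - s) (p.2 - y) + w p) + h p) * φ p =
      1 / 2 * ((gauss2 (p.1 - s) (p.2 - y) + w p) * φ p) + h p * φ p := fun p => by ring
    simp only [e1, Function.uncurry, add_mul (gauss _ _), add_mul (gauss1 _ _)] at e ⊢
    rw [integral_add ((hφ.integrable_mul hl).const_mul _)
      (hφ.integrable_mul hh.locallyIntegrableOn), integral_const_mul,
      integral_add i0 (hh.integral_heatPot_mul hk0 hEt).1, hh.integral_heatPot_mul_fderiv_time hφ]
    rw [integral_add i1 (hh.integral_heatPot_mul hk1 hEx).1] at e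
    simp only at e e0 ⊢
    linarith
  · have hφ : IsTestFunction s φ := ⟨h1, h2, h3⟩
    rw [hφ.setIntegral_mul_fderiv, hφ.setIntegral_mul, hxx φ hφ]
  · simp only
    rw [← ha q.1 q.2 hq]

end IsLeviSource

section Levi

variable {γ K : ℝ} {b : ℝ → ℝ → ℝ}

/-- The Neumann series as a function of its first two arguments. -/
noncomputable def leviSource (γ : ℝ) (b : ℝ → ℝ → ℝ) (s y : ℝ) (q : ℝ × ℝ) : ℝ :=
  leviSeries γ b q.1 q.2 s y

/-- The parametrix formula for the fundamental solution. -/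
noncomputable def parametrix (γ : ℝ) (b : ℝ → ℝ → ℝ) : ParabolicKernel := fun t x s y =>
  gauss (t - s) (x - y) + heatPot gauss (leviSource γ b s y) t x

/-- What is known about the convolution of a kernel with the Neumann series. -/
structure LeviConvergence (γ : ℝ) (b : ℝ → ℝ → ℝ) (k : ParabolicKernel) (t x s y : ℝ) : Prop where
  integrable_term : ∀ m, StConvIntegrable k (leviTerm γ b m) t x s y
  summable : Summable fun m => |stConv k (leviTerm γ b m) t x s y|
  integrable : StConvIntegrable k (leviSeries γ b) t x s y
  eq_tsum : stConv k (leviSeries γ b) t x s y = ∑' m, stConv k (leviTerm γ b m) t x s y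

theorem exists_parametrix (hγ : γ ∈ Ioo (0 : ℝ) 1) (hb : Measurable (Function.uncurry b))
    (hK : ∀ t x, |b t x| ≤ K) :
    MeasurableKernel (parametrix γ b) ∧
    (∀ t x s y, s < t → Summable (fun m => |leviTerm γ b m t x s y|) ∧
      LeviConvergence γ b (leviKernel γ b) t x s y ∧ LeviConvergence γ b heatZ t x s y ∧
      leviSeries γ b t x s y =
        leviKernel γ b t x s y + stConv (leviKernel γ b) (leviSeries γ b) t x s y ∧
      parametrix γ b t x s y = heatZ t x s y + stConv heatZ (leviSeries γ b) t x s y) ∧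
    (∀ s y, IsStrongSolution (drift γ b) s (fun t x => parametrix γ b t x s y)) ∧
    ∃ l D : ℝ, ∀ t x s y, s < t → |stConv heatZ (leviSeries γ b) t x s y| ≤
      D * (Real.exp (l * (t - s)) * (t - s) ^ ((1 - γ) / 2)) * gauss (2 * (t - s)) (x - y) := by
  obtain ⟨l, A, hl, hA, hbound⟩ := exists_abs_leviTerm_le hγ hb hK
  have hterm := fun m t x s y => (hbound m t x s y).1
  obtain ⟨C0, hk0⟩ := exists_isHeatLike_gauss
  obtain ⟨C1, hk1⟩ := exists_isHeatLike_gauss1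
  obtain ⟨D, hD, hconv⟩ := exists_lintegral_mul_leviMajorant_le (p := 0) hγ (by linarith [hγ.2])
  have hmΦ := measurableKernel_leviSeries hb hterm
  have hsrc : ∀ s y, IsLeviSource γ l (2 * A) s y (leviSource γ b s y) := fun s y =>
    ⟨hγ, hl.le, by positivity, hmΦ.comp (by fun_prop) (by fun_prop) (by fun_prop) (by fun_prop),
      fun q => abs_leviSeries_le hterm _ _ _ _⟩
  have hL := fun t x s y (hst : s < t) => stConv_leviSeries hb hA hterm
    (measurableKernel_leviKernel hb) hst (by have := leviMajorant_nonneg γ l t x s y; positivity)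
    ((hbound 0 t x s y).2 hst)
  have hZ := fun t x s y (hst : s < t) => stConv_leviSeries hb hA hterm
    measurableKernel_heatZ (t := t) (x := x) (y := y) (B := C0 * (D * Real.exp (l * (t - s)) *
      (t - s) ^ (1 / 2 - 0 - γ / 2) * gauss (2 * (t - s)) (x - y))) hst
    (by
      have := gauss_nonneg (2 * (t - s)) (x - y)
      have := sub_pos.2 hst
      have := hk0.C_nonneg
      positivity)
    (by
      rw [ENNReal.ofReal_mul hk0.C_nonneg]
      refine le_trans ?_ (mul_le_mul_right (hconv l s t x y hl.le hst) _)
      rw [← lintegral_const_mul' _ _ ENNReal.ofReal_ne_top]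
      refine setLIntegral_mono' measurableSet_Ioo fun r hr => ?_
      rw [← lintegral_const_mul' _ _ ENNReal.ofReal_ne_top]
      refine lintegral_mono fun z => ?_
      rw [← ENNReal.ofReal_mul hk0.C_nonneg]
      refine ENNReal.ofReal_le_ofReal ?_
      rw [← mul_assoc]
      exact mul_le_mul_of_nonneg_right (hk0.abs_le _ _ (sub_pos.2 hr.2))
        (leviMajorant_nonneg γ l r z s y))
  have hvol := fun t x s y (hst : s < t) =>
    leviSeries_eq_add (γ := γ) (b := b) hterm (hL t x s y hst).2.2.2.1
  refine ⟨?_, fun t x s y hst => ⟨summable_abs_leviTerm hterm t x s y,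
    ⟨(hL t x s y hst).1, (hL t x s y hst).2.1, (hL t x s y hst).2.2.1, (hL t x s y hst).2.2.2.1⟩,
    ⟨(hZ t x s y hst).1, (hZ t x s y hst).2.1, (hZ t x s y hst).2.2.1, (hZ t x s y hst).2.2.2.1⟩,
    hvol t x s y hst, ?_⟩, fun s y => (hsrc s y).isStrongSolution fun t x hst => ?_, l,
      2 * A * C0 * D, fun t x s y hst => ?_⟩
  · refine Measurable.add (Measurable.gauss (by fun_prop) (by fun_prop)) ?_
    have hm : Measurable fun w : (ℝ × ℝ × ℝ × ℝ) × (ℝ × ℝ) =>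
        gauss (w.1.1 - w.2.1) (w.1.2.1 - w.2.2) *
          leviSeries γ b w.2.1 w.2.2 w.1.2.2.1 w.1.2.2.2 :=
      (Measurable.gauss (by fun_prop) (by fun_prop)).mul
        (hmΦ.comp (by fun_prop) (by fun_prop) (by fun_prop) (by fun_prop))
    exact (hm.stronglyMeasurable.integral_prod_right' (ν := (volume : Measure (ℝ × ℝ)))).measurable
  · rw [parametrix, (hsrc s y).heatPot_eq_setIntegral hk0, (hZ t x s y hst).2.2.2.2.1]
    rfl
  · change leviSeries γ b t x s y = _
    rw [hvol t x s y hst, (hL t x s y hst).2.2.2.2.1, (hsrc s y).heatPot_eq_setIntegral hk1,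
      leviKernel_eq, mul_add, ← integral_const_mul]
    congr 1
    refine integral_congr_ae (Eventually.of_forall fun q => ?_)
    simp only [leviKernel_eq, leviSource]
    ring
  · refine (hZ t x s y hst).2.2.2.2.2.trans (le_of_eq ?_)
    rw [show (1 - γ) / 2 = 1 / 2 - 0 - γ / 2 by ring]
    ring

theorem isFundamentalSolution_parametrix (hγ : γ ∈ Ioo (0 : ℝ) 1)
    (hb : Measurable (Function.uncurry b)) (hK : ∀ t x, |b t x| ≤ K) :
    IsFundamentalSolution (drift γ b) (parametrix γ b) := by
  obtain ⟨hm, hser, hsol, l, D, hbd⟩ := exists_parametrix hγ hb hK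
  have hms : ∀ t x s, Measurable fun y => parametrix γ b t x s y := fun t x s =>
    hm.comp measurable_const measurable_const measurable_const measurable_id
  have hsub : ∀ t x s y, s < t → |parametrix γ b t x s y - gauss (t - s) (x - y)| ≤
      D * (Real.exp (l * (t - s)) * (t - s) ^ ((1 - γ) / 2)) * gauss (2 * (t - s)) (x - y) := by
    intro t x s y hst
    have : parametrix γ b t x s y - gauss (t - s) (x - y) =
        stConv heatZ (leviSeries γ b) t x s y := by
      rw [(hser t x s y hst).2.2.2.2, heatZ_eq_gauss, add_sub_cancel_left]
    rw [this]
    exact hbd t x s y hst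
  have hgm : ∀ t x s, Measurable fun y => gauss (t - s) (x - y) := fun t x s =>
    Measurable.gauss (by fun_prop) (by fun_prop)
  have hisub : ∀ t x s, s < t →
      Integrable fun y => parametrix γ b t x s y - gauss (t - s) (x - y) := fun t x s hst =>
    ((integrable_gauss' _ x).const_mul _).mono' ((hms t x s).sub (hgm t x s)).aestronglyMeasurable
      (Eventually.of_forall fun y => hsub t x s y hst)
  refine ⟨Measurable.comp hm measurable_subtype_coe, fun s y _ => hsol s y, fun t x s _ hst => ?_,
    fun f hf ⟨M, hM⟩ s x _ => ?_⟩
  · refine ((hisub t x s hst).add (integrable_gauss' (t - s) x)).congr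
      (Eventually.of_forall fun y => ?_)
    simp only [Pi.add_apply, sub_add_cancel]
  · have h2 : Tendsto (fun t => t - s) (𝓝[>] s) (𝓝[>] 0) := by
      refine tendsto_nhdsWithin_iff.2 ⟨?_, ?_⟩
      · have : Tendsto (fun t => t - s) (𝓝 s) (𝓝 (s - s)) := Continuous.tendsto (by fun_prop) _
        rw [sub_self] at this
        exact this.mono_left nhdsWithin_le_nhds
      · filter_upwards [self_mem_nhdsWithin] with t ht
        exact sub_pos.2 (mem_Ioi.1 ht)
    have t1 : Tendsto (fun t => ∫ y, gauss (t - s) (y - x) * f y) (𝓝[>] s) (𝓝 (f x)) :=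
      (tendsto_integral_gauss_mul (f := fun _ => f) (fun _ => hf.measurable) (fun _ => hM)
        ((hf.tendsto x).comp tendsto_snd)).comp h2
    have t2 : Tendsto (fun t => ∫ y, (parametrix γ b t x s y - gauss (t - s) (x - y)) * f y)
        (𝓝[>] s) (𝓝 0) := by
      have t3 : Tendsto (fun v => D * (Real.exp (l * v) * v ^ ((1 - γ) / 2)) * M) (𝓝 0) (𝓝 0) := by
        have hc : Continuous fun v : ℝ => D * (Real.exp (l * v) * v ^ ((1 - γ) / 2)) * M := by
          have : Continuous fun v : ℝ => v ^ ((1 - γ) / 2) :=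
            Real.continuous_rpow_const (by linarith [hγ.2])
          fun_prop
        have := hc.tendsto 0
        simpa [Real.zero_rpow (show (1 - γ) / 2 ≠ 0 by linarith [hγ.2])] using this
      refine squeeze_zero_norm' ?_ ((t3.mono_left nhdsWithin_le_nhds).comp h2)
      filter_upwards [self_mem_nhdsWithin] with t ht
      have hst : s < t := ht
      have hg := (integrable_gauss' (2 * (t - s)) x).const_mul
        (D * (Real.exp (l * (t - s)) * (t - s) ^ ((1 - γ) / 2)) * M)
      refine (norm_integral_le_of_norm_le hg (Eventually.of_forall fun y => ?_)).trans
        (le_of_eq ?_)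
      · rw [norm_mul]
        calc _ ≤ (D * (Real.exp (l * (t - s)) * (t - s) ^ ((1 - γ) / 2)) *
            gauss (2 * (t - s)) (x - y)) * M :=
              mul_le_mul (hsub t x s y hst) (hM y) (abs_nonneg _)
                ((abs_nonneg _).trans (hsub t x s y hst))
          _ = _ := by ring
      · rw [integral_const_mul, integral_gauss' (by linarith), mul_one]
        rfl
    have t4 := t1.add t2
    rw [add_zero] at t4
    refine t4.congr' ?_
    filter_upwards [self_mem_nhdsWithin] with t ht
    have hst : s < t := ht
    have i1 : Integrable fun y => gauss (t - s) (y - x) * f y := by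
      simpa only [mul_comm] using (integrable_gauss (t - s) x).bdd_mul (c := M)
        hf.aestronglyMeasurable (Eventually.of_forall hM)
    have i2 : Integrable fun y => (parametrix γ b t x s y - gauss (t - s) (x - y)) * f y := by
      simpa only [mul_comm] using (hisub t x s hst).bdd_mul (c := M)
        hf.aestronglyMeasurable (Eventually.of_forall hM)
    rw [← integral_add i1 i2]
    refine integral_congr_ae (Eventually.of_forall fun y => ?_)
    simp only
    rw [gauss_sub_comm (t - s) y x]
    ring

end Levi

section Extension

variable {γ : ℝ} {b b' : ℝ → ℝ → ℝ}

theorem leviKernel_congr (h : ∀ t x, 0 < t → b t x = b' t x) {t : ℝ} (ht : 0 < t) (x s y : ℝ) :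
    leviKernel γ b t x s y = leviKernel γ b' t x s y := by
  rw [leviKernel, leviKernel, drift, drift, h t x ht]

theorem stConv_congr {f f' g g' : ParabolicKernel} {t x s y : ℝ} (hst : s < t)
    (hf : ∀ r z, f t x r z = f' t x r z) (hg : ∀ r z, s < r → g r z s y = g' r z s y) :
    stConv f g t x s y = stConv f' g' t x s y := by
  rw [stConv, stConv, intervalIntegral.integral_of_le hst.le, intervalIntegral.integral_of_le hst.le]
  refine setIntegral_congr_fun measurableSet_Ioc fun r hr => ?_
  simp only [hf, hg r _ hr.1]

theorem stConvIntegrable_congr {f f' g g' : ParabolicKernel} {t x s y : ℝ}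
    (hf : ∀ r z, f t x r z = f' t x r z) (hg : ∀ r z, s < r → g r z s y = g' r z s y)
    (h : StConvIntegrable f' g' t x s y) : StConvIntegrable f g t x s y := by
  refine IntegrableOn.congr_fun h (fun q hq => ?_) (measurableSet_Ioo.prod MeasurableSet.univ)
  simp only [hf, hg q.1 _ hq.1.1]

theorem leviTerm_congr (h : ∀ t x, 0 < t → b t x = b' t x) (m : ℕ) {s : ℝ} (hs : 0 ≤ s) (y : ℝ) :
    ∀ t x, s < t → leviTerm γ b m t x s y = leviTerm γ b' m t x s y := by
  induction m with
  | zero => exact fun t x ht => leviKernel_congr h (hs.trans_lt ht) x s y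
  | succ m ih =>
    exact fun t x ht => stConv_congr ht (fun r z => leviKernel_congr h (hs.trans_lt ht) x r z) ih

theorem leviSeries_congr (h : ∀ t x, 0 < t → b t x = b' t x) {s : ℝ} (hs : 0 ≤ s) (y t x : ℝ)
    (ht : s < t) : leviSeries γ b t x s y = leviSeries γ b' t x s y :=
  tsum_congr fun m => leviTerm_congr h m hs y t x ht

theorem LeviConvergence.congr (h : ∀ t x, 0 < t → b t x = b' t x) {k k' : ParabolicKernel}
    {t x s y : ℝ} (hs : 0 ≤ s) (hst : s < t) (hk : ∀ r z, k t x r z = k' t x r z)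
    (hc : LeviConvergence γ b' k' t x s y) : LeviConvergence γ b k t x s y := by
  have h1 := fun m r z => leviTerm_congr (γ := γ) h m hs y r z
  have h2 := fun r z => leviSeries_congr (γ := γ) h hs y r z
  refine ⟨fun m => stConvIntegrable_congr hk (h1 m) (hc.integrable_term m), ?_,
    stConvIntegrable_congr hk h2 hc.integrable, ?_⟩
  · simp only [fun m => stConv_congr hst hk (h1 m)]
    exact hc.summable
  · rw [stConv_congr hst hk h2, hc.eq_tsum]
    exact tsum_congr fun m => (stConv_congr hst hk (h1 m)).symm

theorem IsFundamentalSolution.congr {a a' : ℝ → ℝ → ℝ} {p : ParabolicKernel}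
    (hp : IsFundamentalSolution a' p) (h : ∀ t x, 0 < t → a t x = a' t x) :
    IsFundamentalSolution a p := by
  refine ⟨hp.measurable, fun s y hs => ?_, hp.integrable, hp.initial⟩
  obtain ⟨ut, ux, uxx, h1, h2, h3, h4, h5, h6⟩ := hp.solves s y hs
  refine ⟨ut, ux, uxx, h1, h2, h3, h4, h5, ?_⟩
  filter_upwards [h6] with q hq hsq
  rw [h q.1 q.2 (hs.trans_lt hsq)]
  exact hq hsq

end Extension

theorem theorem1 (γ : ℝ) (hγ : γ ∈ Ioo (0 : ℝ) 1) (b : ℝ → ℝ → ℝ)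
    (hb_meas : Measurable
      ((Ioi (0 : ℝ) ×ˢ (univ : Set ℝ)).domRestrict (Function.uncurry b)))
    (hb_bdd : ∃ K : ℝ, ∀ t x : ℝ, 0 < t → |b t x| ≤ K) :
    -- the iterated kernels are well defined and the Neumann series converges absolutely
    (∀ t x s y : ℝ, 0 ≤ s → s < t →
      (∀ m : ℕ, StConvIntegrable (leviKernel γ b) (leviTerm γ b m) t x s y) ∧
      Summable (fun m : ℕ => |leviTerm γ b m t x s y|)) ∧
    -- its sum solves the Volterra equation
    (∀ t x s y : ℝ, 0 ≤ s → s < t →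
      StConvIntegrable (leviKernel γ b) (leviSeries γ b) t x s y ∧
      leviSeries γ b t x s y =
        leviKernel γ b t x s y + stConv (leviKernel γ b) (leviSeries γ b) t x s y) ∧
    -- there is a fundamental solution, given by the parametrix formula
    ∃ p : ParabolicKernel, IsFundamentalSolution (drift γ b) p ∧
      ∀ t x s y : ℝ, 0 ≤ s → s < t →
        StConvIntegrable heatZ (leviSeries γ b) t x s y ∧
        p t x s y = heatZ t x s y + stConv heatZ (leviSeries γ b) t x s y ∧
        (∀ m : ℕ, StConvIntegrable heatZ (leviTerm γ b m) t x s y) ∧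
        Summable (fun m : ℕ => |stConv heatZ (leviTerm γ b m) t x s y|) ∧
        p t x s y = heatZ t x s y + ∑' m : ℕ, stConv heatZ (leviTerm γ b m) t x s y := by

  obtain ⟨K, hK⟩ := hb_bdd
  set b' : ℝ → ℝ → ℝ := fun t x => (Ioi (0 : ℝ) ×ˢ univ).indicator (Function.uncurry b) (t, x)
  have hbb : ∀ t x, 0 < t → b t x = b' t x := fun t x ht => by
    exact (indicator_of_mem (show (t, x) ∈ Ioi (0 : ℝ) ×ˢ univ from ⟨ht, mem_univ x⟩)
      (Function.uncurry b)).symm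
  have hb'm : Measurable (Function.uncurry b') := by
    have hQ : MeasurableSet (Ioi (0 : ℝ) ×ˢ (univ : Set ℝ)) :=
      measurableSet_Ioi.prod MeasurableSet.univ
    refine measurable_of_restrict_of_restrict_compl hQ ?_ ?_
    · convert hb_meas using 1
      ext q
      exact indicator_of_mem q.2 _
    · convert measurable_const (a := (0 : ℝ)) using 1
      ext q
      exact indicator_of_notMem q.2 _
  have hK' : ∀ t x, |b' t x| ≤ |K| := by
    intro t x
    by_cases ht : 0 < t
    · rw [← hbb t x ht]
      exact (hK t x ht).trans (le_abs_self K)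
    · have : b' t x = 0 := indicator_of_notMem (fun h => ht h.1) _
      rw [this, abs_zero]
      exact abs_nonneg K
  obtain ⟨-, hser, -, -⟩ := exists_parametrix hγ hb'm hK'
  have hker : ∀ t x s : ℝ, 0 ≤ s → s < t → ∀ r z,
      leviKernel γ b t x r z = leviKernel γ b' t x r z := fun t x s hs hst r z =>
    leviKernel_congr hbb (hs.trans_lt hst) x r z
  have hZ : ∀ t x s y : ℝ, 0 ≤ s → s < t → LeviConvergence γ b heatZ t x s y :=
    fun t x s y hs hst => (hser t x s y hst).2.2.1.congr hbb hs hst fun _ _ => rfl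
  have hL : ∀ t x s y : ℝ, 0 ≤ s → s < t → LeviConvergence γ b (leviKernel γ b) t x s y :=
    fun t x s y hs hst => (hser t x s y hst).2.1.congr hbb hs hst (hker t x s hs hst)
  have hp : ∀ t x s y : ℝ, 0 ≤ s → s < t → parametrix γ b' t x s y =
      heatZ t x s y + stConv heatZ (leviSeries γ b) t x s y := fun t x s y hs hst => by
    rw [(hser t x s y hst).2.2.2.2, stConv_congr hst (fun _ _ => rfl)
      (fun r z => leviSeries_congr hbb hs y r z)]
  refine ⟨fun t x s y hs hst => ⟨(hL t x s y hs hst).integrable_term, ?_⟩,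
    fun t x s y hs hst => ⟨(hL t x s y hs hst).integrable, ?_⟩, parametrix γ b',
    (isFundamentalSolution_parametrix hγ hb'm hK').congr fun t x ht => ?_,
    fun t x s y hs hst => ⟨(hZ t x s y hs hst).integrable, hp t x s y hs hst,
      (hZ t x s y hs hst).integrable_term, (hZ t x s y hs hst).summable, ?_⟩⟩
  · simp only [fun m => leviTerm_congr (γ := γ) hbb m hs y t x hst]
    exact (hser t x s y hst).1
  · rw [leviSeries_congr hbb hs y t x hst, (hser t x s y hst).2.2.2.1,
      stConv_congr hst (hker t x s hs hst) (fun r z => leviSeries_congr hbb hs y r z),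
      hker t x s hs hst]
  · rw [drift, drift, hbb t x ht]
  · rw [hp t x s y hs hst, (hZ t x s y hs hst).eq_tsum]
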